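/- Let $n\ge 1$ be an integer and let $n<p<\infty$. Let $L^1_p(\mathbb R^n)$ be the homogeneous Sobolev space of all real functions $F\in L_{p,\mathrm{loc}}(\mathbb R^n)$ whose first order distributional partial derivatives belong to $L_p(\mathbb R^n)$, with the seminorm $\|F\|_{L^1_p(\mathbb R^n)}=\|\nabla F\|_{L_p(\mathbb R^n)}$, where $\mathbb R^n$ carries the maximum norm; since $p>n$, each $F\in L^1_p(\mathbb R^n)$ is identified with its unique continuous representative. For a non-trivial non-negative Borel measure $\mu$ on $\mathbb R^n$ let $\Sigma=L^1_p(\mathbb R^n)+L_p(\mathbb R^n;\mu)$ be the space of all (classes modulo equality $\mu$-almost everywhere of) functions $f=f_1+f_2$ with $f_1\in L^1_p(\mathbb R^n)$ and $f_2\in L_p(\mathbb R^n;\mu)$, with $$\|f\|_{\Sigma}=\inf\{\|f_1\|_{L^1_p(\mathbb R^n)}+\|f_2\|_{L_p(\mathbb R^n;\mu)} : f_1+f_2=f,\ f_1\in L^1_p(\mathbb R^n),\ f_2\in L_p(\mathbb R^n;\mu)\},$$ and for $t>0$ let $$K(t;f)=\inf\{\|f_2\|_{L_p(\mathbb R^n;\mu)}+t\,\|f_1\|_{L^1_p(\mathbb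 R^n)} : f_1+f_2=f,\ f_1\in L^1_p(\mathbb R^n),\ f_2\in L_p(\mathbb R^n;\mu)\}.$$ **Theorem.** There is a constant $C=C(n,p)$, depending only on $n$ and $p$, such that for every non-trivial non-negative Borel measure $\mu$ on $\mathbb R^n$ the following holds. There exist continuous linear operators $T_1:\Sigma\to L^1_p(\mathbb R^n)$ and $T_2:\Sigma\to L_p(\mathbb R^n;\mu)$ such that $$T_1+T_2=\mathrm{Id}_\Sigma\qquad\text{and}\qquad \|T_1\|_{\Sigma\to L^1_p(\mathbb R^n)}+\|T_2\|_{\Sigma\to L_p(\mathbb R^n;\mu)}\le C.$$ Moreover, the couple $(L_p(\mathbb R^n;\mu),L^1_p(\mathbb R^n))$ is quasi-linearizable: for every $t>0$ there exist continuous linear operators $T_1[t]:\Sigma\to L^1_p(\mathbb R^n)$ and $T_2[t]:\Sigma\to L_p(\mathbb R^n;\mu)$ with $T_1[t]+T_2[t]=\mathrm{Id}_\Sigma$ and $$\|T_2[t]f\|_{L_p(\mathbb R^n;\mu)}+t\,\|T_1[t]f\|_{L^1_p(\mathbb R^n)}\le C\,K(t;f)\qquad\text{for all } f\in\Sigma.$$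 -/

import Mathlib

open MeasureTheory
open scoped ENNReal ContDiff

/-- `G` is the distributional gradient of the real function `F` on `ℝⁿ`:
`∫ F ∂ᵢφ = - ∫ Gᵢ φ` for every smooth compactly supported `φ` and every coordinate `i`. -/
def HasWeakGradient {n : ℕ} (F : (Fin n → ℝ) → ℝ) (G : (Fin n → ℝ) → (Fin n → ℝ)) : Prop :=
  ∀ φ : (Fin n → ℝ) → ℝ, ContDiff ℝ ∞ φ → HasCompactSupport φ → ∀ i : Fin n,
    ∫ x, F x * fderiv ℝ φ x (Pi.single i 1) = - ∫ x, G x i * φ x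

section Gradient

variable {n : ℕ} {p : ℝ≥0∞} [hp : Fact (1 ≤ p)]

lemma integrable_mul_fderiv (F : C(Fin n → ℝ, ℝ)) {φ : (Fin n → ℝ) → ℝ}
    (hφ : ContDiff ℝ ∞ φ) (hs : HasCompactSupport φ) (i : Fin n) :
    Integrable (fun x => F x * fderiv ℝ φ x (Pi.single i 1)) := by
  have hc : Continuous (fun x => fderiv ℝ φ x (Pi.single i 1)) :=
    (hφ.continuous_fderiv (by simp)).clm_apply continuous_const
  exact (F.continuous.mul hc).integrable_of_hasCompactSupport
    ((hs.fderiv_apply (𝕜 := ℝ) (Pi.single i 1)).mul_left)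

lemma locallyIntegrable_coord (G : Lp (Fin n → ℝ) p (volume : Measure (Fin n → ℝ)))
    (i : Fin n) : LocallyIntegrable (fun x => G x i) := by
  have h : MemLp (fun x => G x i) p (volume : Measure (Fin n → ℝ)) :=
    (ContinuousLinearMap.proj (R := ℝ) (φ := fun _ : Fin n => ℝ) i).comp_memLp' (Lp.memLp G)
  exact h.locallyIntegrable hp.out

lemma integrable_coord_mul (G : Lp (Fin n → ℝ) p (volume : Measure (Fin n → ℝ)))
    {φ : (Fin n → ℝ) → ℝ} (hφ : ContDiff ℝ ∞ φ) (hs : HasCompactSupport φ) (i : Fin n) :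
    Integrable (fun x => G x i * φ x) := by
  have := (locallyIntegrable_coord G i).integrable_smul_left_of_hasCompactSupport
    hφ.continuous hs
  simpa [mul_comm] using this

lemma HasWeakGradient.add {F F' : C(Fin n → ℝ, ℝ)}
    {G G' : Lp (Fin n → ℝ) p (volume : Measure (Fin n → ℝ))}
    (h : HasWeakGradient F G) (h' : HasWeakGradient F' G') :
    HasWeakGradient (F + F' : C(Fin n → ℝ, ℝ)) (G + G' : Lp (Fin n → ℝ) p volume) := by
  intro φ hφ hs i
  have e : ∫ x, (G + G' : Lp (Fin n → ℝ) p volume) x i * φ x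
      = ∫ x, (G x i * φ x + G' x i * φ x) := by
    refine integral_congr_ae ?_
    filter_upwards [Lp.coeFn_add G G'] with x hx
    rw [hx]; simp [add_mul]
  rw [e, integral_add (integrable_coord_mul G hφ hs i) (integrable_coord_mul G' hφ hs i),
    neg_add, ← h φ hφ hs i, ← h' φ hφ hs i,
    ← integral_add (integrable_mul_fderiv F hφ hs i) (integrable_mul_fderiv F' hφ hs i)]
  simp [add_mul]

set_option linter.unusedSectionVars false in
lemma HasWeakGradient.smul (c : ℝ) {F : C(Fin n → ℝ, ℝ)}
    {G : Lp (Fin n → ℝ) p (volume : Measure (Fin n → ℝ))} (h : HasWeakGradient F G) :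
    HasWeakGradient (c • F : C(Fin n → ℝ, ℝ)) (c • G : Lp (Fin n → ℝ) p volume) := by
  intro φ hφ hs i
  have e : ∫ x, (c • G : Lp (Fin n → ℝ) p volume) x i * φ x = ∫ x, c * (G x i * φ x) := by
    refine integral_congr_ae ?_
    filter_upwards [Lp.coeFn_smul c G] with x hx
    rw [hx]; simp [mul_assoc]
  rw [e, integral_const_mul, ← mul_neg, ← h φ hφ hs i, ← integral_const_mul]
  simp [mul_assoc]

/-- The distributional gradient is unique almost everywhere. -/
lemma HasWeakGradient.unique {F : C(Fin n → ℝ, ℝ)}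
    {G G' : Lp (Fin n → ℝ) p (volume : Measure (Fin n → ℝ))}
    (h : HasWeakGradient F G) (h' : HasWeakGradient F G') : G = G' := by
  have key : ∀ i : Fin n, ∀ᵐ x ∂(volume : Measure (Fin n → ℝ)), G x i = G' x i := by
    intro i
    refine ae_eq_of_integral_contDiff_smul_eq (locallyIntegrable_coord G i)
      (locallyIntegrable_coord G' i) ?_
    intro φ hφ hs
    have := (h φ hφ hs i).symm.trans (h' φ hφ hs i)
    simpa [mul_comm] using this
  refine Lp.ext ?_
  filter_upwards [ae_all_iff.2 key] with x hx
  exact funext hx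

end Gradient

/-- The continuous functions on `ℝⁿ` whose first order distributional partial derivatives belong
to `L_p(ℝⁿ)`. -/
def sobolevSubmodule (n : ℕ) (p : ℝ≥0∞) [Fact (1 ≤ p)] : Submodule ℝ C(Fin n → ℝ, ℝ) where
  carrier := {F | ∃ G : Lp (Fin n → ℝ) p (volume : Measure (Fin n → ℝ)), HasWeakGradient F G}
  zero_mem' := ⟨0, by
    intro φ _ _ i
    have e : ∫ x, (0 : Lp (Fin n → ℝ) p (volume : Measure (Fin n → ℝ))) x i * φ x = 0 := by
      refine integral_eq_zero_of_ae ?_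
      filter_upwards [Lp.coeFn_zero (Fin n → ℝ) p (volume : Measure (Fin n → ℝ))] with x hx
      rw [hx]; simp
    rw [e]; simp⟩
  add_mem' := by
    rintro F F' ⟨G, h⟩ ⟨G', h'⟩
    exact ⟨G + G', h.add h'⟩
  smul_mem' := by
    rintro c F ⟨G, h⟩
    exact ⟨c • G, h.smul c⟩

/-- The homogeneous Sobolev space `L¹_p(ℝⁿ)`, for `n < p < ∞`. In this range every element (a class
of functions modulo equality Lebesgue almost everywhere) has a unique continuous representative;
elements are identified with these representatives. The seminorm is defined below. -/
def HomSobolev (n : ℕ) (p : ℝ≥0∞) [Fact (1 ≤ p)] : Type := sobolevSubmodule n p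

namespace HomSobolev

variable {n : ℕ} {p : ℝ≥0∞} [Fact (1 ≤ p)]

noncomputable instance : AddCommGroup (HomSobolev n p) :=
  inferInstanceAs (AddCommGroup (sobolevSubmodule n p))

noncomputable instance : Module ℝ (HomSobolev n p) :=
  inferInstanceAs (Module ℝ (sobolevSubmodule n p))

/-- The continuous function underlying an element of `L¹_p(ℝⁿ)`. -/
def toContinuousMap : HomSobolev n p →ₗ[ℝ] C(Fin n → ℝ, ℝ) := (sobolevSubmodule n p).subtype

lemma exists_gradient (F : HomSobolev n p) :
    ∃ G : Lp (Fin n → ℝ) p (volume : Measure (Fin n → ℝ)),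
      HasWeakGradient (toContinuousMap F) G := F.2

/-- The distributional gradient `∇F ∈ L_p(ℝⁿ; ℝⁿ)`. -/
noncomputable def gradient :
    HomSobolev n p →ₗ[ℝ] Lp (Fin n → ℝ) p (volume : Measure (Fin n → ℝ)) where
  toFun F := (exists_gradient F).choose
  map_add' F F' := (exists_gradient (F + F')).choose_spec.unique
    ((exists_gradient F).choose_spec.add (exists_gradient F').choose_spec)
  map_smul' c F := (exists_gradient (c • F)).choose_spec.unique
    ((exists_gradient F).choose_spec.smul c)

lemma hasWeakGradient_gradient (F : HomSobolev n p) :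
    HasWeakGradient (toContinuousMap F) (gradient F) := (exists_gradient F).choose_spec

/-- The seminorm of `L¹_p(ℝⁿ)` is `‖F‖ = ‖∇F‖_{L_p(ℝⁿ)}`, see `HomSobolev.norm_def`. The length of
a vector of `ℝⁿ` is measured by the maximum norm, which is the norm of `Fin n → ℝ`. -/
noncomputable instance : SeminormedAddCommGroup (HomSobolev n p) :=
  SeminormedAddCommGroup.induced _ _ (gradient (n := n) (p := p))

noncomputable instance : NormedSpace ℝ (HomSobolev n p) :=
  NormedSpace.induced ℝ _ _ (gradient (n := n) (p := p))

lemma norm_def (F : HomSobolev n p) : ‖F‖ = ‖gradient F‖ := rfl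

/-- The class modulo equality `μ`-almost everywhere of (the continuous representative of) a
function of `L¹_p(ℝⁿ)`. -/
noncomputable def toAEEqFun (μ : Measure (Fin n → ℝ)) :
    HomSobolev n p →ₗ[ℝ] ((Fin n → ℝ) →ₘ[μ] ℝ) where
  toFun F := AEEqFun.mk (toContinuousMap F) (toContinuousMap F).continuous.aestronglyMeasurable
  map_add' F F' := by
    rw [AEEqFun.mk_add_mk]
    exact AEEqFun.mk_eq_mk.2 (Filter.Eventually.of_forall fun x => by simp)
  map_smul' c F := by
    refine Eq.trans ?_ (AEEqFun.smul_mk c (toContinuousMap F : (Fin n → ℝ) → ℝ)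
      (toContinuousMap F).continuous.aestronglyMeasurable)
    exact AEEqFun.mk_eq_mk.2 (Filter.Eventually.of_forall fun x => by simp)

end HomSobolev

/-- `L¹_p(ℝⁿ) + L_p(ℝⁿ; μ)` as a linear space of classes of functions modulo equality
`μ`-almost everywhere. -/
noncomputable def sumSubmodule (n : ℕ) (p : ℝ≥0∞) [Fact (1 ≤ p)] (μ : Measure (Fin n → ℝ)) :
    Submodule ℝ ((Fin n → ℝ) →ₘ[μ] ℝ) :=
  LinearMap.range (HomSobolev.toAEEqFun (p := p) μ) ⊔ Lp.LpSubmodule ℝ ℝ p μ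

/-- The space `Σ = L¹_p(ℝⁿ) + L_p(ℝⁿ; μ)`. Its seminorm is defined below. -/
def SumSpace (n : ℕ) (p : ℝ≥0∞) [Fact (1 ≤ p)] (μ : Measure (Fin n → ℝ)) : Type :=
  sumSubmodule n p μ

namespace SumSpace

variable {n : ℕ} {p : ℝ≥0∞} [Fact (1 ≤ p)] {μ : Measure (Fin n → ℝ)}

noncomputable instance : AddCommGroup (SumSpace n p μ) :=
  inferInstanceAs (AddCommGroup (sumSubmodule n p μ))

noncomputable instance : Module ℝ (SumSpace n p μ) :=
  inferInstanceAs (Module ℝ (sumSubmodule n p μ))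

/-- The inclusion of `L¹_p(ℝⁿ)` into `Σ`. -/
noncomputable def ofSobolev : HomSobolev n p →ₗ[ℝ] SumSpace n p μ :=
  LinearMap.codRestrict (sumSubmodule n p μ) (HomSobolev.toAEEqFun μ)
    (fun F => Submodule.mem_sup_left (LinearMap.mem_range_self _ F))

/-- The inclusion of `L_p(ℝⁿ; μ)` into `Σ`. -/
noncomputable def ofLp : Lp ℝ p μ →ₗ[ℝ] SumSpace n p μ :=
  LinearMap.codRestrict (sumSubmodule n p μ) (Lp.LpSubmodule ℝ ℝ p μ).subtype
    (fun h => Submodule.mem_sup_right h.2)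

lemma exists_decomposition (f : SumSpace n p μ) :
    ∃ (f₁ : HomSobolev n p) (f₂ : Lp ℝ p μ), ofSobolev f₁ + ofLp f₂ = f := by
  obtain ⟨f, hf⟩ := f
  obtain ⟨_, ⟨F, rfl⟩, h, hh, rfl⟩ := Submodule.mem_sup.1 hf
  exact ⟨F, ⟨h, hh⟩, rfl⟩

/-- The `K`-functional of the couple `(L_p(ℝⁿ; μ), L¹_p(ℝⁿ))`:
`K(t; f) = inf {‖f₂‖ + t ‖f₁‖ : f₁ + f₂ = f, f₁ ∈ L¹_p(ℝⁿ), f₂ ∈ L_p(ℝⁿ; μ)}`. -/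
noncomputable def kFunctional (t : ℝ) (f : SumSpace n p μ) : ℝ :=
  sInf {r : ℝ | ∃ (f₁ : HomSobolev n p) (f₂ : Lp ℝ p μ),
    ofSobolev f₁ + ofLp f₂ = f ∧ r = ‖f₂‖ + t * ‖f₁‖}

/-- `‖f‖_Σ = inf {‖f₁‖ + ‖f₂‖ : f₁ + f₂ = f, f₁ ∈ L¹_p(ℝⁿ), f₂ ∈ L_p(ℝⁿ; μ)}`. -/
noncomputable instance : Norm (SumSpace n p μ) where
  norm f := sInf {r : ℝ | ∃ (f₁ : HomSobolev n p) (f₂ : Lp ℝ p μ),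
    ofSobolev f₁ + ofLp f₂ = f ∧ r = ‖f₁‖ + ‖f₂‖}

lemma norm_def (f : SumSpace n p μ) :
    ‖f‖ = sInf {r : ℝ | ∃ (f₁ : HomSobolev n p) (f₂ : Lp ℝ p μ),
      ofSobolev f₁ + ofLp f₂ = f ∧ r = ‖f₁‖ + ‖f₂‖} := rfl

lemma norm_le_of_decomposition {f : SumSpace n p μ} {f₁ : HomSobolev n p} {f₂ : Lp ℝ p μ}
    (h : ofSobolev f₁ + ofLp f₂ = f) : ‖f‖ ≤ ‖f₁‖ + ‖f₂‖ :=
  csInf_le ⟨0, by rintro r ⟨g₁, g₂, -, rfl⟩; positivity⟩ ⟨f₁, f₂, h, rfl⟩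

lemma exists_decomposition_lt {f : SumSpace n p μ} {r : ℝ} (hr : ‖f‖ < r) :
    ∃ (f₁ : HomSobolev n p) (f₂ : Lp ℝ p μ),
      ofSobolev f₁ + ofLp f₂ = f ∧ ‖f₁‖ + ‖f₂‖ < r := by
  obtain ⟨F, h, hf⟩ := exists_decomposition f
  have hne : {r : ℝ | ∃ (f₁ : HomSobolev n p) (f₂ : Lp ℝ p μ),
      ofSobolev f₁ + ofLp f₂ = f ∧ r = ‖f₁‖ + ‖f₂‖}.Nonempty := ⟨_, F, h, hf, rfl⟩
  obtain ⟨_, ⟨f₁, f₂, hd, rfl⟩, hlt⟩ := exists_lt_of_csInf_lt hne hr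
  exact ⟨f₁, f₂, hd, hlt⟩

lemma sum_norm_nonneg (f : SumSpace n p μ) : 0 ≤ ‖f‖ :=
  Real.sInf_nonneg (by rintro r ⟨g₁, g₂, -, rfl⟩; positivity)

lemma sum_norm_add_le (f g : SumSpace n p μ) : ‖f + g‖ ≤ ‖f‖ + ‖g‖ := by
  refine le_of_forall_pos_le_add fun ε hε => ?_
  obtain ⟨f₁, f₂, hf, hf'⟩ := exists_decomposition_lt (lt_add_of_pos_right ‖f‖ (half_pos hε))
  obtain ⟨g₁, g₂, hg, hg'⟩ := exists_decomposition_lt (lt_add_of_pos_right ‖g‖ (half_pos hε))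
  have h : ofSobolev (f₁ + g₁) + ofLp (f₂ + g₂) = f + g := by
    rw [map_add, map_add, ← hf, ← hg]; abel
  have := norm_le_of_decomposition h
  have h1 := norm_add_le f₁ g₁
  have h2 := norm_add_le f₂ g₂
  linarith

lemma sum_norm_smul_le (c : ℝ) (f : SumSpace n p μ) : ‖c • f‖ ≤ ‖c‖ * ‖f‖ := by
  refine le_of_forall_pos_le_add fun ε hε => ?_
  have hc : 0 < ‖c‖ + 1 := by positivity
  obtain ⟨f₁, f₂, hf, hf'⟩ := exists_decomposition_lt
    (lt_add_of_pos_right ‖f‖ (div_pos hε hc))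
  have h : ofSobolev (c • f₁) + ofLp (c • f₂) = c • f := by
    rw [map_smul, map_smul, ← hf, smul_add]
  have h0 := norm_le_of_decomposition h
  rw [norm_smul c f₁, norm_smul c f₂, ← mul_add] at h0
  have h1 : ‖c‖ * (‖f₁‖ + ‖f₂‖) ≤ ‖c‖ * (‖f‖ + ε / (‖c‖ + 1)) :=
    mul_le_mul_of_nonneg_left hf'.le (norm_nonneg c)
  have h2 : ‖c‖ * (ε / (‖c‖ + 1)) ≤ ε := by
    rw [mul_div_assoc', div_le_iff₀ hc]; nlinarith [norm_nonneg c]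
  nlinarith

lemma sum_norm_zero : ‖(0 : SumSpace n p μ)‖ = 0 := by
  refine le_antisymm ?_ (sum_norm_nonneg _)
  simpa using sum_norm_smul_le (0 : ℝ) (0 : SumSpace n p μ)

lemma sum_norm_neg (f : SumSpace n p μ) : ‖-f‖ = ‖f‖ := by
  have h : ∀ g : SumSpace n p μ, ‖-g‖ ≤ ‖g‖ := fun g => by
    simpa using sum_norm_smul_le (-1 : ℝ) g
  exact le_antisymm (h f) (by simpa using h (-f))

noncomputable instance : SeminormedAddCommGroup (SumSpace n p μ) :=
  AddGroupSeminorm.toSeminormedAddCommGroup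
    { toFun := fun f => ‖f‖
      map_zero' := sum_norm_zero
      add_le' := sum_norm_add_le
      neg' := sum_norm_neg }

noncomputable instance : NormedSpace ℝ (SumSpace n p μ) where
  norm_smul_le := sum_norm_smul_le

end SumSpace

/-! Write β = p - n. Changing a function by a unit amount on a ball of radius R costs about R^(-β)
in the p-th power of the gradient norm, while it costs ν(ball) in the p-th power of the L_p(ν) norm.
The critical radius ρ(x) is the scale at which the two costs balance. Below it the measure is cheap,
so f may be replaced there by constants. Replacing μ by ν = t^(-p) μ reduces every t to the case t =
1.

ρ is 1-Lipschitz, so the set {ρ > 0} has a Whitney partition of unity φⱼ with radii rⱼ = ρ(xⱼ). The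
first component of f is taken to be ∑ cⱼ φⱼ on {ρ > 0}, with cⱼ a ν-average of f near xⱼ, and f₁
itself on {ρ = 0}. Averages over balls around xⱼ may be meaningless, since such balls can have
infinite mass. Each xⱼ is therefore given a node, an almost minimum point of ρ at distance at most 8
rⱼ. If ρ(node) > 0, the ball of radius 2ρ(node) has finite mass at least (2ρ(node))^(-β). If ρ(node)
= 0, every ball around the node has infinite mass, and then the continuous part at the node is
determined by f alone, because a continuous function in L_p(ν) vanishes there
(`eq_zero_of_ae_add_eq_zero`). In both cases cⱼ is linear in f and independent of the decomposition.

For a given decomposition f = f₁ + f₂ the first component is f₁ plus the correction ∑ φⱼ (cⱼ - f₁).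
If eⱼ bounds |cⱼ - f₁| near xⱼ, the p-th powers of both norms of the correction are governed by ∑
rⱼ^(-β) eⱼ^p. The error eⱼ splits into a Morrey oscillation of f₁ (`exists_morrey` with an exponent
q between n and p), summed by the Carleson embedding `tsum_volume_ball_mul_average_rpow_le` in
`tsum_gradErr_le`, and an average of |f₂|, summed in `tsum_avgErr_le`. Since the result does not
depend on the decomposition, the bound holds for all decompositions at once, which gives the
K-functional. -/

section QuasiLinearization

open Metric
open scoped NNReal Convolution

variable {n : ℕ}

/-! ### Morrey's inequality. -/

/-- Hölder against the constant 1. It is left unnormalised so as to serve balls, probability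
averages and counting measure alike. -/
lemma lintegral_rpow_le_measure_univ_rpow_mul {α : Type*} {m0 : MeasurableSpace α} (m : Measure α)
    {q : ℝ} (hq : 1 ≤ q) {g : α → ℝ≥0∞} (hg : AEMeasurable g m) :
    (∫⁻ x, g x ∂m) ^ q ≤ m Set.univ ^ (q - 1) * ∫⁻ x, g x ^ q ∂m := by
  rcases hq.eq_or_lt with rfl | hq
  · simp
  have h := ENNReal.lintegral_mul_le_Lp_mul_Lq m (Real.HolderConjugate.conjExponent hq).symm
    (aemeasurable_const (b := (1 : ℝ≥0∞))) hg
  simp only [Pi.mul_apply, one_mul, ENNReal.one_rpow, lintegral_const] at h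
  calc _ ≤ (m Set.univ ^ (1 / Real.conjExponent q) * (∫⁻ x, g x ^ q ∂m) ^ (1 / q)) ^ q := by
        gcongr
    _ = _ := by
        rw [ENNReal.mul_rpow_of_nonneg _ _ (by linarith), ← ENNReal.rpow_mul, ← ENNReal.rpow_mul]
        congr 2
        · rw [Real.conjExponent]; field_simp
        · rw [one_div_mul_cancel (by linarith)]; simp

lemma lintegral_comp_smul_add {t : ℝ} (ht : 0 < t) (c : Fin n → ℝ) {k : (Fin n → ℝ) → ℝ≥0∞}
    (hk : Measurable k) :
    ∫⁻ y, k (t • y + c) = ENNReal.ofReal (t ^ n)⁻¹ * ∫⁻ y, k y := by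
  have h1 : ∫⁻ y, k (t • y + c) = ∫⁻ y, k (y + c) ∂(Measure.map (t • ·) volume) := by
    rw [lintegral_map (by fun_prop) (by fun_prop)]
  rw [h1, Measure.map_addHaar_smul _ ht.ne', lintegral_smul_measure,
    lintegral_add_right_eq_self (fun y => k y) c]
  simp [abs_of_pos ht]

/-- The reflected translate φ(z - ·) is the test function to insert in the definition of the weak
gradient. -/
lemma fderiv_convolution_single_eq {F : (Fin n → ℝ) → ℝ} (hF : Continuous F)
    {G : (Fin n → ℝ) → (Fin n → ℝ)} (h : HasWeakGradient F G) {φ : (Fin n → ℝ) → ℝ}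
    (hφ : ContDiff ℝ ∞ φ) (hs : HasCompactSupport φ) (z : Fin n → ℝ) (i : Fin n) :
    fderiv ℝ (φ ⋆[ContinuousLinearMap.lsmul ℝ ℝ] F) z (Pi.single i 1) =
      ∫ w, G (z - w) i * φ w := by
  have h1 := hs.hasFDerivAt_convolution_left (ContinuousLinearMap.lsmul ℝ ℝ)
    (hφ.of_le (by simp)) (hF.locallyIntegrable (μ := volume)) z
  rw [h1.fderiv]
  have hex := (hs.fderiv ℝ).convolutionExists_left
    ((ContinuousLinearMap.lsmul ℝ ℝ : ℝ →L[ℝ] ℝ →L[ℝ] ℝ).precompL (Fin n → ℝ))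
    (hφ.continuous_fderiv (by simp)) (hF.locallyIntegrable (μ := volume)) z
  rw [convolution_def, ContinuousLinearMap.integral_apply hex]
  set ψ : (Fin n → ℝ) → ℝ := fun u => φ (z - u) with hψ
  have hψd : ∀ u v, fderiv ℝ ψ u v = - fderiv ℝ φ (z - u) v := by
    intro u v
    have : HasFDerivAt ψ ((fderiv ℝ φ (z - u)).comp (-ContinuousLinearMap.id ℝ (Fin n → ℝ))) u :=
      ((hφ.differentiable (by simp)) (z - u)).hasFDerivAt.comp u
        ((hasFDerivAt_id u).const_sub z)
    rw [this.fderiv]; simp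
  have hψs : HasCompactSupport ψ := hs.comp_homeomorph (Homeomorph.subLeft z)
  have key := h ψ (by fun_prop) hψs i
  rw [← integral_sub_left_eq_self _ volume z]
  simp only [hψd] at key
  simp only [hψ, ContinuousLinearMap.precompL_apply, ContinuousLinearMap.lsmul_apply, smul_eq_mul, sub_sub_cancel] at key ⊢
  rw [← integral_sub_left_eq_self (fun w => G (z - w) i * φ w) volume z]
  simp only [sub_sub_cancel]
  have := neg_injective (by rw [← key, ← integral_neg]; congr 1; ext x; ring :
    - ∫ x, F x * fderiv ℝ φ (z - x) (Pi.single i 1) = - ∫ x, G x i * φ (z - x))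
  rw [← this]; congr 1; ext; ring

lemma enorm_le_card_mul_of_single_le (L : (Fin n → ℝ) →L[ℝ] ℝ) {B : ℝ≥0∞}
    (hB : ∀ i, ‖L (Pi.single i 1)‖ₑ ≤ B) (v : Fin n → ℝ) : ‖L v‖ₑ ≤ n * B * ‖v‖ₑ := by
  have : L v = ∑ i, v i * L (Pi.single i 1) := by
    conv_lhs => rw [← Finset.univ_sum_single v]
    rw [map_sum]
    refine Finset.sum_congr rfl fun i _ => ?_
    rw [← smul_eq_mul, ← map_smul]; congr 1
    rw [← Pi.single_smul]; simp
  rw [this]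
  refine (enorm_sum_le _ _).trans ?_
  calc _ ≤ ∑ i : Fin n, ‖v‖ₑ * B := by
        refine Finset.sum_le_sum fun i _ => ?_
        rw [enorm_mul]; gcongr
        · exact enorm_le_iff_norm_le.2 (norm_le_pi_norm v i)
        · exact hB i
    _ = _ := by simp; ring

lemma enorm_fderiv_convolution_le {F : (Fin n → ℝ) → ℝ} (hF : Continuous F)
    {G : (Fin n → ℝ) → (Fin n → ℝ)} (h : HasWeakGradient F G) {φ : (Fin n → ℝ) → ℝ}
    (hφ : ContDiff ℝ ∞ φ) (hs : HasCompactSupport φ) (z v : Fin n → ℝ) :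
    ‖fderiv ℝ (φ ⋆[ContinuousLinearMap.lsmul ℝ ℝ] F) z v‖ₑ ≤
      n * (∫⁻ w, ‖G (z - w)‖ₑ * ‖φ w‖ₑ) * ‖v‖ₑ := by
  refine enorm_le_card_mul_of_single_le _ (fun i => ?_) v
  rw [fderiv_convolution_single_eq hF h hφ hs]
  refine (enorm_integral_le_lintegral_enorm _).trans (lintegral_mono fun w => ?_)
  rw [enorm_mul]; gcongr
  exact enorm_le_iff_norm_le.2 (norm_le_pi_norm _ i)

lemma enorm_sub_le_lintegral_fderiv {u : (Fin n → ℝ) → ℝ} (hu : ContDiff ℝ 1 u)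
    (x y : Fin n → ℝ) :
    ‖u y - u x‖ₑ ≤ ∫⁻ t in Set.Ioc (0 : ℝ) 1, ‖fderiv ℝ u (t • (y - x) + x) (y - x)‖ₑ := by
  have hd : ∀ t : ℝ, HasDerivAt (fun t : ℝ => u (t • (y - x) + x))
      (fderiv ℝ u (t • (y - x) + x) (y - x)) t := by
    intro t
    have h1 : HasDerivAt (fun t : ℝ => t • (y - x) + x) (y - x) t := by
      simpa using ((hasDerivAt_id t).smul_const (y - x)).add_const x
    exact ((hu.differentiable one_ne_zero _).hasFDerivAt.comp_hasDerivAt t h1)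
  have hc : Continuous fun t : ℝ => fderiv ℝ u (t • (y - x) + x) (y - x) :=
    ((hu.continuous_fderiv one_ne_zero).comp (by fun_prop)).clm_apply continuous_const
  have := intervalIntegral.integral_eq_sub_of_hasDerivAt (a := 0) (b := 1)
    (fun t _ => hd t) (hc.intervalIntegrable _ _)
  simp only [one_smul, sub_add_cancel, zero_smul, zero_add] at this
  rw [← this, intervalIntegral.integral_of_le zero_le_one]
  exact enorm_integral_le_lintegral_enorm _

/-- The affine substitution y ↦ t y + c maps the ball into its double and costs a Jacobian t^(-n).
After Hölder and the q-th root this becomes t^(-n/q), which is integrable on (0, 1] when q > n. -/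
lemma lintegral_ball_comp_smul_le {a x w : Fin n → ℝ} {R t q : ℝ} (ht : t ∈ Set.Ioc (0 : ℝ) 1)
    (hx : x ∈ closedBall a R) (hw : ‖w‖ ≤ R) (hq : 1 ≤ q) {g : (Fin n → ℝ) → ℝ≥0∞}
    (hg : Measurable g) :
    ∫⁻ y in ball a R, g (t • (y - x) + x - w) ≤
      ENNReal.ofReal (t ^ (-(n / q : ℝ))) *
        (volume (ball a R) ^ (q - 1) * ∫⁻ y in ball a (2 * R), g y ^ q) ^ (1 / q) := by
  have hq0 : 0 < q := by linarith
  set c : Fin n → ℝ := x - t • x - w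
  have hc : ∀ y, t • (y - x) + x - w = t • y + c := fun y => by simp only [c, smul_sub]; abel
  have hsub : ∀ y ∈ ball a R, t • y + c ∈ ball a (2 * R) := by
    intro y hy
    rw [mem_ball, dist_eq_norm] at hy ⊢
    rw [mem_closedBall, dist_eq_norm] at hx
    have : t • y + c - a = t • (y - a) + (1 - t) • (x - a) - w := by
      simp only [c, smul_sub, sub_smul, one_smul]; abel
    rw [this]
    have h1 := norm_sub_le (t • (y - a) + (1 - t) • (x - a)) w
    have h2 := norm_add_le (t • (y - a)) ((1 - t) • (x - a))
    rw [norm_smul, norm_smul, Real.norm_of_nonneg ht.1.le,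
      Real.norm_of_nonneg (sub_nonneg.2 ht.2)] at h2
    nlinarith [ht.1, ht.2]
  have hgm : Measurable fun y => g (t • (y - x) + x - w) := by fun_prop
  have h1 := lintegral_rpow_le_measure_univ_rpow_mul (volume.restrict (ball a R)) hq
    hgm.aemeasurable
  have h2 : ∫⁻ y in ball a R, g (t • (y - x) + x - w) ^ q ≤
      ENNReal.ofReal (t ^ n)⁻¹ * ∫⁻ y in ball a (2 * R), g y ^ q := by
    rw [← lintegral_indicator measurableSet_ball (fun y => g y ^ q),
      ← lintegral_comp_smul_add ht.1 c ((hg.pow_const q).indicator measurableSet_ball),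
      ← lintegral_indicator measurableSet_ball]
    refine lintegral_mono fun y => ?_
    by_cases hy : y ∈ ball a R
    · rw [Set.indicator_of_mem hy, Set.indicator_of_mem (hsub y hy), hc]
    · rw [Set.indicator_of_notMem hy]; exact zero_le
  rw [Measure.restrict_apply_univ] at h1
  calc _ = ((∫⁻ y in ball a R, g (t • (y - x) + x - w)) ^ q) ^ (1 / q) := by
        rw [← ENNReal.rpow_mul, mul_one_div_cancel hq0.ne', ENNReal.rpow_one]
    _ ≤ (volume (ball a R) ^ (q - 1) *
          (ENNReal.ofReal (t ^ n)⁻¹ * ∫⁻ y in ball a (2 * R), g y ^ q)) ^ (1 / q) := by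
        gcongr; exact h1.trans (by gcongr)
    _ = _ := by
        rw [mul_left_comm, ENNReal.mul_rpow_of_nonneg _ _ (by positivity)]
        congr 1
        rw [ENNReal.ofReal_rpow_of_nonneg (by have := ht.1; positivity) (by positivity)]
        congr 1
        rw [← Real.rpow_natCast, ← Real.rpow_neg ht.1.le, ← Real.rpow_mul ht.1.le]
        congr 1; ring

/-- The Morrey inequality for mollified functions, averaged over a ball. -/
lemma lintegral_ball_enorm_sub_convolution_le {F : (Fin n → ℝ) → ℝ} (hF : Continuous F)
    {G : (Fin n → ℝ) → (Fin n → ℝ)} (hG : Measurable G) (h : HasWeakGradient F G)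
    {φ : (Fin n → ℝ) → ℝ}
    (hφ : ContDiff ℝ ∞ φ) (hs : HasCompactSupport φ) (hφ1 : ∫⁻ w, ‖φ w‖ₑ = 1)
    {a x : Fin n → ℝ} {R q : ℝ} (hsR : ∀ w, φ w ≠ 0 → ‖w‖ ≤ R)
    (hx : x ∈ closedBall a R) (hq : 1 ≤ q) :
    ∫⁻ y in ball a R, ‖(φ ⋆[ContinuousLinearMap.lsmul ℝ ℝ] F) y -
        (φ ⋆[ContinuousLinearMap.lsmul ℝ ℝ] F) x‖ₑ ≤
      (∫⁻ t in Set.Ioc (0 : ℝ) 1, ENNReal.ofReal (t ^ (-(n / q : ℝ)))) * (n * ENNReal.ofReal (2 * R)) *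
        (volume (ball a R) ^ (q - 1) * ∫⁻ y in ball a (2 * R), ‖G y‖ₑ ^ q) ^ (1 / q) := by
  set u := φ ⋆[ContinuousLinearMap.lsmul ℝ ℝ] F with hu_def
  have hu : ContDiff ℝ 1 u := hs.contDiff_convolution_left _
    (hφ.of_le (by simp)) (hF.locallyIntegrable)
  set A := (volume (ball a R) ^ (q - 1) * ∫⁻ y in ball a (2 * R), ‖G y‖ₑ ^ q) ^ (1 / q)
  set g : ℝ → (Fin n → ℝ) → ℝ≥0∞ := fun t y => ∫⁻ w, ‖G (t • (y - x) + x - w)‖ₑ * ‖φ w‖ₑ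
  have hφm : Measurable φ := hφ.continuous.measurable
  have hgm : Measurable (Function.uncurry fun (y : Fin n → ℝ) (t : ℝ) => g t y) := by
    simp only [g, Function.uncurry_def]
    refine Measurable.lintegral_prod_right' (f := fun z : ((Fin n → ℝ) × ℝ) × (Fin n → ℝ) =>
      ‖G (z.1.2 • (z.1.1 - x) + x - z.2)‖ₑ * ‖φ z.2‖ₑ) ?_
    fun_prop
  calc ∫⁻ y in ball a R, ‖u y - u x‖ₑ
      ≤ ∫⁻ y in ball a R, ∫⁻ t in Set.Ioc (0 : ℝ) 1, n * ENNReal.ofReal (2 * R) * g t y := by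
        refine setLIntegral_mono' measurableSet_ball fun y hy => ?_
        refine (enorm_sub_le_lintegral_fderiv hu x y).trans (lintegral_mono fun t => ?_)
        refine (enorm_fderiv_convolution_le hF h hφ hs _ _).trans ?_
        rw [mul_right_comm]
        gcongr
        rw [← ofReal_norm]
        gcongr
        rw [← dist_eq_norm]
        have := dist_triangle_right y x a
        rw [mem_ball] at hy
        rw [mem_closedBall] at hx
        linarith
    _ = ∫⁻ t in Set.Ioc (0 : ℝ) 1, ∫⁻ y in ball a R, n * ENNReal.ofReal (2 * R) * g t y :=
        lintegral_lintegral_swap (hgm.const_mul _).aemeasurable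
    _ ≤ ∫⁻ t in Set.Ioc (0 : ℝ) 1,
          n * ENNReal.ofReal (2 * R) * (ENNReal.ofReal (t ^ (-(n / q : ℝ))) * A) := by
        refine setLIntegral_mono' measurableSet_Ioc fun t ht => ?_
        rw [lintegral_const_mul' _ _ (by finiteness)]
        gcongr
        simp only [g]
        rw [lintegral_lintegral_swap (by fun_prop)]
        calc _ ≤ ∫⁻ w, (ENNReal.ofReal (t ^ (-(n / q : ℝ))) * A) * ‖φ w‖ₑ := by
              refine lintegral_mono fun w => ?_
              rw [lintegral_mul_const' _ _ (by finiteness)]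
              rcases eq_or_ne (φ w) 0 with h0 | h0
              · simp [h0]
              · gcongr
                exact lintegral_ball_comp_smul_le ht hx (hsR w h0) hq (g := fun z => ‖G z‖ₑ)
                  (by fun_prop)
          _ = _ := by rw [lintegral_const_mul _ (by fun_prop), hφ1, mul_one]
    _ = _ := by
        rw [lintegral_const_mul' _ _ (by finiteness), lintegral_mul_const _ (by fun_prop)]
        ring

lemma lintegral_Ioc_rpow_neg_lt_top {s : ℝ} (hs : s < 1) :
    ∫⁻ t in Set.Ioc (0 : ℝ) 1, ENNReal.ofReal (t ^ (-s)) < ⊤ := by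
  have h := intervalIntegral.intervalIntegrable_rpow' (a := 0) (b := 1) (r := -s) (by linarith)
  rw [intervalIntegrable_iff_integrableOn_Ioc_of_le zero_le_one] at h
  refine lt_of_le_of_lt (lintegral_mono fun t => ?_) h.2
  exact Real.ofReal_le_enorm _

/-- **Morrey's inequality** on balls of the maximum norm. -/
lemma exists_morrey {q : ℝ} (hq : 1 ≤ q) (hn : (n : ℝ) < q) :
    ∃ C : ℝ≥0∞, C ≠ ⊤ ∧ ∀ (F : (Fin n → ℝ) → ℝ) (_ : Continuous F)
      (G : (Fin n → ℝ) → (Fin n → ℝ)) (_ : Measurable G) (_ : HasWeakGradient F G)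
      (a : Fin n → ℝ) (R : ℝ) (_ : 0 < R), ∀ x ∈ closedBall a R, ∀ y ∈ closedBall a R,
      ‖F x - F y‖ₑ ≤ C * ENNReal.ofReal R *
        ((volume (ball a R))⁻¹ * ∫⁻ y in ball a (2 * R), ‖G y‖ₑ ^ q) ^ (1 / q) := by
  have hq0 : 0 < q := by linarith
  set c := ∫⁻ t in Set.Ioc (0 : ℝ) 1, ENNReal.ofReal (t ^ (-(n / q : ℝ)))
  have hc : c < ⊤ := lintegral_Ioc_rpow_neg_lt_top ((div_lt_one hq0).2 hn)
  -- The outer 2 comes from joining x to y through a third point, n from passing from coordinate to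
  -- directional derivatives, and the inner 2 from |y - x| ≤ 2R.
  refine ⟨2 * (c * (n * 2)), by finiteness, ?_⟩
  intro F hF G hG h a R hR x hx y hy
  set V := volume (ball a R) with hV
  have hV0 : V ≠ 0 := (measure_ball_pos _ _ hR).ne'
  have hVt : V ≠ ⊤ := measure_ball_lt_top.ne
  set I := ∫⁻ y in ball a (2 * R), ‖G y‖ₑ ^ q
  -- The mollifiers have support in radius at most R, so on the ball of radius R the smoothed
  -- gradient sees `G` only on the doubled ball.
  let b : ℕ → ContDiffBump (0 : Fin n → ℝ) := fun k =>
    { rIn := R / (2 * (k + 1)), rOut := R / (k + 1), rIn_pos := by positivity,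
      rIn_lt_rOut := by gcongr; linarith [(Nat.cast_nonneg k : (0:ℝ) ≤ k)] }
  let u : ℕ → (Fin n → ℝ) → ℝ := fun k =>
    ((b k).normed volume ⋆[ContinuousLinearMap.lsmul ℝ ℝ] F)
  have hb : Filter.Tendsto (fun k => (b k).rOut) Filter.atTop (nhds 0) := by
    have := (tendsto_one_div_add_atTop_nhds_zero_nat (𝕜 := ℝ)).const_mul R
    simpa [b, div_eq_mul_inv] using this
  have hlim : ∀ z, Filter.Tendsto (fun k => u k z) Filter.atTop (nhds (F z)) :=
    fun z => ContDiffBump.convolution_tendsto_right_of_continuous hb hF z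
  have hlim2 : Filter.Tendsto (fun k => ‖u k x - u k y‖ₑ) Filter.atTop (nhds ‖F x - F y‖ₑ) :=
    ((hlim x).sub (hlim y)).enorm
  refine le_of_tendsto' hlim2 fun k => ?_
  have hb1 : ∫⁻ w, ‖(b k).normed volume w‖ₑ = 1 := by
    have h1 := ofReal_integral_eq_lintegral_ofReal (b k).integrable_normed
      (Filter.Eventually.of_forall (b k).nonneg_normed) (μ := volume)
    rw [(b k).integral_normed, ENNReal.ofReal_one] at h1
    rw [h1]
    exact lintegral_congr fun w => Real.enorm_of_nonneg ((b k).nonneg_normed w)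
  have hbs : ∀ w, (b k).normed volume w ≠ 0 → ‖w‖ ≤ R := by
    intro w hw
    have : w ∈ Function.support ((b k).normed volume) := hw
    rw [(b k).support_normed_eq, mem_ball_zero_iff] at this
    refine this.le.trans ?_
    exact div_le_self hR.le (by linarith [(Nat.cast_nonneg k : (0:ℝ) ≤ k)])
  have key : ∀ z ∈ closedBall a R, ∫⁻ y in ball a R, ‖u k y - u k z‖ₑ ≤
      c * (n * ENNReal.ofReal (2 * R)) * (V ^ (q - 1) * I) ^ (1 / q) := fun z hz =>
    lintegral_ball_enorm_sub_convolution_le hF hG h (b k).contDiff_normed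
      (b k).hasCompactSupport_normed hb1 hbs hz hq
  have huc : Continuous (u k) := by
    refine HasCompactSupport.continuous_convolution_left _ (b k).hasCompactSupport_normed
      (b k).continuous_normed hF.locallyIntegrable
  have h2 : V * ‖u k x - u k y‖ₑ ≤
      2 * (c * (n * ENNReal.ofReal (2 * R)) * (V ^ (q - 1) * I) ^ (1 / q)) := by
    calc V * ‖u k x - u k y‖ₑ = ∫⁻ z in ball a R, ‖u k x - u k y‖ₑ := by
          rw [setLIntegral_const, mul_comm]
      _ ≤ ∫⁻ z in ball a R, (‖u k z - u k x‖ₑ + ‖u k z - u k y‖ₑ) := by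
          refine lintegral_mono fun z => ?_
          rw [← enorm_neg (u k z - u k x)]
          refine le_trans (le_of_eq ?_) (enorm_add_le _ _)
          congr 1; ring
      _ ≤ _ := by
          rw [lintegral_add_left (by fun_prop), two_mul]
          exact add_le_add (key x hx) (key y hy)
  have h3 : V⁻¹ * (V ^ (q - 1) * I) ^ (1 / q) = (V⁻¹ * I) ^ (1 / q) := by
    have : V⁻¹ = (V⁻¹ ^ q) ^ (1 / q) := by
      rw [← ENNReal.rpow_mul, mul_one_div_cancel hq0.ne', ENNReal.rpow_one]
    conv_lhs => rw [this]
    rw [← ENNReal.mul_rpow_of_nonneg _ _ (by positivity), ← mul_assoc]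
    congr 2
    rw [ENNReal.inv_rpow, ← ENNReal.rpow_neg, ← ENNReal.rpow_add _ _ hV0 hVt,
      show -q + (q - 1) = -1 by ring, ENNReal.rpow_neg_one]
  calc ‖u k x - u k y‖ₑ = V⁻¹ * (V * ‖u k x - u k y‖ₑ) := by
        rw [← mul_assoc, ENNReal.inv_mul_cancel hV0 hVt, one_mul]
    _ ≤ V⁻¹ * (2 * (c * (n * ENNReal.ofReal (2 * R)) * (V ^ (q - 1) * I) ^ (1 / q))) := by gcongr
    _ = 2 * (c * (n * 2)) * ENNReal.ofReal R * (V⁻¹ * (V ^ (q - 1) * I) ^ (1 / q)) := by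
        rw [ENNReal.ofReal_mul (by norm_num), ENNReal.ofReal_ofNat]; ring
    _ = _ := by rw [h3]

/-! ### A Carleson embedding for separated balls. -/

/-- Layer-cake formula for a single value. The value ⊤ must be admitted because averages of an
arbitrary measurable function may be infinite. -/
lemma lintegral_Ioi_indicator_rpow (a : ℝ≥0∞) {s : ℝ} (hs : 0 < s) :
    ∫⁻ t in Set.Ioi (0 : ℝ), {t : ℝ | ENNReal.ofReal t < a}.indicator
      (fun t => ENNReal.ofReal (t ^ (s - 1))) t = a ^ s / ENNReal.ofReal s := by
  have main : ∀ b : ℝ, 0 ≤ b →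
      ∫⁻ t in Set.Ioo (0 : ℝ) b, ENNReal.ofReal (t ^ (s - 1)) =
        ENNReal.ofReal b ^ s / ENNReal.ofReal s := by
    intro b hb
    rw [setLIntegral_congr Ioo_ae_eq_Ioc, ← ofReal_integral_eq_lintegral_ofReal,
      ← intervalIntegral.integral_of_le hb, integral_rpow (Or.inl (by linarith)),
      ENNReal.ofReal_rpow_of_nonneg hb hs.le, ← ENNReal.ofReal_div_of_pos hs]
    · simp [hs.ne']
    · exact (intervalIntegrable_iff_integrableOn_Ioc_of_le hb).1
        (intervalIntegral.intervalIntegrable_rpow' (by linarith))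
    · exact (ae_restrict_mem measurableSet_Ioc).mono fun t ht => Real.rpow_nonneg ht.1.le _
  have hm : MeasurableSet {t : ℝ | ENNReal.ofReal t < a} :=
    measurableSet_lt ENNReal.measurable_ofReal measurable_const
  rw [lintegral_indicator hm, Measure.restrict_restrict hm]
  rcases eq_or_ne a ⊤ with rfl | ha
  · have h2 : ∀ N : ℕ, (N : ℝ≥0∞) ^ s / ENNReal.ofReal s ≤
        ∫⁻ t in {t : ℝ | ENNReal.ofReal t < ⊤} ∩ Set.Ioi 0, ENNReal.ofReal (t ^ (s - 1)) := by
      intro N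
      rw [← ENNReal.ofReal_natCast, ← main N (by positivity)]
      exact lintegral_mono_set fun t ht => ⟨ENNReal.ofReal_lt_top, ht.1⟩
    rw [ENNReal.top_rpow_of_pos hs, ENNReal.top_div_of_ne_top ENNReal.ofReal_ne_top, eq_top_iff]
    have h3 : Filter.Tendsto (fun N : ℕ => (N : ℝ≥0∞) ^ s / ENNReal.ofReal s) Filter.atTop
        (nhds ⊤) := by
      have := ENNReal.Tendsto.div_const
        (((ENNReal.continuous_rpow_const (y := s)).tendsto ⊤).comp ENNReal.tendsto_nat_nhds_top)
        (b := ENNReal.ofReal s) (Or.inl (by simp [hs]))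
      simpa [ENNReal.top_rpow_of_pos hs, ENNReal.top_div_of_ne_top] using this
    exact le_of_tendsto' h3 h2
  · have : {t : ℝ | ENNReal.ofReal t < a} ∩ Set.Ioi 0 = Set.Ioo 0 a.toReal := by
      ext t
      simp only [Set.mem_inter_iff, Set.mem_ofPred_eq, Set.mem_Ioi, Set.mem_Ioo]
      rw [and_comm]
      refine and_congr_right fun h0 => ?_
      rw [ENNReal.ofReal_lt_iff_lt_toReal h0.le ha]
    rw [this, main _ ENNReal.toReal_nonneg, ENNReal.ofReal_toReal ha]

lemma volume_ball_mul (x : Fin n → ℝ) {c r : ℝ} (hc : 0 < c) (hr : 0 < r) :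
    volume (ball x (c * r)) = ENNReal.ofReal (c ^ n) * volume (ball x r) := by
  rw [Real.volume_pi_ball _ (by positivity), Real.volume_pi_ball _ hr,
    ← ENNReal.ofReal_mul (by positivity), Fintype.card_fin, ← mul_pow]
  congr 2; ring

/-- The weak type estimate behind `tsum_volume_ball_mul_average_rpow_le`. -/
lemma sum_volume_ball_le_of_lt_average {ι : Type*} {x : ι → Fin n → ℝ} {r : ι → ℝ}
    (hr : ∀ j, 0 < r j) {ε : ℝ} (hε : 0 < ε) (hε1 : ε ≤ 1)
    (hd : Pairwise (Function.onFun Disjoint fun j => ball (x j) (ε * r j)))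
    {g : (Fin n → ℝ) → ℝ≥0∞} (hg : Measurable g) {l : ℝ≥0∞} (hl : l ≠ 0) (hl' : l ≠ ⊤)
    (S : Finset ι)
    (hS : ∀ j ∈ S, l < (volume (ball (x j) (r j)))⁻¹ * ∫⁻ y in ball (x j) (r j), g y) :
    ∑ j ∈ S, volume (ball (x j) (r j)) ≤
      ENNReal.ofReal ((5 / ε) ^ n) * 2 * (l⁻¹ * ∫⁻ y, {y | l < 2 * g y}.indicator g y) := by
  -- Where 2g ≤ l, the function adds at most l/2 to any average, so an average above l owes at least
  -- l/2 to `g'`. This truncation is what makes the weak estimate integrable in l afterwards.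
  set g' := {y | l < 2 * g y}.indicator g
  have hgm : MeasurableSet {y | l < 2 * g y} := measurableSet_lt measurable_const (by fun_prop)
  have hg'm : Measurable g' := hg.indicator hgm
  have h1 : ∀ j ∈ S, volume (ball (x j) (r j)) ≤ 2 * l⁻¹ * ∫⁻ y in ball (x j) (r j), g' y := by
    intro j hj
    set V := volume (ball (x j) (r j))
    have hV0 : V ≠ 0 := (measure_ball_pos _ _ (hr j)).ne'
    have hVt : V ≠ ⊤ := measure_ball_lt_top.ne
    have h2 : ∫⁻ y in ball (x j) (r j), g y ≤ (∫⁻ y in ball (x j) (r j), g' y) + l / 2 * V := by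
      rw [← setLIntegral_const, ← lintegral_add_left hg'm]
      refine lintegral_mono fun y => ?_
      by_cases hy : l < 2 * g y
      · simp [g', Set.indicator_of_mem (s := {y | l < 2 * g y}) hy]
      · refine le_add_left ?_
        rw [ENNReal.le_div_iff_mul_le (by simp) (by simp), mul_comm]
        exact not_lt.1 hy
    have h3 : l * V ≤ (∫⁻ y in ball (x j) (r j), g' y) + l / 2 * V := by
      refine le_trans ?_ h2
      have := (hS j hj).le
      rwa [mul_comm V⁻¹, ← div_eq_mul_inv, ENNReal.le_div_iff_mul_le (Or.inl hV0) (Or.inl hVt)]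
        at this
    have h4 : l / 2 * V ≤ ∫⁻ y in ball (x j) (r j), g' y := by
      have h5 : l * V = l / 2 * V + l / 2 * V := by rw [← add_mul, ENNReal.add_halves]
      rw [h5] at h3
      exact (ENNReal.add_le_add_iff_right (by finiteness)).1 h3
    calc V = 2 * l⁻¹ * (l / 2 * V) := by
          rw [div_eq_mul_inv, ← mul_assoc, ← mul_assoc, mul_assoc 2, ENNReal.inv_mul_cancel hl hl',
            mul_one, ENNReal.mul_inv_cancel (by simp) (by simp), one_mul]
      _ ≤ _ := by gcongr
  obtain ⟨R, hR⟩ : ∃ R, ∀ j ∈ (S : Set ι), r j ≤ R := by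
    obtain ⟨R, hR⟩ := (S.finite_toSet.image r).bddAbove
    exact ⟨R, fun j hj => hR ⟨j, hj, rfl⟩⟩
  -- The selected balls are disjoint, so their integrals of `g'` add up. The discarded balls are
  -- recovered by volume: all ε-shrunk balls are disjoint and lie in the 5-fold enlargements of the
  -- selected ones.
  obtain ⟨u, huS, hud, hu⟩ := Vitali.exists_disjoint_subfamily_covering_enlargement_ball
    (S : Set ι) x r R hR 5 (by norm_num)
  lift u to Finset ι using S.finite_toSet.subset huS
  have huS' : u ⊆ S := by exact_mod_cast huS
  have hsum : ∑ j ∈ S, volume (ball (x j) (ε * r j)) ≤ ∑ b ∈ u, volume (ball (x b) (5 * r b)) := by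
    rw [← measure_biUnion_finset (fun i _ j _ hij => hd hij) (fun j _ => measurableSet_ball)]
    refine (measure_mono ?_).trans (measure_biUnion_finset_le u _)
    refine Set.iUnion₂_subset fun j hj => ?_
    obtain ⟨b, hb, hjb⟩ := hu j hj
    refine ((ball_subset_ball ?_).trans hjb).trans (Set.subset_biUnion_of_mem (u := fun b => ball (x b) (5 * r b)) hb)
    have := hr j
    nlinarith
  have hεn : ENNReal.ofReal (ε ^ n) ≠ 0 := by simp; positivity
  calc ∑ j ∈ S, volume (ball (x j) (r j))
      = (ENNReal.ofReal (ε ^ n))⁻¹ * ∑ j ∈ S, volume (ball (x j) (ε * r j)) := by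
        simp_rw [fun j => volume_ball_mul (x j) hε (hr j)]
        rw [← Finset.mul_sum, ← mul_assoc, ENNReal.inv_mul_cancel hεn ENNReal.ofReal_ne_top, one_mul]
    _ ≤ (ENNReal.ofReal (ε ^ n))⁻¹ * ∑ b ∈ u, volume (ball (x b) (5 * r b)) := by gcongr
    _ = ENNReal.ofReal ((5 / ε) ^ n) * ∑ b ∈ u, volume (ball (x b) (r b)) := by
        simp_rw [fun j => volume_ball_mul (x j) (by norm_num : (0:ℝ) < 5) (hr j)]
        rw [← Finset.mul_sum, ← mul_assoc, div_pow, ENNReal.ofReal_div_of_pos (by positivity),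
          div_eq_mul_inv, mul_comm (ENNReal.ofReal (5 ^ n))]
    _ ≤ ENNReal.ofReal ((5 / ε) ^ n) * ∑ b ∈ u, 2 * l⁻¹ * ∫⁻ y in ball (x b) (r b), g' y := by
        gcongr with b hb
        exact h1 b (huS' hb)
    _ = ENNReal.ofReal ((5 / ε) ^ n) * 2 * (l⁻¹ * ∑ b ∈ u, ∫⁻ y in ball (x b) (r b), g' y) := by
        rw [← Finset.mul_sum]; ring
    _ ≤ _ := by
        gcongr
        rw [← lintegral_biUnion_finset hud (fun j _ => measurableSet_ball)]
        exact setLIntegral_le_lintegral _ _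

/-- A Carleson embedding: for balls whose `ε`-shrinkings are disjoint, the averages of `g` over the
balls are controlled in `L_s` by `g`, for `s > 1`. -/
lemma tsum_volume_ball_mul_average_rpow_le {ι : Type*} {x : ι → Fin n → ℝ} {r : ι → ℝ}
    (hr : ∀ j, 0 < r j) {ε : ℝ} (hε : 0 < ε) (hε1 : ε ≤ 1)
    (hd : Pairwise (Function.onFun Disjoint fun j => ball (x j) (ε * r j)))
    {g : (Fin n → ℝ) → ℝ≥0∞} (hg : Measurable g) {s : ℝ} (hs : 1 < s) :
    ∑' j, volume (ball (x j) (r j)) *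
        ((volume (ball (x j) (r j)))⁻¹ * ∫⁻ y in ball (x j) (r j), g y) ^ s ≤
      ENNReal.ofReal s * (ENNReal.ofReal ((5 / ε) ^ n) * 2) * (2 ^ (s - 1) / ENNReal.ofReal (s - 1))
        * ∫⁻ y, g y ^ s := by
  set V : ι → ℝ≥0∞ := fun j => volume (ball (x j) (r j))
  set a : ι → ℝ≥0∞ := fun j => (V j)⁻¹ * ∫⁻ y in ball (x j) (r j), g y
  set C := ENNReal.ofReal ((5 / ε) ^ n) * 2
  have hs0 : ENNReal.ofReal s ≠ 0 := by simp; linarith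
  have hs1 : 0 < s - 1 := by linarith
  rw [ENNReal.tsum_eq_iSup_sum]
  refine iSup_le fun S => ?_
  have hm : ∀ b : ℝ≥0∞, MeasurableSet {t : ℝ | ENNReal.ofReal t < b} := fun b =>
    measurableSet_lt ENNReal.measurable_ofReal measurable_const
  calc ∑ j ∈ S, V j * a j ^ s
      = ENNReal.ofReal s * ∑ j ∈ S, V j * ∫⁻ t in Set.Ioi (0 : ℝ),
          {t : ℝ | ENNReal.ofReal t < a j}.indicator (fun t => ENNReal.ofReal (t ^ (s - 1))) t := by
        rw [Finset.mul_sum]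
        refine Finset.sum_congr rfl fun j _ => ?_
        rw [lintegral_Ioi_indicator_rpow _ (by linarith), mul_left_comm,
          ENNReal.mul_div_cancel hs0 ENNReal.ofReal_ne_top]
    _ = ENNReal.ofReal s * ∫⁻ t in Set.Ioi (0 : ℝ), ∑ j ∈ S, V j *
          {t : ℝ | ENNReal.ofReal t < a j}.indicator (fun t => ENNReal.ofReal (t ^ (s - 1))) t := by
        rw [lintegral_finsetSum]
        · congr 1
          refine Finset.sum_congr rfl fun j _ => ?_
          rw [lintegral_const_mul]
          exact Measurable.indicator (by fun_prop) (hm _)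
        · intro j _
          exact (Measurable.indicator (by fun_prop) (hm _)).const_mul _
    -- The weak type estimate at level t contributes t⁻¹, lowering the power of t to s - 2. This is
    -- still integrable at 0 because s > 1.
    _ ≤ ENNReal.ofReal s * ∫⁻ t in Set.Ioi (0 : ℝ), C * ∫⁻ y,
          {t : ℝ | ENNReal.ofReal t < 2 * g y}.indicator
            (fun t => ENNReal.ofReal (t ^ (s - 1 - 1))) t * g y := by
        gcongr ENNReal.ofReal s * ?_
        refine setLIntegral_mono' measurableSet_Ioi fun t ht => ?_
        have ht0 : (0 : ℝ) < t := ht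
        classical
        have hw := sum_volume_ball_le_of_lt_average hr hε hε1 hd hg
          (l := ENNReal.ofReal t) (by simpa using ht0) ENNReal.ofReal_ne_top
          (S.filter fun j => ENNReal.ofReal t < a j) (fun j hj => (Finset.mem_filter.1 hj).2)
        calc _ = (∑ j ∈ S.filter fun j => ENNReal.ofReal t < a j, V j) *
              ENNReal.ofReal (t ^ (s - 1)) := by
              rw [Finset.sum_mul, Finset.sum_filter]
              refine Finset.sum_congr rfl fun j _ => ?_
              by_cases h : ENNReal.ofReal t < a j <;> simp [h]
          _ ≤ _ := mul_le_mul_left hw _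
          _ = C * (((ENNReal.ofReal t)⁻¹ * ENNReal.ofReal (t ^ (s - 1))) *
                ∫⁻ y, {y | ENNReal.ofReal t < 2 * g y}.indicator g y) := by ring
          _ = _ := by
              rw [← lintegral_const_mul' _ _ (by
                have : ENNReal.ofReal t ≠ 0 := by simpa using ht0
                finiteness)]
              congr 1
              refine lintegral_congr fun y => ?_
              have : ENNReal.ofReal (t ^ (s - 1 - 1)) =
                  (ENNReal.ofReal t)⁻¹ * ENNReal.ofReal (t ^ (s - 1)) := by
                rw [← ENNReal.ofReal_inv_of_pos ht0, ← ENNReal.ofReal_mul (by positivity),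
                  Real.rpow_sub_one ht0.ne' (s - 1)]
                congr 1; field_simp
              by_cases h : ENNReal.ofReal t < 2 * g y <;> simp [h, this]
    _ = ENNReal.ofReal s * (C * ∫⁻ y, ∫⁻ t in Set.Ioi (0 : ℝ),
          {t : ℝ | ENNReal.ofReal t < 2 * g y}.indicator
            (fun t => ENNReal.ofReal (t ^ (s - 1 - 1))) t * g y) := by
        have hmm : Measurable (Function.uncurry fun (t : ℝ) (y : Fin n → ℝ) =>
            {t : ℝ | ENNReal.ofReal t < 2 * g y}.indicator
            (fun t => ENNReal.ofReal (t ^ (s - 1 - 1))) t * g y) := by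
          refine Measurable.mul ?_ (by fun_prop)
          exact Measurable.indicator (s := {z : ℝ × (Fin n → ℝ) | ENNReal.ofReal z.1 < 2 * g z.2})
            (f := fun z : ℝ × (Fin n → ℝ) => ENNReal.ofReal (z.1 ^ (s - 1 - 1)))
            (by fun_prop) (measurableSet_lt (by fun_prop) (by fun_prop))
        rw [lintegral_const_mul' _ _ (by finiteness), lintegral_lintegral_swap hmm.aemeasurable]
    _ = ENNReal.ofReal s * (C * ∫⁻ y, 2 ^ (s - 1) / ENNReal.ofReal (s - 1) * g y ^ s) := by
        congr 2
        refine lintegral_congr fun y => ?_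
        rw [lintegral_mul_const _ (Measurable.indicator (by fun_prop) (hm _)),
          lintegral_Ioi_indicator_rpow _ hs1, ENNReal.mul_rpow_of_nonneg _ _ hs1.le]
        have : g y ^ s = g y ^ (s - 1) * g y := by
          conv_rhs => rw [← ENNReal.rpow_one (g y)]
          rw [← ENNReal.rpow_mul, one_mul, ← ENNReal.rpow_add_of_nonneg _ _ hs1.le zero_le_one]
          congr 1; ring
        rw [this]; simp only [div_eq_mul_inv]; ring
    _ = _ := by
        rw [lintegral_const_mul _ (by fun_prop)]; ring

/-! ### The critical radius of a measure. -/

/-- The largest radius `R` of balls with centre `x` such that `ν (B(x, R)) ≤ R ^ (-β)`. -/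
noncomputable def criticalRadius (ν : Measure (Fin n → ℝ)) (β : ℝ) (x : Fin n → ℝ) : ℝ :=
  sSup {R : ℝ | 0 ≤ R ∧ ν (ball x R) ≤ ENNReal.ofReal R ^ (-β)}

namespace criticalRadius

variable {ν : Measure (Fin n → ℝ)} {β : ℝ}

lemma zero_mem (x : Fin n → ℝ) :
    (0 : ℝ) ∈ {R : ℝ | 0 ≤ R ∧ ν (ball x R) ≤ ENNReal.ofReal R ^ (-β)} := by
  simp

lemma le_of_le (hβ : 0 ≤ β) {x y : Fin n → ℝ} {R S : ℝ} (hRS : R ≤ S)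
    (hb : ball x R ⊆ ball y S) (h : ν (ball y S) ≤ ENNReal.ofReal S ^ (-β)) :
    ν (ball x R) ≤ ENNReal.ofReal R ^ (-β) := by
  refine (measure_mono hb).trans (h.trans ?_)
  rw [ENNReal.rpow_neg, ENNReal.rpow_neg]
  exact ENNReal.inv_le_inv.2 (ENNReal.rpow_le_rpow (ENNReal.ofReal_le_ofReal hRS) hβ)

/-- If arbitrarily large radii were admissible, every ball would have mass at most R^(-β) for all
large R, hence mass 0, and `ν` would be trivial. -/
lemma bddAbove (hν : ν ≠ 0) (hβ : 0 < β) (x : Fin n → ℝ) :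
    BddAbove {R : ℝ | 0 ≤ R ∧ ν (ball x R) ≤ ENNReal.ofReal R ^ (-β)} := by
  by_contra hb
  refine hν ?_
  have h1 : ∀ R : ℝ, ν (ball x R) ≤ ENNReal.ofReal R ^ (-β) := by
    intro R
    obtain ⟨S, hS, hRS⟩ := not_bddAbove_iff.1 hb R
    exact le_of_le hβ.le hRS.le (ball_subset_ball hRS.le) hS.2
  have h2 : Filter.Tendsto (fun R : ℝ => ENNReal.ofReal R ^ (-β)) Filter.atTop (nhds 0) := by
    have := (ENNReal.continuous_rpow_const (y := -β)).tendsto ⊤ |>.comp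
      ENNReal.tendsto_ofReal_atTop
    rwa [ENNReal.top_rpow_of_neg (neg_neg_iff_pos.2 hβ)] at this
  have h3 : ∀ k : ℕ, ν (ball x k) = 0 := by
    intro k
    refine le_antisymm (ge_of_tendsto h2 ?_) zero_le
    filter_upwards [Filter.eventually_ge_atTop (k : ℝ)] with R hR
    exact (measure_mono (ball_subset_ball hR)).trans (h1 R)
  rw [← Measure.measure_univ_eq_zero, ← iUnion_ball_nat x]
  exact measure_iUnion_null h3

lemma nonneg (x : Fin n → ℝ) : 0 ≤ criticalRadius ν β x :=
  Real.sSup_nonneg fun _ h => h.1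

lemma measure_ball_le (hβ : 0 < β) {x : Fin n → ℝ} {R : ℝ}
    (hR : R < criticalRadius ν β x) : ν (ball x R) ≤ ENNReal.ofReal R ^ (-β) := by
  obtain ⟨S, hS, hRS⟩ := exists_lt_of_lt_csSup ⟨0, zero_mem x⟩ hR
  exact le_of_le hβ.le hRS.le (ball_subset_ball hRS.le) hS.2

lemma lt_measure_ball (hν : ν ≠ 0) (hβ : 0 < β) {x : Fin n → ℝ} {R : ℝ}
    (hR : criticalRadius ν β x < R) : ENNReal.ofReal R ^ (-β) < ν (ball x R) := by
  by_contra h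
  exact hR.not_ge (le_csSup (bddAbove hν hβ x) ⟨(nonneg x).trans hR.le, not_lt.1 h⟩)

/-- If R is admissible at x, then R - dist x y is admissible at y: the ball only shrinks and the
threshold only grows. -/
lemma le_add_dist (hν : ν ≠ 0) (hβ : 0 < β) (x y : Fin n → ℝ) :
    criticalRadius ν β x ≤ criticalRadius ν β y + dist x y := by
  refine csSup_le ⟨0, zero_mem x⟩ fun R hR => ?_
  rcases le_or_gt R (dist x y) with h | h
  · linarith [nonneg (ν := ν) (β := β) y]
  · have : R - dist x y ≤ criticalRadius ν β y := by
      refine le_csSup (bddAbove hν hβ y) ⟨by linarith, ?_⟩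
      refine le_of_le hβ.le (sub_le_self _ dist_nonneg) (ball_subset_ball' ?_) hR.2
      rw [dist_comm y x]; linarith
    linarith

/-- The ball contains all balls of small radius S, whose masses exceed S^(-β) → ∞. -/
lemma measure_ball_eq_top (hν : ν ≠ 0) (hβ : 0 < β) {x : Fin n → ℝ}
    (hx : criticalRadius ν β x = 0) {R : ℝ} (hR : 0 < R) : ν (ball x R) = ⊤ := by
  have h1 : Filter.Tendsto (fun S : ℝ => ENNReal.ofReal S ^ (-β)) (nhdsWithin 0 (Set.Ioi 0))
      (nhds ⊤) := by
    have h0 : Filter.Tendsto (fun S : ℝ => ENNReal.ofReal S) (nhdsWithin 0 (Set.Ioi 0))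
        (nhds 0) := by
      have := (ENNReal.continuous_ofReal.tendsto 0).mono_left
        (nhdsWithin_le_nhds (s := Set.Ioi (0:ℝ)))
      simpa using this
    have := ((ENNReal.continuous_rpow_const (y := -β)).tendsto 0).comp h0
    rwa [ENNReal.zero_rpow_of_neg (neg_neg_iff_pos.2 hβ)] at this
  refine top_le_iff.1 (le_of_tendsto h1 ?_)
  filter_upwards [self_mem_nhdsWithin, mem_nhdsWithin_of_mem_nhds (Iio_mem_nhds hR)] with S hS hSR
  exact (lt_measure_ball hν hβ (hx.trans_lt hS)).le.trans
    (measure_mono (ball_subset_ball (le_of_lt hSR)))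

lemma measure_lt_top_of_isCompact (hβ : 0 < β) {K : Set (Fin n → ℝ)} (hK : IsCompact K)
    (h : ∀ x ∈ K, 0 < criticalRadius ν β x) : ν K < ⊤ := by
  refine hK.measure_lt_top_of_nhdsWithin fun x hx => ?_
  have hx' := h x hx
  refine ⟨ball x (criticalRadius ν β x / 2), mem_nhdsWithin_of_mem_nhds
    (ball_mem_nhds _ (by positivity)), (measure_ball_le hβ (half_lt_self hx')).trans_lt ?_⟩
  have : ENNReal.ofReal (criticalRadius ν β x / 2) ≠ 0 := by simpa using hx'
  finiteness

end criticalRadius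

/-! ### Whitney coverings and cutoffs for a nonnegative 1-Lipschitz function. -/

section Whitney

variable {ρ : (Fin n → ℝ) → ℝ}

/-- Take a maximal family with disjoint shrunken balls. An uncovered y has dist y x > ρ x / 4 for
every centre, hence ρ x + ρ y ≤ 2 ρ x + dist y x < 16 dist y x, and y could be added. -/
lemma exists_whitney_centres (hL : ∀ x y, ρ x ≤ ρ y + dist x y) :
    ∃ X : Set (Fin n → ℝ), X.Countable ∧ (∀ x ∈ X, 0 < ρ x) ∧
      X.PairwiseDisjoint (fun x => ball x (ρ x / 16)) ∧
      ∀ y, 0 < ρ y → ∃ x ∈ X, y ∈ closedBall x (ρ x / 4) := by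
  obtain ⟨X, hX⟩ := zorn_subset {X : Set (Fin n → ℝ) | (∀ x ∈ X, 0 < ρ x) ∧
      X.PairwiseDisjoint (fun x => ball x (ρ x / 16))} (by
    intro c hc hchain
    refine ⟨⋃₀ c, ⟨?_, ?_⟩, fun s hs => Set.subset_sUnion_of_mem hs⟩
    · rintro x ⟨s, hs, hx⟩
      exact (hc hs).1 x hx
    · exact (Set.pairwiseDisjoint_sUnion hchain.directedOn).2 fun s hs => (hc hs).2)
  refine ⟨X, ?_, hX.prop.1, hX.prop.2, ?_⟩
  · refine hX.prop.2.countable_of_isOpen (fun _ _ => isOpen_ball) fun x hx => ?_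
    have := hX.prop.1 x hx
    exact nonempty_ball.2 (by positivity)
  · intro y hy
    by_contra hcon
    push Not at hcon
    have hyX : y ∉ X := fun h => hcon y h (mem_closedBall_self (by positivity))
    refine hyX (hX.le_of_ge (y := insert y X) ⟨?_, ?_⟩ (Set.subset_insert _ _)
      (Set.mem_insert _ _))
    · rintro x (rfl | hx)
      exacts [hy, hX.prop.1 x hx]
    · refine hX.prop.2.insert fun x hx _ => ?_
      have h1 := hcon x hx
      rw [mem_closedBall, not_le] at h1
      refine ball_disjoint_ball ?_
      have := hL y x
      linarith

/-- Volume packing. If y lies in the ball of x then ρ x ≤ 2 ρ y ≤ 3 ρ x, so the disjoint balls of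
radius ρ x / 16 all sit in the ball of radius 2 ρ y, and each has at least the fraction 48^(-n) of
its volume. -/
lemma tsum_indicator_ball_le {X : Set (Fin n → ℝ)} (hXc : X.Countable) (hX : ∀ x ∈ X, 0 < ρ x)
    (hL : ∀ x y, ρ x ≤ ρ y + dist x y)
    (hd : X.PairwiseDisjoint (fun x => ball x (ρ x / 16))) (y : Fin n → ℝ) :
    ∑' x : X, (ball (x : Fin n → ℝ) (ρ x / 2)).indicator (fun _ => (1 : ℝ≥0∞)) y ≤
      ENNReal.ofReal (48 ^ n) := by
  have := hXc.to_subtype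
  by_cases hy : ∃ x : X, y ∈ ball (x : Fin n → ℝ) (ρ x / 2)
  swap
  · push Not at hy
    simp [hy]
  have hρy : 0 < ρ y := by
    obtain ⟨x, hx⟩ := hy
    rw [mem_ball, dist_comm] at hx
    have := hL x y
    have := hX x x.2
    linarith
  set V := volume (ball y (2 * ρ y))
  have hV0 : V ≠ 0 := (measure_ball_pos _ _ (by positivity)).ne'
  have hVt : V ≠ ⊤ := measure_ball_lt_top.ne
  have h1 : ∀ x : X, (ball (x : Fin n → ℝ) (ρ x / 2)).indicator (fun _ => (1 : ℝ≥0∞)) y ≤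
      ENNReal.ofReal (48 ^ n) * V⁻¹ *
        volume (ball (x : Fin n → ℝ) (ρ x / 16) ∩ ball y (2 * ρ y)) := by
    intro x
    by_cases hx : y ∈ ball (x : Fin n → ℝ) (ρ x / 2)
    swap
    · simp [hx]
    rw [Set.indicator_of_mem hx]
    have hxp := hX x x.2
    rw [mem_ball] at hx
    have h2 := hL x y
    have h3 := hL y x
    rw [dist_comm] at h2
    have hsub : ball (x : Fin n → ℝ) (ρ x / 16) ⊆ ball y (2 * ρ y) :=
      ball_subset_ball' (by rw [dist_comm]; linarith)
    rw [Set.inter_eq_left.2 hsub]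
    calc (1 : ℝ≥0∞) = V⁻¹ * V := (ENNReal.inv_mul_cancel hV0 hVt).symm
      _ ≤ V⁻¹ * volume (ball y (48 * (ρ x / 16))) := by
          exact mul_le_mul_right (measure_mono (ball_subset_ball (by linarith))) _
      _ = V⁻¹ * (ENNReal.ofReal (48 ^ n) * volume (ball (x : Fin n → ℝ) (ρ x / 16))) := by
          rw [volume_ball_mul y (by norm_num) (by positivity),
            Real.volume_pi_ball _ (by positivity : 0 < ρ x / 16),
            Real.volume_pi_ball _ (by positivity : 0 < ρ x / 16)]
      _ = _ := by ring
  calc _ ≤ ∑' x : X, ENNReal.ofReal (48 ^ n) * V⁻¹ *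
        volume (ball (x : Fin n → ℝ) (ρ x / 16) ∩ ball y (2 * ρ y)) := ENNReal.tsum_le_tsum h1
    _ = ENNReal.ofReal (48 ^ n) * V⁻¹ *
        volume (⋃ x : X, ball (x : Fin n → ℝ) (ρ x / 16) ∩ ball y (2 * ρ y)) := by
      rw [ENNReal.tsum_mul_left, measure_iUnion]
      · intro a b hab
        exact (hd a.2 b.2 (by simpa [Subtype.ext_iff] using hab)).mono Set.inter_subset_left
          Set.inter_subset_left
      · exact fun x => measurableSet_ball.inter measurableSet_ball
    _ ≤ ENNReal.ofReal (48 ^ n) * V⁻¹ * V := by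
      exact mul_le_mul_right (measure_mono (Set.iUnion_subset fun x => Set.inter_subset_right)) _
    _ = _ := by rw [mul_assoc, ENNReal.inv_mul_cancel hV0 hVt, mul_one]

/-- Penalised minimisation produces a point away from which ρ can fall at rate at most 1/8. Outside
the ball of radius 8 ρ x the penalty alone exceeds the value at x, so a minimum on that compact ball
is global. -/
lemma exists_minimizer_add_dist (h0 : ∀ x, 0 ≤ ρ x) (hρ : Continuous ρ) (x : Fin n → ℝ) :
    ∃ y, ∀ z, ρ y + dist x y / 8 ≤ ρ z + dist x z / 8 := by
  have hx : x ∈ closedBall x (8 * ρ x) := mem_closedBall_self (by linarith [h0 x])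
  obtain ⟨y, -, hmin⟩ := (isCompact_closedBall x (8 * ρ x)).exists_isMinOn
    (f := fun z => ρ z + dist x z / 8) ⟨x, hx⟩ (by fun_prop)
  refine ⟨y, fun z => ?_⟩
  by_cases hz : z ∈ closedBall x (8 * ρ x)
  · exact hmin hz
  · rw [mem_closedBall, not_le, dist_comm] at hz
    have h1 : ρ y + dist x y / 8 ≤ ρ x + dist x x / 8 := hmin hx
    rw [dist_self] at h1
    linarith [h0 z]

/-- A smooth subordinate partition built from cutoff functions `ψ j` by successive multiplication
with `1 - ψ k`. -/
lemma exists_partition_of_cutoffs {ι : Type*} [Countable ι] {ψ : ι → (Fin n → ℝ) → ℝ}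
    (hψ : ∀ j, ContDiff ℝ ∞ (ψ j)) (h0 : ∀ j x, 0 ≤ ψ j x) (h1 : ∀ j x, ψ j x ≤ 1) :
    ∃ φ : ι → (Fin n → ℝ) → ℝ, (∀ j, ContDiff ℝ ∞ (φ j)) ∧ (∀ j x, 0 ≤ φ j x) ∧
      (∀ j x, φ j x ≤ ψ j x) ∧ (∀ x, (∃ j, ψ j x = 1) → HasSum (fun j => φ j x) 1) ∧
      ∀ j x, ‖fderiv ℝ (φ j) x‖ₑ ≤ ∑' k, ‖fderiv ℝ (ψ k) x‖ₑ := by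
  obtain ⟨e, he⟩ := exists_injective_nat ι
  set Ψ : ℕ → (Fin n → ℝ) → ℝ := Function.extend e ψ 0 with hΨ
  have hcase : ∀ m, (∃ j, e j = m ∧ Ψ m = ψ j) ∨ ((∀ j, e j ≠ m) ∧ Ψ m = 0) := by
    intro m
    by_cases h : ∃ j, e j = m
    · obtain ⟨j, rfl⟩ := h
      exact Or.inl ⟨j, rfl, he.extend_apply _ _ _⟩
    · exact Or.inr ⟨fun j hj => h ⟨j, hj⟩, Function.extend_apply' _ _ _ h⟩
  have hΨs : ∀ m, ContDiff ℝ ∞ (Ψ m) := by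
    intro m
    rcases hcase m with ⟨j, -, h⟩ | ⟨-, h⟩ <;> rw [h]
    exacts [hψ j, contDiff_const]
  have hΨ0 : ∀ m x, 0 ≤ Ψ m x := by
    intro m x
    rcases hcase m with ⟨j, -, h⟩ | ⟨-, h⟩ <;> rw [h]
    exacts [h0 j x, le_rfl]
  have hΨ1 : ∀ m x, Ψ m x ≤ 1 := by
    intro m x
    rcases hcase m with ⟨j, -, h⟩ | ⟨-, h⟩ <;> rw [h]
    exacts [h1 j x, zero_le_one]
  -- `Q m` is what the first m cutoffs leave over. The sums of `Ψ m * Q m` telescope to 1 - `Q M`,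
  -- which equals 1 once a cutoff with value 1 has been used. All factors lie in [0, 1], so the
  -- product rule merely adds gradient norms.
  set Q : ℕ → (Fin n → ℝ) → ℝ := fun m x => ∏ k ∈ Finset.range m, (1 - Ψ k x) with hQ
  have hQs : ∀ m, ContDiff ℝ ∞ (Q m) := fun m =>
    contDiff_prod fun k _ => contDiff_const.sub (hΨs k)
  have hQ0 : ∀ m x, 0 ≤ Q m x := fun m x =>
    Finset.prod_nonneg fun k _ => sub_nonneg.2 (hΨ1 k x)
  have hQ1 : ∀ m x, Q m x ≤ 1 := fun m x =>
    Finset.prod_le_one (fun k _ => sub_nonneg.2 (hΨ1 k x)) fun k _ => sub_le_self _ (hΨ0 k x)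
  have hsucc : ∀ m, Q (m + 1) = fun x => Q m x * (1 - Ψ m x) := fun m => by
    ext x; simp only [hQ]; rw [Finset.prod_range_succ]
  have hprod : ∀ (f g : (Fin n → ℝ) → ℝ) (x : Fin n → ℝ), DifferentiableAt ℝ f x →
      DifferentiableAt ℝ g x → |f x| ≤ 1 → |g x| ≤ 1 →
      ‖fderiv ℝ (fun x => f x * g x) x‖ₑ ≤ ‖fderiv ℝ f x‖ₑ + ‖fderiv ℝ g x‖ₑ := by
    intro f g x hf hg hf1 hg1
    rw [fderiv_fun_mul hf hg]
    rw [← ofReal_norm, ← ofReal_norm (fderiv ℝ f x), ← ofReal_norm (fderiv ℝ g x),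
      ← ENNReal.ofReal_add (norm_nonneg _) (norm_nonneg _), add_comm]
    refine ENNReal.ofReal_le_ofReal ((norm_add_le _ _).trans ?_)
    rw [norm_smul, norm_smul, Real.norm_eq_abs, Real.norm_eq_abs]
    exact add_le_add (mul_le_of_le_one_left (norm_nonneg _) hg1)
      (mul_le_of_le_one_left (norm_nonneg _) hf1)
  have hdiff : ∀ {f : (Fin n → ℝ) → ℝ}, ContDiff ℝ ∞ f → ∀ x, DifferentiableAt ℝ f x :=
    fun hf x => hf.differentiable (by simp) x
  have hQd : ∀ m x, ‖fderiv ℝ (Q m) x‖ₑ ≤ ∑ k ∈ Finset.range m, ‖fderiv ℝ (Ψ k) x‖ₑ := by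
    intro m
    induction m with
    | zero =>
      intro x
      have : Q 0 = fun _ => 1 := by ext x; simp [hQ]
      simp [this, ← ofReal_norm]
    | succ m ih =>
      intro x
      rw [hsucc, Finset.sum_range_succ]
      refine (hprod _ _ x (hdiff (hQs m) x) ((hdiff (hΨs m) x).const_sub 1) ?_ ?_).trans ?_
      · rw [abs_of_nonneg (hQ0 m x)]; exact hQ1 m x
      · rw [abs_of_nonneg (sub_nonneg.2 (hΨ1 m x))]; linarith [hΨ0 m x]
      · rw [fderiv_const_sub, enorm_neg]
        gcongr
        exact ih x
  have hsum : ∀ M x, ∑ m ∈ Finset.range M, Ψ m x * Q m x = 1 - Q M x := by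
    intro M x
    induction M with
    | zero => simp [hQ]
    | succ M ih => rw [Finset.sum_range_succ, ih, hsucc]; ring
  refine ⟨fun j x => Ψ (e j) x * Q (e j) x, fun j => (hΨs _).mul (hQs _),
    fun j x => mul_nonneg (hΨ0 _ x) (hQ0 _ x), fun j x => ?_, ?_, fun j x => ?_⟩
  · have : Ψ (e j) = ψ j := he.extend_apply _ _ _
    simp only [this]
    exact mul_le_of_le_one_right (h0 j x) (hQ1 _ x)
  · rintro x ⟨j, hj⟩
    have hj' : Ψ (e j) x = 1 := by
      have : Ψ (e j) = ψ j := he.extend_apply _ _ _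
      rw [this, hj]
    have hz : ∀ m, e j < m → Q m x = 0 := fun m hm =>
      Finset.prod_eq_zero (Finset.mem_range.2 hm) (by rw [hj', sub_self])
    have hs : HasSum (fun m => Ψ m x * Q m x) 1 := by
      have := hasSum_sum_of_ne_finset_zero (f := fun m => Ψ m x * Q m x)
        (L := SummationFilter.unconditional ℕ) (s := Finset.range (e j + 1)) fun m hm => by
          rw [hz m (by simpa using hm), mul_zero]
      rwa [hsum, hz _ (Nat.lt_succ_self _), sub_zero] at this
    refine (he.hasSum_iff fun m hm => ?_).2 hs
    rcases hcase m with ⟨k, hk, -⟩ | ⟨-, h⟩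
    · exact (hm ⟨k, hk⟩).elim
    · simp [h]
  · refine (hprod _ _ x (hdiff (hΨs _) x) (hdiff (hQs _) x) ?_ ?_).trans ?_
    · rw [abs_of_nonneg (hΨ0 _ x)]; exact hΨ1 _ x
    · rw [abs_of_nonneg (hQ0 _ x)]; exact hQ1 _ x
    · calc _ ≤ ‖fderiv ℝ (Ψ (e j)) x‖ₑ + ∑ k ∈ Finset.range (e j), ‖fderiv ℝ (Ψ k) x‖ₑ := by
            gcongr; exact hQd _ x
        _ = ∑ k ∈ Finset.range (e j + 1), ‖fderiv ℝ (Ψ k) x‖ₑ := by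
            rw [Finset.sum_range_succ, add_comm]
        _ ≤ ∑' k, ‖fderiv ℝ (Ψ k) x‖ₑ := ENNReal.sum_le_tsum _
        _ = _ := by
            rw [← he.tsum_eq (f := fun k => ‖fderiv ℝ (Ψ k) x‖ₑ)]
            · refine tsum_congr fun k => ?_
              rw [show Ψ (e k) = ψ k from he.extend_apply _ _ _]
            · intro m hm
              rcases hcase m with ⟨k, hk, -⟩ | ⟨-, h⟩
              · exact ⟨k, hk⟩
              · simp [h, ← ofReal_norm] at hm

end Whitney

/-! ### The critical partition and its nodes. -/

lemma fderiv_eq_zero_of_nonneg_of_eq_zero {φ : (Fin n → ℝ) → ℝ} (h : ∀ x, 0 ≤ φ x)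
    {x : Fin n → ℝ} (hx : φ x = 0) : fderiv ℝ φ x = 0 :=
  IsLocalMin.fderiv_eq_zero (Filter.Eventually.of_forall fun y => hx.trans_le (h y))

/-- A Whitney type partition of unity on the set where the critical radius of `ν` is positive,
together with, for each bump function, a node: a point near its centre at which the critical
radius is almost minimal. -/
structure CriticalPartition (ν : Measure (Fin n → ℝ)) (β : ℝ) (B : ℝ≥0∞) where
  /-- The set of centres of the balls. -/
  centres : Set (Fin n → ℝ)
  countable : centres.Countable
  radius_pos : ∀ x : centres, 0 < criticalRadius ν β x
  disjoint : centres.PairwiseDisjoint (fun x => ball x (criticalRadius ν β x / 16))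
  /-- The bump functions. -/
  bump : centres → (Fin n → ℝ) → ℝ
  contDiff_bump : ∀ j, ContDiff ℝ ∞ (bump j)
  bump_nonneg : ∀ j y, 0 ≤ bump j y
  bump_eq_zero : ∀ j y, y ∉ ball j.1 (criticalRadius ν β j.1 / 2) → bump j y = 0
  hasSum_bump : ∀ y, 0 < criticalRadius ν β y → HasSum (fun j => bump j y) 1
  enorm_fderiv_bump_le : ∀ j y, ‖fderiv ℝ (bump j) y‖ₑ ≤ B / ENNReal.ofReal (criticalRadius ν β j)
  /-- The nodes. -/
  node : centres → Fin n → ℝ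
  node_le : ∀ j z, criticalRadius ν β (node j) + dist (j : Fin n → ℝ) (node j) / 8 ≤
    criticalRadius ν β z + dist (j : Fin n → ℝ) z / 8

lemma exists_criticalPartition (n : ℕ) : ∃ B : ℝ≥0∞, B ≠ ⊤ ∧
    ∀ (ν : Measure (Fin n → ℝ)) (β : ℝ), ν ≠ 0 → 0 < β → Nonempty (CriticalPartition ν β B) := by
  let b : ContDiffBump (0 : Fin n → ℝ) := ⟨1 / 4, 1 / 2, by norm_num, by norm_num⟩
  obtain ⟨C, hC⟩ := (b.contDiff.continuous_fderiv (n := 1) one_ne_zero).bounded_above_of_compact_support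
    (b.hasCompactSupport.fderiv ℝ)
  have hC0 : 0 ≤ C := (norm_nonneg _).trans (hC 0)
  refine ⟨ENNReal.ofReal (3 * C) * ENNReal.ofReal (48 ^ n), by finiteness, fun ν β hν hβ => ?_⟩
  set ρ := criticalRadius ν β
  have hL : ∀ x y, ρ x ≤ ρ y + dist x y := criticalRadius.le_add_dist hν hβ
  have h0 : ∀ x, 0 ≤ ρ x := criticalRadius.nonneg
  have hρc : Continuous ρ := by
    refine (LipschitzWith.of_le_add fun x y => hL x y).continuous
  obtain ⟨X, hXc, hXp, hXd, hXcov⟩ := exists_whitney_centres hL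
  have := hXc.to_subtype
  set ψ : X → (Fin n → ℝ) → ℝ := fun j y => b ((ρ j)⁻¹ • (y - j)) with hψ
  have hnorm : ∀ (j : X) (y : Fin n → ℝ), ‖(ρ j)⁻¹ • (y - j)‖ = dist y j / ρ j := by
    intro j y
    have := hXp j j.2
    rw [norm_smul, norm_inv, Real.norm_of_nonneg this.le, dist_eq_norm, div_eq_inv_mul]
  have hψ0 : ∀ j y, 0 ≤ ψ j y := fun j y => b.nonneg
  have hψz : ∀ (j : X) y, y ∉ ball (j : Fin n → ℝ) (ρ j / 2) → ψ j y = 0 := by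
    intro j y hy
    have := hXp j j.2
    refine b.zero_of_le_dist ?_
    rw [dist_zero_right, hnorm, le_div_iff₀ this]
    rw [mem_ball, not_lt] at hy
    change 1 / 2 * ρ j ≤ _
    linarith
  have hψd : ∀ (j : X) y, ‖fderiv ℝ (ψ j) y‖ ≤ C / ρ j := by
    intro j y
    have hp := hXp j j.2
    have hd : HasFDerivAt (ψ j) ((fderiv ℝ b ((ρ j)⁻¹ • (y - j))).comp
        ((ρ j)⁻¹ • ContinuousLinearMap.id ℝ (Fin n → ℝ))) y :=
      ((b.contDiff (n := 1)).differentiable one_ne_zero _).hasFDerivAt.comp y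
        (((hasFDerivAt_id y).sub_const (j : Fin n → ℝ)).fun_const_smul (ρ j)⁻¹)
    rw [hd.fderiv, ContinuousLinearMap.comp_smul, ContinuousLinearMap.comp_id, norm_smul, norm_inv,
      Real.norm_of_nonneg hp.le, div_eq_inv_mul]
    gcongr
    exact hC _
  obtain ⟨φ, hφs, hφ0, hφψ, hφ1, hφd⟩ := exists_partition_of_cutoffs (ψ := ψ)
    (fun j => b.contDiff.comp ((contDiff_id.sub contDiff_const).const_smul _)) hψ0
    (fun j y => b.le_one)
  have hφz : ∀ (j : X) y, y ∉ ball (j : Fin n → ℝ) (ρ j / 2) → φ j y = 0 := fun j y hy =>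
    le_antisymm ((hφψ j y).trans_eq (hψz j y hy)) (hφ0 j y)
  choose node hnode using fun j : X => exists_minimizer_add_dist h0 hρc j
  refine ⟨⟨X, hXc, fun x => hXp x x.2, hXd, φ, hφs, hφ0, hφz, ?_, ?_, node, hnode⟩⟩
  · intro y hy
    obtain ⟨x, hx, hyx⟩ := hXcov y hy
    refine hφ1 y ⟨⟨x, hx⟩, b.one_of_mem_closedBall ?_⟩
    have := hXp x hx
    rw [mem_closedBall, dist_zero_right, hnorm, div_le_iff₀ this]
    rw [mem_closedBall] at hyx
    change dist y x ≤ 1 / 4 * ρ x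
    linarith
  · intro j y
    have hp := hXp j j.2
    by_cases hy : y ∈ ball (j : Fin n → ℝ) (ρ j / 2)
    swap
    · rw [fderiv_eq_zero_of_nonneg_of_eq_zero (hφ0 j) (hφz j y hy), ← ofReal_norm]
      simp
    refine (hφd j y).trans ?_
    -- If the balls of j and k both contain y, then ρ j ≤ 2 ρ y ≤ 3 ρ k, so every cutoff active at y
    -- has gradient at most 3C / ρ j. At most 48^n of them are active.
    calc _ ≤ ∑' k : X, ENNReal.ofReal (3 * C / ρ j) *
          (ball (k : Fin n → ℝ) (ρ k / 2)).indicator (fun _ => (1 : ℝ≥0∞)) y := by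
          refine ENNReal.tsum_le_tsum fun k => ?_
          by_cases hk : y ∈ ball (k : Fin n → ℝ) (ρ k / 2)
          · rw [Set.indicator_of_mem hk, mul_one, ← ofReal_norm]
            refine ENNReal.ofReal_le_ofReal ((hψd k y).trans ?_)
            have hkp := hXp k k.2
            rw [div_le_div_iff₀ hkp hp]
            rw [mem_ball] at hk hy
            have h1 := hL j y
            have h2 := hL y k
            rw [dist_comm] at h1
            nlinarith
          · rw [fderiv_eq_zero_of_nonneg_of_eq_zero (hψ0 k) (hψz k y hk), ← ofReal_norm]
            simp
      _ ≤ ENNReal.ofReal (3 * C / ρ j) * ENNReal.ofReal (48 ^ n) := by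
          rw [ENNReal.tsum_mul_left]
          gcongr
          exact tsum_indicator_ball_le hXc hXp hL hXd y
      _ = _ := by
          rw [ENNReal.ofReal_div_of_pos hp, div_eq_mul_inv, div_eq_mul_inv]; ring

namespace CriticalPartition

variable {ν : Measure (Fin n → ℝ)} {β : ℝ} {B : ℝ≥0∞} (W : CriticalPartition ν β B)

instance : Countable W.centres := W.countable.to_subtype

/-- The radius attached to a centre. -/
noncomputable def radius (j : W.centres) : ℝ := criticalRadius ν β j

/-- The ball around the node over which functions are averaged. -/
def nodeBall (j : W.centres) : Set (Fin n → ℝ) :=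
  closedBall (W.node j) (2 * criticalRadius ν β (W.node j))

lemma radius_pos' (j : W.centres) : 0 < W.radius j := W.radius_pos j

lemma pairwise_disjoint : Pairwise (Function.onFun Disjoint
    fun j : W.centres => ball (j : Fin n → ℝ) (W.radius j / 16)) :=
  fun a b hab => W.disjoint a.2 b.2 (by simpa [Subtype.ext_iff] using hab)

lemma fderiv_bump_eq_zero (j : W.centres) {y : Fin n → ℝ}
    (hy : y ∉ ball (j : Fin n → ℝ) (W.radius j / 2)) : fderiv ℝ (W.bump j) y = 0 :=
  fderiv_eq_zero_of_nonneg_of_eq_zero (W.bump_nonneg j) (W.bump_eq_zero j y hy)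

lemma measure_ball_le (hβ : 0 < β) (j : W.centres) :
    ν (ball (j : Fin n → ℝ) (W.radius j / 2)) ≤
      ENNReal.ofReal (2 ^ β) * ENNReal.ofReal (W.radius j ^ (-β)) := by
  have h := W.radius_pos' j
  refine (criticalRadius.measure_ball_le hβ (half_lt_self h)).trans_eq ?_
  change ENNReal.ofReal (W.radius j / 2) ^ (-β) = _
  rw [ENNReal.ofReal_rpow_of_pos (by positivity), ← ENNReal.ofReal_mul (by positivity),
    Real.div_rpow h.le (by norm_num), Real.rpow_neg (by norm_num : (0:ℝ) ≤ 2), div_inv_eq_mul, mul_comm]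

lemma tsum_indicator_le (hν : ν ≠ 0) (hβ : 0 < β) (y : Fin n → ℝ) :
    ∑' j : W.centres, (ball (j : Fin n → ℝ) (W.radius j / 2)).indicator (fun _ => (1 : ℝ≥0∞)) y ≤
      ENNReal.ofReal (48 ^ n) :=
  tsum_indicator_ball_le W.countable (fun x hx => W.radius_pos ⟨x, hx⟩)
    (criticalRadius.le_add_dist hν hβ) W.disjoint y

lemma radius_le_of_mem (hν : ν ≠ 0) (hβ : 0 < β) {j : W.centres} {y : Fin n → ℝ}
    (hy : y ∈ ball (j : Fin n → ℝ) (W.radius j / 2)) :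
    W.radius j ≤ 2 * criticalRadius ν β y := by
  have := criticalRadius.le_add_dist hν hβ (j : Fin n → ℝ) y
  rw [mem_ball, dist_comm] at hy
  change W.radius j ≤ _ at this
  linarith

/-- Minimality tested at the centre gives ρ(node) + dist/8 ≤ r, so dist + 2 ρ(node) ≤ 8 r. The
constant 10 leaves some room. -/
lemma nodeBall_subset (j : W.centres) :
    W.nodeBall j ⊆ closedBall (j : Fin n → ℝ) (10 * W.radius j) := by
  have h1 := W.node_le j j
  rw [dist_self, zero_div, add_zero] at h1
  have h2 := criticalRadius.nonneg (ν := ν) (β := β) (W.node j)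
  refine closedBall_subset_closedBall' ?_
  rw [dist_comm]
  change _ ≤ W.radius j at h1
  linarith [dist_nonneg (x := (j : Fin n → ℝ)) (y := W.node j)]

/-- The purpose of the nodes: over a distance 2 ρ(node) the critical radius loses at most a quarter
of ρ(node), so it stays positive on the whole node ball when ρ(node) > 0. -/
lemma criticalRadius_node_le {j : W.centres} {z : Fin n → ℝ} (hz : z ∈ W.nodeBall j) :
    3 / 4 * criticalRadius ν β (W.node j) ≤ criticalRadius ν β z := by
  have h1 := W.node_le j z
  have h2 := dist_triangle (j : Fin n → ℝ) (W.node j) z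
  rw [nodeBall, mem_closedBall, dist_comm] at hz
  linarith

lemma node_mem_nodeBall (j : W.centres) : W.node j ∈ W.nodeBall j :=
  mem_closedBall_self (by linarith [criticalRadius.nonneg (ν := ν) (β := β) (W.node j)])

lemma criticalRadius_le_of_mem_nodeBall (hν : ν ≠ 0) (hβ : 0 < β) {j : W.centres} {z : Fin n → ℝ} (hz : z ∈ W.nodeBall j) :
    criticalRadius ν β z ≤ 11 * W.radius j := by
  have h1 := W.nodeBall_subset j hz
  have h2 := criticalRadius.le_add_dist hν hβ z (j : Fin n → ℝ)
  rw [mem_closedBall] at h1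
  change _ ≤ W.radius j + _ at h2
  linarith

/-- The node ball is larger than the critical ball, so the definition of ρ does not bound its mass.
Finiteness comes from compactness and positivity of ρ, without any quantitative bound. -/
lemma measure_nodeBall_lt_top (hβ : 0 < β) {j : W.centres} (hj : 0 < criticalRadius ν β (W.node j)) :
    ν (W.nodeBall j) < ⊤ :=
  criticalRadius.measure_lt_top_of_isCompact hβ (isCompact_closedBall _ _) fun x hx => by
    have := W.criticalRadius_node_le hx
    linarith

lemma le_measure_nodeBall (hν : ν ≠ 0) (hβ : 0 < β) {j : W.centres} (hj : 0 < criticalRadius ν β (W.node j)) :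
    ENNReal.ofReal ((2 * criticalRadius ν β (W.node j)) ^ (-β)) ≤ ν (W.nodeBall j) := by
  rw [← ENNReal.ofReal_rpow_of_pos (by positivity)]
  exact (criticalRadius.lt_measure_ball hν hβ (by linarith)).le.trans
    (measure_mono ball_subset_closedBall)

lemma measure_nodeBall_ne_zero (hν : ν ≠ 0) (hβ : 0 < β) {j : W.centres} (hj : 0 < criticalRadius ν β (W.node j)) :
    ν (W.nodeBall j) ≠ 0 := by
  refine (lt_of_lt_of_le ?_ (W.le_measure_nodeBall hν hβ hj)).ne'
  simp only [ENNReal.ofReal_pos]; positivity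

end CriticalPartition

/-! ### Coefficients and the summation of their errors. -/

namespace CriticalPartition

variable {ν : Measure (Fin n → ℝ)} {β : ℝ} {B : ℝ≥0∞} (W : CriticalPartition ν β B)

/-- The coefficient of a function `f₁ + f₂` at a bump function: the `ν`-average over the node ball,
or the value of the continuous part at the node if the node ball is degenerate. -/
noncomputable def coeff (j : W.centres) (f₁ f₂ : (Fin n → ℝ) → ℝ) : ℝ :=
  if criticalRadius ν β (W.node j) = 0 then f₁ (W.node j)
  else ⨍ z in W.nodeBall j, (f₁ z + f₂ z) ∂ν

/-- The contribution of the gradient to the error of a coefficient. -/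
noncomputable def gradErr (q : ℝ) (j : W.centres) (G : (Fin n → ℝ) → (Fin n → ℝ)) : ℝ≥0∞ :=
  ENNReal.ofReal (10 * W.radius j) * ((volume (ball (j : Fin n → ℝ) (10 * W.radius j)))⁻¹ *
    ∫⁻ y in ball (j : Fin n → ℝ) (2 * (10 * W.radius j)), ‖G y‖ₑ ^ q) ^ (1 / q)

/-- The contribution of the `L_p` part to the error of a coefficient. -/
noncomputable def avgErr (P : ℝ) (j : W.centres) (f₂ : (Fin n → ℝ) → ℝ) : ℝ≥0∞ :=
  if criticalRadius ν β (W.node j) = 0 then 0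
  else ((ν (W.nodeBall j))⁻¹ * ∫⁻ z in W.nodeBall j, ‖f₂ z‖ₑ ^ P ∂ν) ^ (1 / P)

lemma measurableSet_nodeBall (j : W.centres) : MeasurableSet (W.nodeBall j) :=
  measurableSet_closedBall

lemma integrableOn_nodeBall (hβ : 0 < β) {P : ℝ} (hP : 1 ≤ P) {f₂ : (Fin n → ℝ) → ℝ}
    (hf₂ : AEStronglyMeasurable f₂ ν) (hf₂' : ∫⁻ z, ‖f₂ z‖ₑ ^ P ∂ν < ⊤) {j : W.centres}
    (hj : 0 < criticalRadius ν β (W.node j)) : IntegrableOn f₂ (W.nodeBall j) ν := by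
  refine ⟨hf₂.restrict, ?_⟩
  have h1 := lintegral_rpow_le_measure_univ_rpow_mul (ν.restrict (W.nodeBall j)) hP
    hf₂.restrict.enorm
  rw [Measure.restrict_apply_univ] at h1
  have h2 : (∫⁻ z in W.nodeBall j, ‖f₂ z‖ₑ ∂ν) ^ P < ⊤ := by
    refine h1.trans_lt (ENNReal.mul_lt_top ?_ ((setLIntegral_le_lintegral _ _).trans_lt hf₂'))
    exact ENNReal.rpow_lt_top_of_nonneg (by linarith) (W.measure_nodeBall_lt_top hβ hj).ne
  exact (ENNReal.rpow_lt_top_iff_of_pos (by linarith)).1 h2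

lemma continuous_integrableOn_nodeBall (hβ : 0 < β) {f₁ : (Fin n → ℝ) → ℝ}
    (hf₁ : Continuous f₁) {j : W.centres}
    (hj : 0 < criticalRadius ν β (W.node j)) : IntegrableOn f₁ (W.nodeBall j) ν := by
  have hfin := W.measure_nodeBall_lt_top hβ hj
  have : IsFiniteMeasure (ν.restrict (W.nodeBall j)) :=
    ⟨by rwa [Measure.restrict_apply_univ]⟩
  have hK : IsCompact (W.nodeBall j) := isCompact_closedBall _ _
  obtain ⟨C, hC⟩ := hK.exists_bound_of_continuousOn hf₁.continuousOn
  refine Integrable.of_bound hf₁.aestronglyMeasurable C ?_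
  exact (ae_restrict_mem (W.measurableSet_nodeBall j)).mono fun z hz => hC z hz

lemma coeff_add (hβ : 0 < β) {P : ℝ} (hP : 1 ≤ P) {f₁ f₂ g₁ g₂ : (Fin n → ℝ) → ℝ}
    (hf₁ : Continuous f₁) (hg₁ : Continuous g₁)
    (hf₂ : AEStronglyMeasurable f₂ ν) (hf₂' : ∫⁻ z, ‖f₂ z‖ₑ ^ P ∂ν < ⊤)
    (hg₂ : AEStronglyMeasurable g₂ ν) (hg₂' : ∫⁻ z, ‖g₂ z‖ₑ ^ P ∂ν < ⊤) (j : W.centres) :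
    W.coeff j (f₁ + g₁) (f₂ + g₂) = W.coeff j f₁ f₂ + W.coeff j g₁ g₂ := by
  rw [coeff, coeff, coeff]
  split_ifs with h
  · rfl
  · have hj := (criticalRadius.nonneg (W.node j)).lt_of_ne' h
    rw [setAverage_eq, setAverage_eq, setAverage_eq, ← smul_add, ← integral_add]
    · congr 2; ext z; simp only [Pi.add_apply]; ring
    · exact (W.continuous_integrableOn_nodeBall hβ hf₁ hj).add
        (W.integrableOn_nodeBall hβ hP hf₂ hf₂' hj)
    · exact (W.continuous_integrableOn_nodeBall hβ hg₁ hj).add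
        (W.integrableOn_nodeBall hβ hP hg₂ hg₂' hj)

lemma coeff_smul (c : ℝ) (f₁ f₂ : (Fin n → ℝ) → ℝ) (j : W.centres) :
    W.coeff j (c • f₁) (c • f₂) = c * W.coeff j f₁ f₂ := by
  rw [coeff, coeff]
  split_ifs with h
  · rfl
  · rw [setAverage_eq, setAverage_eq, smul_eq_mul, smul_eq_mul, mul_left_comm]
    congr 1
    rw [← integral_const_mul]
    refine integral_congr_ae (Filter.Eventually.of_forall fun z => ?_)
    simp only [Pi.smul_apply, smul_eq_mul]; ring

lemma coeff_congr {f₁ f₂ g₂ : (Fin n → ℝ) → ℝ} (h : f₂ =ᵐ[ν] g₂) (j : W.centres) :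
    W.coeff j f₁ f₂ = W.coeff j f₁ g₂ := by
  rw [coeff, coeff]
  split_ifs
  · rfl
  · rw [setAverage_eq, setAverage_eq]
    congr 1
    exact integral_congr_ae (ae_restrict_of_ae (h.mono fun z hz => by simp only [hz]))

/-- Together with linearity this makes the coefficient a function of the class of `f₁ + f₂` alone.
The hypothesis `h0` covers degenerate nodes, where the coefficient is a value of `f₁`. -/
lemma coeff_eq_zero {f₁ f₂ : (Fin n → ℝ) → ℝ}
    (h0 : ∀ x, criticalRadius ν β x = 0 → f₁ x = 0) (h : ∀ᵐ z ∂ν, f₁ z + f₂ z = 0)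
    (j : W.centres) : W.coeff j f₁ f₂ = 0 := by
  rw [coeff]
  split_ifs with hj
  · exact h0 _ hj
  · rw [setAverage_eq, integral_eq_zero_of_ae (ae_restrict_of_ae h), smul_zero]

/-- The coefficient approximates the continuous part near the centre. -/
lemma enorm_coeff_sub_le (hν : ν ≠ 0) (hβ : 0 < β) {P : ℝ} (hP : 1 ≤ P) {C : ℝ≥0∞} {q : ℝ}
    {f₁ f₂ : (Fin n → ℝ) → ℝ} {G : (Fin n → ℝ) → (Fin n → ℝ)} (hf₁ : Continuous f₁)
    (hf₂ : AEStronglyMeasurable f₂ ν) (hf₂' : ∫⁻ z, ‖f₂ z‖ₑ ^ P ∂ν < ⊤)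
    (j : W.centres)
    (hC : ∀ x ∈ closedBall (j : Fin n → ℝ) (10 * W.radius j),
      ∀ y ∈ closedBall (j : Fin n → ℝ) (10 * W.radius j), ‖f₁ x - f₁ y‖ₑ ≤ C * W.gradErr q j G)
    {y : Fin n → ℝ}
    (hy : y ∈ ball (j : Fin n → ℝ) (W.radius j / 2)) :
    ‖W.coeff j f₁ f₂ - f₁ y‖ₑ ≤ C * W.gradErr q j G + W.avgErr P j f₂ := by
  have hr := W.radius_pos' j
  have hy' : y ∈ closedBall (j : Fin n → ℝ) (10 * W.radius j) := by
    rw [mem_ball] at hy; rw [mem_closedBall]; linarith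
  rw [coeff, avgErr]
  by_cases h : criticalRadius ν β (W.node j) = 0
  · rw [if_pos h, if_pos h, add_zero]
    exact hC _ (W.nodeBall_subset j (W.node_mem_nodeBall j)) _ hy'
  rw [if_neg h, if_neg h]
  have hj := (criticalRadius.nonneg (W.node j)).lt_of_ne' h
  set D := W.nodeBall j
  have hD0 : ν D ≠ 0 := W.measure_nodeBall_ne_zero hν hβ hj
  have hDt : ν D ≠ ⊤ := (W.measure_nodeBall_lt_top hβ hj).ne
  set κ := (ν D)⁻¹ • ν.restrict D
  have hκ : κ Set.univ = 1 := by
    simp only [κ, Measure.smul_apply, Measure.restrict_apply_univ, smul_eq_mul]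
    exact ENNReal.inv_mul_cancel hD0 hDt
  have : IsProbabilityMeasure κ := ⟨hκ⟩
  have hi1 : Integrable f₁ κ :=
    (W.continuous_integrableOn_nodeBall hβ hf₁ hj).integrable.smul_measure (ENNReal.inv_ne_top.2 hD0)
  have hi2 : Integrable f₂ κ :=
    (W.integrableOn_nodeBall hβ hP hf₂ hf₂' hj).integrable.smul_measure (ENNReal.inv_ne_top.2 hD0)
  have hav : ⨍ z in D, (f₁ z + f₂ z) ∂ν - f₁ y = ∫ z, (f₁ z - f₁ y + f₂ z) ∂κ := by
    have e : ⨍ z in D, (f₁ z + f₂ z) ∂ν = ∫ z, (f₁ z + f₂ z) ∂κ := by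
      rw [average, Measure.restrict_apply_univ]
    have e2 : f₁ y = ∫ _, f₁ y ∂κ := by simp
    rw [e]
    conv_lhs => rw [e2]
    have e3 := integral_sub (hi1.add hi2) (integrable_const (f₁ y))
    simp only [Pi.add_apply] at e3
    rw [← e3]
    congr 1; ext z; ring
  rw [hav]
  calc _ ≤ ∫⁻ z, (C * W.gradErr q j G + ‖f₂ z‖ₑ) ∂κ := by
        refine (enorm_integral_le_lintegral_enorm _).trans (lintegral_mono_ae ?_)
        refine Measure.ae_smul_measure ?_ _
        filter_upwards [ae_restrict_mem (W.measurableSet_nodeBall j)] with z hz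
        refine (enorm_add_le _ _).trans ?_
        gcongr
        exact hC _ (W.nodeBall_subset j hz) _ hy'
    _ = C * W.gradErr q j G + ∫⁻ z, ‖f₂ z‖ₑ ∂κ := by
        rw [lintegral_add_left measurable_const, lintegral_const, hκ, mul_one]
    _ ≤ _ := by
        gcongr
        have h1 := lintegral_rpow_le_measure_univ_rpow_mul κ hP hi2.1.enorm
        rw [hκ, ENNReal.one_rpow, one_mul] at h1
        calc _ = ((∫⁻ z, ‖f₂ z‖ₑ ∂κ) ^ P) ^ (1 / P) := by
              rw [← ENNReal.rpow_mul, mul_one_div_cancel (by linarith), ENNReal.rpow_one]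
          _ ≤ _ := by
              gcongr
              exact h1.trans_eq (by rw [lintegral_smul_measure, smul_eq_mul])

/-- Comparison of a sum over far away centres with an integral. -/
lemma tsum_indicator_radius_rpow_le (hβ : 0 < β) (y : Fin n → ℝ) {s : ℝ} (hs : 0 < s) :
    ∑' j : W.centres, {j : W.centres | dist y j ≤ 10 * W.radius j ∧ s ≤ 11 * W.radius j}.indicator
      (fun j => ENNReal.ofReal (W.radius j ^ (-β))) j ≤
    ENNReal.ofReal (8 ^ n * 22 ^ (n + β)) *
      (∫⁻ u : Fin n → ℝ, ENNReal.ofReal ((1 + ‖u‖) ^ (-(n + β)))) * ENNReal.ofReal (s ^ (-β)) := by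
  set P := n + β
  set K := ∫⁻ u : Fin n → ℝ, ENNReal.ofReal ((1 + ‖u‖) ^ (-P))
  have hP : 0 < P := by positivity
  have hint : ∫⁻ z : Fin n → ℝ, ENNReal.ofReal ((s + ‖z - y‖) ^ (-P)) =
      K * ENNReal.ofReal (s ^ (-β)) := by
    have h1 := lintegral_comp_smul_add (inv_pos.2 hs) (-(s⁻¹ • y))
      (k := fun u : Fin n → ℝ => ENNReal.ofReal ((1 + ‖u‖) ^ (-P))) (by fun_prop)
    have h2 : ∀ z : Fin n → ℝ, ENNReal.ofReal ((s + ‖z - y‖) ^ (-P)) =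
        ENNReal.ofReal (s ^ (-P)) * ENNReal.ofReal ((1 + ‖s⁻¹ • z + -(s⁻¹ • y)‖) ^ (-P)) := by
      intro z
      rw [← ENNReal.ofReal_mul (by positivity), ← Real.mul_rpow hs.le (by positivity),
        ← sub_eq_add_neg, ← smul_sub, norm_smul, norm_inv, Real.norm_of_nonneg hs.le]
      congr 2; field_simp
    simp_rw [h2]
    rw [lintegral_const_mul _ (by fun_prop), h1, ← mul_assoc, ← ENNReal.ofReal_mul (by positivity),
      mul_comm]
    congr 2
    rw [inv_pow, inv_inv, ← Real.rpow_natCast, ← Real.rpow_add hs]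
    congr 1; simp only [P]; ring
  -- On the small ball around such a centre, s + |z - y| ≤ 11r + 10r + r/16 ≤ 22r, while its volume
  -- is (r/8)^n. So r^(-β) = r^(-P) r^n is dominated by the integral of (s + |z - y|)^(-P) there,
  -- and these small balls are disjoint.
  have hterm : ∀ j : W.centres,
      {j : W.centres | dist y j ≤ 10 * W.radius j ∧ s ≤ 11 * W.radius j}.indicator
        (fun j => ENNReal.ofReal (W.radius j ^ (-β))) j ≤
      ENNReal.ofReal (8 ^ n * 22 ^ P) * ∫⁻ z in ball (j : Fin n → ℝ) (W.radius j / 16),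
        ENNReal.ofReal ((s + ‖z - y‖) ^ (-P)) := by
    intro j
    by_cases hj : dist y j ≤ 10 * W.radius j ∧ s ≤ 11 * W.radius j
    swap
    · simp [hj]
    have hr := W.radius_pos' j
    rw [Set.indicator_of_mem (s := {j : W.centres | dist y j ≤ 10 * W.radius j ∧
      s ≤ 11 * W.radius j}) hj]
    calc ENNReal.ofReal (W.radius j ^ (-β))
        = ENNReal.ofReal (8 ^ n * 22 ^ P) * (ENNReal.ofReal ((22 * W.radius j) ^ (-P)) *
            volume (ball (j : Fin n → ℝ) (W.radius j / 16))) := by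
          rw [Real.volume_pi_ball _ (by positivity), ← ENNReal.ofReal_mul (by positivity),
            ← ENNReal.ofReal_mul (by positivity), Real.mul_rpow (by norm_num) hr.le,
            Fintype.card_fin, Real.rpow_neg (by norm_num : (0:ℝ) ≤ 22)]
          congr 1
          have h22 : (22 : ℝ) ^ P ≠ 0 := by positivity
          have : W.radius j ^ (-β) = W.radius j ^ (-P) * W.radius j ^ n := by
            rw [← Real.rpow_natCast, ← Real.rpow_add hr]; congr 1; simp only [P]; ring
          rw [this, show 2 * (W.radius j / 16) = W.radius j / 8 by ring, div_pow]
          field_simp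
      _ = ENNReal.ofReal (8 ^ n * 22 ^ P) *
            ∫⁻ z in ball (j : Fin n → ℝ) (W.radius j / 16),
              ENNReal.ofReal ((22 * W.radius j) ^ (-P)) := by rw [setLIntegral_const]
      _ ≤ _ := by
          refine mul_le_mul_right (setLIntegral_mono' measurableSet_ball fun z hz => ?_) _
          refine ENNReal.ofReal_le_ofReal
            (Real.rpow_le_rpow_of_nonpos (by positivity) ?_ (by linarith))
          rw [← dist_eq_norm]
          rw [mem_ball] at hz
          have := dist_triangle_right z y (j : Fin n → ℝ)
          linarith [hj.1, hj.2]
  refine (ENNReal.tsum_le_tsum hterm).trans ?_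
  rw [ENNReal.tsum_mul_left, mul_assoc, ← hint,
    ← lintegral_iUnion (fun j => measurableSet_ball) W.pairwise_disjoint]
  exact mul_le_mul_right (setLIntegral_le_lintegral _ _) _

/-- After exchanging sum and integral, fix z. A nondegenerate node ball through z has inverse mass
at most (2 ρ(node))^β ≤ (3 ρ(z))^β, and the sum of r^(-β) over the corresponding centres is at most
a constant times ρ(z)^(-β). The powers of ρ(z) cancel. -/
lemma tsum_avgErr_le (hν : ν ≠ 0) (hβ : 0 < β) {P : ℝ} (hP : 0 < P) {f₂ : (Fin n → ℝ) → ℝ}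
    (hf₂ : AEStronglyMeasurable f₂ ν) :
    ∑' j : W.centres, ENNReal.ofReal (W.radius j ^ (-β)) * W.avgErr P j f₂ ^ P ≤
      ENNReal.ofReal (3 ^ β) * (ENNReal.ofReal (8 ^ n * 22 ^ (n + β)) *
      (∫⁻ u : Fin n → ℝ, ENNReal.ofReal ((1 + ‖u‖) ^ (-(n + β))))) * ∫⁻ z, ‖f₂ z‖ₑ ^ P ∂ν := by
  set M := ENNReal.ofReal (8 ^ n * 22 ^ (n + β)) *
      (∫⁻ u : Fin n → ℝ, ENNReal.ofReal ((1 + ‖u‖) ^ (-(n + β))))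
  set S : W.centres → Set (Fin n → ℝ) := fun j =>
    {z | z ∈ W.nodeBall j ∧ criticalRadius ν β (W.node j) ≠ 0}
  have hS : ∀ j, MeasurableSet (S j) := fun j =>
    (W.measurableSet_nodeBall j).inter (MeasurableSet.const _)
  have hm : AEMeasurable (fun z => ‖f₂ z‖ₑ ^ P) ν := hf₂.enorm.pow_const P
  calc _ = ∑' j : W.centres, ∫⁻ z, (S j).indicator (fun _ => ENNReal.ofReal (W.radius j ^ (-β)) *
          (ν (W.nodeBall j))⁻¹) z * ‖f₂ z‖ₑ ^ P ∂ν := by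
        refine tsum_congr fun j => ?_
        rw [avgErr]
        by_cases h : criticalRadius ν β (W.node j) = 0
        · simp [h, S, hP]
        · rw [if_neg h, ← ENNReal.rpow_mul, one_div_mul_cancel hP.ne', ENNReal.rpow_one,
            ← mul_assoc, ← lintegral_const_mul'' _ hm.restrict,
            ← lintegral_indicator (W.measurableSet_nodeBall j)]
          refine lintegral_congr fun z => ?_
          by_cases hz : z ∈ W.nodeBall j <;> simp [S, h, hz]
    _ = ∫⁻ z, (∑' j : W.centres, (S j).indicator (fun _ => ENNReal.ofReal (W.radius j ^ (-β)) *
          (ν (W.nodeBall j))⁻¹) z) * ‖f₂ z‖ₑ ^ P ∂ν := by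
        rw [← lintegral_tsum]
        · simp_rw [ENNReal.tsum_mul_right]
        · exact fun j => ((measurable_const.indicator (hS j)).aemeasurable).mul hm
    _ ≤ ∫⁻ z, (ENNReal.ofReal (3 ^ β) * M) * ‖f₂ z‖ₑ ^ P ∂ν := by
        refine lintegral_mono fun z => mul_le_mul_left ?_ _
        rcases (criticalRadius.nonneg (ν := ν) (β := β) z).eq_or_lt with hz | hz
        -- No nondegenerate node ball meets {ρ = 0}, so here the sum is empty.
        · rw [ENNReal.tsum_eq_zero.2 fun j => ?_]
          · exact zero_le
          refine Set.indicator_of_notMem (fun hj => hj.2 ?_) _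
          have h1 := W.criticalRadius_node_le hj.1
          linarith [criticalRadius.nonneg (ν := ν) (β := β) (W.node j)]
        calc _ ≤ ∑' j : W.centres, ENNReal.ofReal ((3 * criticalRadius ν β z) ^ β) *
              {j : W.centres | dist z j ≤ 10 * W.radius j ∧
                criticalRadius ν β z ≤ 11 * W.radius j}.indicator
              (fun j => ENNReal.ofReal (W.radius j ^ (-β))) j := by
              refine ENNReal.tsum_le_tsum fun j => ?_
              by_cases hj : z ∈ S j
              swap
              · simp [hj]
              have hpos := (criticalRadius.nonneg (ν := ν) (β := β) (W.node j)).lt_of_ne' hj.2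
              have h1 := W.criticalRadius_node_le hj.1
              rw [Set.indicator_of_mem hj, Set.indicator_of_mem
                (s := {j : W.centres | dist z j ≤ 10 * W.radius j ∧
                criticalRadius ν β z ≤ 11 * W.radius j})
                ⟨W.nodeBall_subset j hj.1, W.criticalRadius_le_of_mem_nodeBall hν hβ hj.1⟩,
                mul_comm]
              refine mul_le_mul_left ?_ _
              refine (ENNReal.inv_le_inv.2 (W.le_measure_nodeBall hν hβ hpos)).trans ?_
              rw [← ENNReal.ofReal_inv_of_pos (by positivity), Real.rpow_neg (by positivity),
                inv_inv]
              refine ENNReal.ofReal_le_ofReal (Real.rpow_le_rpow (by positivity) ?_ hβ.le)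
              linarith
          _ ≤ ENNReal.ofReal ((3 * criticalRadius ν β z) ^ β) *
              (M * ENNReal.ofReal (criticalRadius ν β z ^ (-β))) := by
              rw [ENNReal.tsum_mul_left]
              exact mul_le_mul_right (W.tsum_indicator_radius_rpow_le hβ z hz) _
          _ = _ := by
              rw [Real.mul_rpow (by norm_num) hz.le, ENNReal.ofReal_mul (by positivity),
                Real.rpow_neg hz.le, ENNReal.ofReal_inv_of_pos (by positivity)]
              have : ENNReal.ofReal (criticalRadius ν β z ^ β) ≠ 0 := by
                simp only [ne_eq, ENNReal.ofReal_eq_zero, not_le]; positivity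
              calc _ = ENNReal.ofReal (3 ^ β) * M * (ENNReal.ofReal (criticalRadius ν β z ^ β) *
                    (ENNReal.ofReal (criticalRadius ν β z ^ β))⁻¹) := by ring
                _ = _ := by rw [ENNReal.mul_inv_cancel this ENNReal.ofReal_ne_top, mul_one]
    _ = _ := lintegral_const_mul'' _ hm

/-- Since r^(-β) r^(n+β) = r^n is comparable to the volume of the ball, this is the Carleson
embedding for |G|^q with exponent (n + β)/q > 1. -/
lemma tsum_gradErr_le (hβ : 0 < β) {q : ℝ} (hq : 0 < q) (hqP : q < n + β)
    {G : (Fin n → ℝ) → (Fin n → ℝ)} (hG : Measurable G) :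
    ∑' j : W.centres, ENNReal.ofReal (W.radius j ^ (-β)) * W.gradErr q j G ^ (n + β) ≤
      ENNReal.ofReal (10 ^ (n + β)) * (ENNReal.ofReal (2 ^ n)) ^ ((n + β) / q) *
      (ENNReal.ofReal ((n + β) / q) * (ENNReal.ofReal ((5 / (1 / 320)) ^ n) * 2) *
        (2 ^ ((n + β) / q - 1) / ENNReal.ofReal ((n + β) / q - 1))) *
        ∫⁻ y, ‖G y‖ₑ ^ (n + β) := by
  set P := n + β
  have hP : 0 < P := hq.trans hqP
  have hs : 1 < P / q := (one_lt_div hq).2 hqP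
  have key := tsum_volume_ball_mul_average_rpow_le (x := fun j : W.centres => (j : Fin n → ℝ))
    (r := fun j => 20 * W.radius j) (fun j => by have := W.radius_pos' j; positivity)
    -- 20 r / 320 = r / 16, the radius at which the Whitney balls are disjoint.
    (ε := 1 / 320) (by norm_num) (by norm_num)
    (by
      have := W.pairwise_disjoint
      convert this using 4
      ring)
    (g := fun y => ‖G y‖ₑ ^ q) (by fun_prop) hs
  have e : ∀ y, (‖G y‖ₑ ^ q) ^ (P / q) = ‖G y‖ₑ ^ P := fun y => by
    rw [← ENNReal.rpow_mul, mul_div_cancel₀ _ hq.ne']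
  simp_rw [e] at key
  calc _ ≤ ∑' j : W.centres, ENNReal.ofReal (10 ^ P) * (ENNReal.ofReal (2 ^ n)) ^ (P / q) *
        (volume (ball (j : Fin n → ℝ) (20 * W.radius j)) *
        ((volume (ball (j : Fin n → ℝ) (20 * W.radius j)))⁻¹ *
          ∫⁻ y in ball (j : Fin n → ℝ) (20 * W.radius j), ‖G y‖ₑ ^ q) ^ (P / q)) := by
        refine ENNReal.tsum_le_tsum fun j => ?_
        have hr := W.radius_pos' j
        rw [gradErr, ENNReal.mul_rpow_of_nonneg _ _ hP.le, ← ENNReal.rpow_mul,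
          one_div_mul_eq_div, ← mul_assoc, show 2 * (10 * W.radius j) = 20 * W.radius j by ring]
        have hvol : (volume (ball (j : Fin n → ℝ) (10 * W.radius j)))⁻¹ =
            ENNReal.ofReal (2 ^ n) * (volume (ball (j : Fin n → ℝ) (20 * W.radius j)))⁻¹ := by
          rw [show 20 * W.radius j = 2 * (10 * W.radius j) by ring,
            volume_ball_mul _ (by norm_num : (0:ℝ) < 2) (by positivity : 0 < 10 * W.radius j),
            ENNReal.mul_inv (Or.inl (by simp)) (Or.inl (by finiteness)), ← mul_assoc,
            ENNReal.mul_inv_cancel (by simp) (by finiteness), one_mul]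
        rw [hvol, mul_assoc (ENNReal.ofReal (2 ^ n)),
          ENNReal.mul_rpow_of_nonneg _ _ (by positivity : 0 ≤ P / q)]
        have h1 : ENNReal.ofReal (W.radius j ^ (-β)) * ENNReal.ofReal (10 * W.radius j) ^ P ≤
            ENNReal.ofReal (10 ^ P) * volume (ball (j : Fin n → ℝ) (20 * W.radius j)) := by
          rw [Real.volume_pi_ball _ (by positivity), ENNReal.ofReal_rpow_of_pos (by positivity),
            ← ENNReal.ofReal_mul (by positivity), ← ENNReal.ofReal_mul (by positivity),
            Real.mul_rpow (by norm_num) hr.le, Fintype.card_fin]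
          refine ENNReal.ofReal_le_ofReal ?_
          have : W.radius j ^ (-β) * W.radius j ^ P = W.radius j ^ n := by
            rw [← Real.rpow_natCast, ← Real.rpow_add hr]; congr 1; simp only [P]; ring
          calc _ = 10 ^ P * W.radius j ^ n := by rw [← this]; ring
            _ ≤ _ := by gcongr; linarith
        calc _ ≤ _ := mul_le_mul_left h1 _
          _ = _ := by ring
    _ ≤ _ := by
        rw [ENNReal.tsum_mul_left, mul_assoc (ENNReal.ofReal (10 ^ P) * _)]
        exact mul_le_mul_right key _

end CriticalPartition

/-! ### The correction: continuity, weak gradient and norm bounds. -/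

/-- Bounded overlap turns the power of a sum into a sum of powers: Hölder for counting measure on
the set of indices active at each point. -/
lemma lintegral_tsum_indicator_rpow_le {α ι : Type*} [Countable ι] {m0 : MeasurableSpace α}
    (m : Measure α) {S : ι → Set α} (hS : ∀ j, MeasurableSet (S j)) (a : ι → ℝ≥0∞) {N : ℝ≥0∞}
    (hN : ∀ y, ∑' j, (S j).indicator (fun _ => (1 : ℝ≥0∞)) y ≤ N) {P : ℝ} (hP : 1 ≤ P) :
    ∫⁻ y, (∑' j, (S j).indicator (fun _ => a j) y) ^ P ∂m ≤
      N ^ (P - 1) * ∑' j, m (S j) * a j ^ P := by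
  have hpt : ∀ y, (∑' j, (S j).indicator (fun _ => a j) y) ^ P ≤
      N ^ (P - 1) * ∑' j, (S j).indicator (fun _ => a j ^ P) y := by
    intro y
    let _ : MeasurableSpace ι := ⊤
    set T : Set ι := {j | y ∈ S j}
    have hT : ∀ b : ι → ℝ≥0∞, ∫⁻ j, b j ∂(Measure.count.restrict T) =
        ∑' j, (S j).indicator (fun _ => b j) y := by
      intro b
      rw [← lintegral_indicator (MeasurableSpace.measurableSet_top), lintegral_count]
      rfl
    have h := lintegral_rpow_le_measure_univ_rpow_mul (Measure.count.restrict T) hP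
      (g := a) (measurable_from_top.aemeasurable)
    rw [hT, hT] at h
    refine h.trans (mul_le_mul_left (ENNReal.rpow_le_rpow ?_ (by linarith)) _)
    rw [← lintegral_one, hT]
    exact hN y
  refine (lintegral_mono hpt).trans ?_
  have hm : ∀ j, Measurable fun y => (S j).indicator (fun _ => a j ^ P) y := fun j =>
    measurable_const.indicator (hS j)
  rw [lintegral_const_mul _ (Measurable.tsum hm),
    lintegral_tsum fun j => (hm j).aemeasurable]
  refine mul_le_mul_right (ENNReal.tsum_le_tsum fun j => ?_) _
  rw [lintegral_indicator_const (hS j), mul_comm]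

lemma integral_fderiv_single_eq_zero {χ : (Fin n → ℝ) → ℝ} (hχ : ContDiff ℝ ∞ χ)
    (hs : HasCompactSupport χ) (v : Fin n → ℝ) : ∫ x, fderiv ℝ χ x v = 0 := by
  have hc : Continuous fun x => fderiv ℝ χ x v :=
    (hχ.continuous_fderiv (by simp)).clm_apply continuous_const
  have h := integral_mul_fderiv_eq_neg_fderiv_mul_of_integrable (μ := volume)
    (f := fun _ : Fin n → ℝ => (1 : ℝ)) (g := χ) (v := v) (by simp)
    (by simpa using hc.integrable_of_hasCompactSupport (hs.fderiv_apply (𝕜 := ℝ) v))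
    (by simpa using hχ.continuous.integrable_of_hasCompactSupport hs)
    (fun x _ => differentiableAt_const _) (fun x _ => hχ.differentiable (by simp) x)
  simpa using h

/-- The product of a smooth function and the difference of a constant and a function with a weak
gradient. -/
lemma HasWeakGradient.mul_const_sub {F : (Fin n → ℝ) → ℝ} (hF : Continuous F)
    {G : (Fin n → ℝ) → (Fin n → ℝ)} (hG : ∀ i, LocallyIntegrable fun x => G x i)
    (h : HasWeakGradient F G) (c : ℝ) {φ : (Fin n → ℝ) → ℝ} (hφ : ContDiff ℝ ∞ φ) :
    HasWeakGradient (fun x => φ x * (c - F x))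
      (fun x i => (c - F x) * fderiv ℝ φ x (Pi.single i 1) - φ x * G x i) := by
  intro ψ hψ hs i
  have hφc := hφ.continuous
  have hψc := hψ.continuous
  have hφd : Continuous fun x => fderiv ℝ φ x (Pi.single i 1) :=
    (hφ.continuous_fderiv (by simp)).clm_apply continuous_const
  have hψd : Continuous fun x => fderiv ℝ ψ x (Pi.single i 1) :=
    (hψ.continuous_fderiv (by simp)).clm_apply continuous_const
  have hsd : HasCompactSupport fun x => fderiv ℝ ψ x (Pi.single i 1) :=
    hs.fderiv_apply (𝕜 := ℝ) (Pi.single i 1)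
  have hχ : ContDiff ℝ ∞ fun x => φ x * ψ x := hφ.mul hψ
  have hχs : HasCompactSupport fun x => φ x * ψ x := hs.mul_left
  have hχd : ∀ x, fderiv ℝ (fun x => φ x * ψ x) x (Pi.single i 1) =
      φ x * fderiv ℝ ψ x (Pi.single i 1) + ψ x * fderiv ℝ φ x (Pi.single i 1) := by
    intro x
    rw [fderiv_fun_mul (hφ.differentiable (by simp) x) (hψ.differentiable (by simp) x)]
    simp
  have h1 := h _ hχ hχs i
  have h2 := integral_fderiv_single_eq_zero hχ hχs (Pi.single i 1)
  simp only [hχd] at h1 h2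
  have I1 : Integrable fun x => F x * (φ x * fderiv ℝ ψ x (Pi.single i 1) +
      ψ x * fderiv ℝ φ x (Pi.single i 1)) :=
    (by fun_prop : Continuous _).integrable_of_hasCompactSupport
      ((hsd.mul_left.add hs.mul_right).mul_left)
  have I2 : Integrable fun x => φ x * fderiv ℝ ψ x (Pi.single i 1) +
      ψ x * fderiv ℝ φ x (Pi.single i 1) :=
    (by fun_prop : Continuous _).integrable_of_hasCompactSupport (hsd.mul_left.add hs.mul_right)
  have I3 : Integrable fun x => (c - F x) * fderiv ℝ φ x (Pi.single i 1) * ψ x :=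
    (by fun_prop : Continuous _).integrable_of_hasCompactSupport hs.mul_left
  have I4 : Integrable fun x => G x i * (φ x * ψ x) := by
    have := (hG i).integrable_smul_left_of_hasCompactSupport hχ.continuous hχs
    simpa [mul_comm] using this
  have e1 : ∫ x, φ x * (c - F x) * fderiv ℝ ψ x (Pi.single i 1) =
      ∫ x, (c * (φ x * fderiv ℝ ψ x (Pi.single i 1) + ψ x * fderiv ℝ φ x (Pi.single i 1)) -
        F x * (φ x * fderiv ℝ ψ x (Pi.single i 1) + ψ x * fderiv ℝ φ x (Pi.single i 1)) -
        (c - F x) * fderiv ℝ φ x (Pi.single i 1) * ψ x) := by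
    congr 1; ext x; ring
  have e2 : ∫ x, ((c - F x) * fderiv ℝ φ x (Pi.single i 1) - φ x * G x i) * ψ x =
      ∫ x, ((c - F x) * fderiv ℝ φ x (Pi.single i 1) * ψ x - G x i * (φ x * ψ x)) := by
    congr 1; ext x; ring
  have e3 := integral_sub ((I2.const_mul c).sub I1) I3
  simp only [Pi.sub_apply] at e3
  rw [e1, e2, e3, integral_sub (I2.const_mul c) I1,
    integral_sub I3 I4, integral_const_mul, h1, h2]
  ring

lemma pi_enorm_le_of_forall_le {v : Fin n → ℝ} {a : ℝ≥0∞} (h : ∀ i, ‖v i‖ₑ ≤ a) : ‖v‖ₑ ≤ a := by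
  rw [← edist_zero_right, edist_pi_le_iff]
  simpa using h

namespace CriticalPartition

variable {ν : Measure (Fin n → ℝ)} {β : ℝ} {B : ℝ≥0∞} (W : CriticalPartition ν β B)

/-- The correction `∑ φⱼ (cⱼ - f)`. -/
noncomputable def correction (c : W.centres → ℝ) (f : (Fin n → ℝ) → ℝ) (y : Fin n → ℝ) : ℝ :=
  ∑' j, W.bump j y * (c j - f y)

/-- The gradient of `CriticalPartition.correction`. -/
noncomputable def correctionGrad (c : W.centres → ℝ) (f : (Fin n → ℝ) → ℝ)
    (G : (Fin n → ℝ) → (Fin n → ℝ)) (y : Fin n → ℝ) (i : Fin n) : ℝ :=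
  ∑' j, ((c j - f y) * fderiv ℝ (W.bump j) y (Pi.single i 1) - W.bump j y * G y i)

lemma bump_eq_zero_of_radius_eq_zero (hν : ν ≠ 0) (hβ : 0 < β) {y : Fin n → ℝ}
    (hy : criticalRadius ν β y = 0) (j : W.centres) : W.bump j y = 0 := by
  by_contra h
  have h1 : y ∈ ball (j : Fin n → ℝ) (W.radius j / 2) := by
    by_contra h'; exact h (W.bump_eq_zero j y h')
  have := W.radius_le_of_mem hν hβ h1
  have := W.radius_pos' j
  linarith

lemma tsum_enorm_bump_le (hν : ν ≠ 0) (hβ : 0 < β) (y : Fin n → ℝ) :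
    ∑' j, ‖W.bump j y‖ₑ ≤ 1 := by
  rcases (criticalRadius.nonneg (ν := ν) (β := β) y).eq_or_lt with hy | hy
  · simp [W.bump_eq_zero_of_radius_eq_zero hν hβ hy.symm]
  · have h := W.hasSum_bump y hy
    simp_rw [fun j => Real.enorm_of_nonneg (W.bump_nonneg j y)]
    rw [← ENNReal.ofReal_tsum_of_nonneg (fun j => W.bump_nonneg j y) h.summable, h.tsum_eq]
    simp

/-- This finiteness is only pointwise. The family may accumulate at points of {ρ = 0}, so continuity
and weak differentiability of the correction need separate convergence arguments. -/
lemma finite_setOf_mem_ball (hν : ν ≠ 0) (hβ : 0 < β) (y : Fin n → ℝ) :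
    {j : W.centres | y ∈ ball (j : Fin n → ℝ) (W.radius j / 2)}.Finite := by
  have h := ENNReal.finite_const_le_of_tsum_ne_top
    ((W.tsum_indicator_le hν hβ y).trans_lt ENNReal.ofReal_lt_top).ne one_ne_zero
  refine h.subset fun j hj => ?_
  rw [Set.mem_ofPred_eq] at hj ⊢
  rw [Set.indicator_of_mem hj]

lemma summable_correction (hν : ν ≠ 0) (hβ : 0 < β) (c : W.centres → ℝ) (f : (Fin n → ℝ) → ℝ)
    (y : Fin n → ℝ) : Summable fun j => W.bump j y * (c j - f y) := by
  refine summable_of_hasFiniteSupport ((W.finite_setOf_mem_ball hν hβ y).subset fun j hj => ?_)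
  by_contra h
  exact hj (by simp [W.bump_eq_zero j y h])

lemma correction_add (hν : ν ≠ 0) (hβ : 0 < β) (c d : W.centres → ℝ) (f g : (Fin n → ℝ) → ℝ) :
    W.correction (c + d) (f + g) = W.correction c f + W.correction d g := by
  ext y
  simp only [correction, Pi.add_apply]
  rw [← (W.summable_correction hν hβ c f y).tsum_add (W.summable_correction hν hβ d g y)]
  congr 1; ext j; ring

lemma correction_smul (a : ℝ) (c : W.centres → ℝ) (f : (Fin n → ℝ) → ℝ) :
    W.correction (a • c) (a • f) = a • W.correction c f := by
  ext y
  simp only [correction, Pi.smul_apply, smul_eq_mul]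
  rw [← tsum_mul_left]
  congr 1; ext j; ring

/-- If the coefficients vanish and `f` vanishes where the critical radius does, then adding the
correction to `f` gives zero. -/
lemma correction_zero {c : W.centres → ℝ} {f : (Fin n → ℝ) → ℝ}
    (hc : ∀ j, c j = 0) (hf : ∀ x, criticalRadius ν β x = 0 → f x = 0) :
    W.correction c f = -f := by
  ext y
  rcases (criticalRadius.nonneg (ν := ν) (β := β) y).eq_or_lt with hy | hy
  · simp [correction, hf y hy.symm, hc]
  · simp only [correction, hc, zero_sub]
    rw [tsum_mul_right, (W.hasSum_bump y hy).tsum_eq, one_mul, Pi.neg_apply]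

/-- The numbers `e j` bound the distances of `f` to the coefficients `c j` near the centres. -/
def IsErrorBound (c : W.centres → ℝ) (f : (Fin n → ℝ) → ℝ) (e : W.centres → ℝ≥0∞) : Prop :=
  ∀ j : W.centres, ∀ y ∈ ball (j : Fin n → ℝ) (W.radius j / 2), ‖c j - f y‖ₑ ≤ e j

variable {c : W.centres → ℝ} {f : (Fin n → ℝ) → ℝ} {e : W.centres → ℝ≥0∞}

lemma error_le_of_rpow_le {P : ℝ} (hP : 0 < P) {j : W.centres} {D : ℝ≥0∞}
    (h : ENNReal.ofReal (W.radius j ^ (-β)) * e j ^ P ≤ D ^ P) :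
    e j ≤ ENNReal.ofReal (W.radius j ^ (β / P)) * D := by
  have hr := W.radius_pos' j
  have h1 : e j ^ P ≤ (ENNReal.ofReal (W.radius j ^ (β / P)) * D) ^ P := by
    rw [ENNReal.mul_rpow_of_nonneg _ _ hP.le, ENNReal.ofReal_rpow_of_pos (by positivity),
      ← Real.rpow_mul hr.le, div_mul_cancel₀ _ hP.ne']
    calc e j ^ P = ENNReal.ofReal (W.radius j ^ β) *
          (ENNReal.ofReal (W.radius j ^ (-β)) * e j ^ P) := by
          rw [← mul_assoc, ← ENNReal.ofReal_mul (by positivity), ← Real.rpow_add hr]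
          simp
      _ ≤ _ := by gcongr
  exact (ENNReal.rpow_le_rpow_iff hP).1 h1

/-- A weighted bound on the error becomes a pointwise bound with the factor ρ(y)^(β/P), because r ≤
2 ρ(y) wherever the bump is active. -/
lemma enorm_bump_mul_le (he : W.IsErrorBound c f e) (hν : ν ≠ 0) (hβ : 0 < β) {P : ℝ} (hP : 0 < P) {j : W.centres}
    {D : ℝ≥0∞} (h : ENNReal.ofReal (W.radius j ^ (-β)) * e j ^ P ≤ D ^ P) (y : Fin n → ℝ) :
    ‖W.bump j y * (c j - f y)‖ₑ ≤
      ‖W.bump j y‖ₑ * (ENNReal.ofReal ((2 * criticalRadius ν β y) ^ (β / P)) * D) := by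
  have hr := W.radius_pos' j
  by_cases hy : y ∈ ball (j : Fin n → ℝ) (W.radius j / 2)
  · rw [enorm_mul]
    gcongr
    refine ((he j y hy).trans (W.error_le_of_rpow_le hP h)).trans ?_
    gcongr
    exact W.radius_le_of_mem hν hβ hy
  · simp [W.bump_eq_zero j y hy]

lemma tsum_enorm_correction_le (he : W.IsErrorBound c f e) (hν : ν ≠ 0) (hβ : 0 < β) {P : ℝ} (hP : 0 < P) (y : Fin n → ℝ) :
    ∑' j, ‖W.bump j y * (c j - f y)‖ₑ ≤ ENNReal.ofReal ((2 * criticalRadius ν β y) ^ (β / P)) *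
      (∑' j, ENNReal.ofReal (W.radius j ^ (-β)) * e j ^ P) ^ (1 / P) := by
  set A := ∑' j, ENNReal.ofReal (W.radius j ^ (-β)) * e j ^ P
  have h : ∀ j, ENNReal.ofReal (W.radius j ^ (-β)) * e j ^ P ≤ (A ^ (1 / P)) ^ P := fun j => by
    rw [← ENNReal.rpow_mul, one_div_mul_cancel hP.ne', ENNReal.rpow_one]
    exact ENNReal.le_tsum j
  refine (ENNReal.tsum_le_tsum fun j => W.enorm_bump_mul_le he hν hβ hP (h j) y).trans ?_
  rw [ENNReal.tsum_mul_right]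
  exact mul_le_of_le_one_left zero_le (W.tsum_enorm_bump_le hν hβ y)

lemma continuous_criticalRadius (hν : ν ≠ 0) (hβ : 0 < β) : Continuous (criticalRadius ν β) :=
  (LipschitzWith.of_le_add fun x y => criticalRadius.le_add_dist hν hβ x y).continuous

/-- Convergence of the weighted series leaves only finitely many indices with a weighted error above
D^P. The remaining terms add up to at most K D uniformly on the unit ball around x, so finite sums
of continuous functions approximate locally uniformly. -/
lemma continuous_correction (he : W.IsErrorBound c f e) (hν : ν ≠ 0) (hβ : 0 < β) {P : ℝ} (hP : 0 < P) (hf : Continuous f)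
    (hA : ∑' j, ENNReal.ofReal (W.radius j ^ (-β)) * e j ^ P ≠ ⊤) :
    Continuous (W.correction c f) := by
  refine continuous_of_locally_uniform_approx_of_continuousAt fun x u hu => ?_
  obtain ⟨ε, hε, hεu⟩ := mem_uniformity_edist.1 hu
  set K := ENNReal.ofReal ((2 * (criticalRadius ν β x + 1)) ^ (β / P))
  have hx0 := criticalRadius.nonneg (ν := ν) (β := β) x
  have hK0 : K ≠ 0 := by
    simp only [K, ne_eq, ENNReal.ofReal_eq_zero, not_le]; positivity
  obtain ⟨D, hD0, hD⟩ : ∃ D, 0 < D ∧ K * D < ε := by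
    obtain ⟨δ, hδ, hδε⟩ := exists_between hε
    refine ⟨δ / K, ENNReal.div_pos hδ.ne' ENNReal.ofReal_ne_top, ?_⟩
    rwa [ENNReal.mul_div_cancel hK0 ENNReal.ofReal_ne_top]
  have hfin := ENNReal.finite_const_le_of_tsum_ne_top hA
    (ε := D ^ P) (by simp [hD0.ne', hP, hP.le])
  set S : Finset W.centres := hfin.toFinset
  have hS : ∀ j ∉ S, ENNReal.ofReal (W.radius j ^ (-β)) * e j ^ P ≤ D ^ P := fun j hj => by
    simp only [S, Set.Finite.mem_toFinset, Set.mem_ofPred_eq, not_le] at hj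
    exact hj.le
  refine ⟨ball x 1, ball_mem_nhds _ one_pos, fun y => ∑ j ∈ S, W.bump j y * (c j - f y),
    ?_, fun y hy => hεu ?_⟩
  · refine Continuous.continuousAt (continuous_finsetSum _ fun j _ => ?_)
    exact (W.contDiff_bump j).continuous.mul (continuous_const.sub hf)
  · rw [correction, ← (W.summable_correction hν hβ c f y).sum_add_tsum_subtype_compl S,
      edist_eq_enorm_sub, add_sub_cancel_left]
    refine lt_of_le_of_lt ?_ hD
    calc _ ≤ ∑' j : {j // j ∉ S}, ‖W.bump j y * (c j - f y)‖ₑ := enorm_tsum_le_tsum_enorm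
      _ ≤ ∑' j : {j // j ∉ S}, ‖W.bump j y‖ₑ * (K * D) := by
          refine ENNReal.tsum_le_tsum fun j => ?_
          refine (W.enorm_bump_mul_le he hν hβ hP (hS j j.2) y).trans ?_
          have h1 := criticalRadius.nonneg (ν := ν) (β := β) y
          have h2 := criticalRadius.le_add_dist hν hβ y x
          rw [mem_ball] at hy
          exact mul_le_mul_right (mul_le_mul_left (ENNReal.ofReal_le_ofReal
            (Real.rpow_le_rpow (by positivity) (by linarith) (by positivity))) _) _
      _ = (∑' j : {j // j ∉ S}, ‖W.bump j y‖ₑ) * (K * D) := ENNReal.tsum_mul_right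
      _ ≤ 1 * (K * D) := by
          gcongr
          exact (ENNReal.tsum_comp_le_tsum_of_injective Subtype.val_injective
            (fun j => ‖W.bump j y‖ₑ)).trans (W.tsum_enorm_bump_le hν hβ y)
      _ = _ := one_mul _

lemma lintegral_correction_rpow_le (he : W.IsErrorBound c f e) (hν : ν ≠ 0) (hβ : 0 < β) {P : ℝ} (hP : 1 ≤ P) :
    ∫⁻ y, ‖W.correction c f y‖ₑ ^ P ∂ν ≤ ENNReal.ofReal (48 ^ n) ^ (P - 1) *
      ENNReal.ofReal (2 ^ β) * ∑' j, ENNReal.ofReal (W.radius j ^ (-β)) * e j ^ P := by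
  calc _ ≤ ∫⁻ y, (∑' j : W.centres,
        (ball (j : Fin n → ℝ) (W.radius j / 2)).indicator (fun _ => e j) y) ^ P ∂ν := by
        refine lintegral_mono fun y => ENNReal.rpow_le_rpow ?_ (by linarith)
        refine enorm_tsum_le_tsum_enorm.trans (ENNReal.tsum_le_tsum fun j => ?_)
        by_cases hy : y ∈ ball (j : Fin n → ℝ) (W.radius j / 2)
        · rw [Set.indicator_of_mem hy, enorm_mul]
          exact (mul_le_of_le_one_left zero_le ((ENNReal.le_tsum j).trans
            (W.tsum_enorm_bump_le hν hβ y))).trans (he j y hy)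
        · simp [W.bump_eq_zero j y hy]
    _ ≤ _ := lintegral_tsum_indicator_rpow_le ν (fun j => measurableSet_ball) e
        (W.tsum_indicator_le hν hβ) hP
    _ ≤ ENNReal.ofReal (48 ^ n) ^ (P - 1) * ∑' j, ENNReal.ofReal (2 ^ β) *
        (ENNReal.ofReal (W.radius j ^ (-β)) * e j ^ P) := by
        refine mul_le_mul_right (ENNReal.tsum_le_tsum fun j => ?_) _
        rw [← mul_assoc]
        exact mul_le_mul_left (W.measure_ball_le hβ j) _
    _ = _ := by rw [ENNReal.tsum_mul_left, mul_assoc]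

/-- An upper bound for the sizes of the terms of `correctionGrad`. -/
noncomputable def gradBound (e : W.centres → ℝ≥0∞) (y : Fin n → ℝ) : ℝ≥0∞ :=
  ∑' j : W.centres, (ball (j : Fin n → ℝ) (W.radius j / 2)).indicator
    (fun _ => B / ENNReal.ofReal (W.radius j) * e j) y

lemma measurable_gradBound : Measurable (W.gradBound e) :=
  Measurable.tsum fun _ => measurable_const.indicator measurableSet_ball

lemma tsum_enorm_grad_le (he : W.IsErrorBound c f e) (hν : ν ≠ 0) (hβ : 0 < β) (G : (Fin n → ℝ) → (Fin n → ℝ))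
    (y : Fin n → ℝ) (i : Fin n) :
    ∑' j, ‖(c j - f y) * fderiv ℝ (W.bump j) y (Pi.single i 1) - W.bump j y * G y i‖ₑ ≤
      W.gradBound e y + ‖G y‖ₑ := by
  calc _ ≤ ∑' j : W.centres, ((ball (j : Fin n → ℝ) (W.radius j / 2)).indicator
        (fun _ => B / ENNReal.ofReal (W.radius j) * e j) y + ‖W.bump j y‖ₑ * ‖G y‖ₑ) := by
        refine ENNReal.tsum_le_tsum fun j => ?_
        refine enorm_sub_le.trans (add_le_add ?_ ?_)
        · by_cases hy : y ∈ ball (j : Fin n → ℝ) (W.radius j / 2)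
          · rw [Set.indicator_of_mem hy, enorm_mul, mul_comm]
            refine mul_le_mul' ?_ (he j y hy)
            have h1 : ‖fderiv ℝ (W.bump j) y (Pi.single i 1)‖ ≤ ‖fderiv ℝ (W.bump j) y‖ := by
              refine (ContinuousLinearMap.le_opNorm _ _).trans ?_
              rw [Pi.norm_single]; simp
            refine le_trans ?_ (W.enorm_fderiv_bump_le j y)
            rw [← ofReal_norm, ← ofReal_norm]
            exact ENNReal.ofReal_le_ofReal h1
          · simp [W.fderiv_bump_eq_zero j hy]
        · rw [enorm_mul]
          gcongr
          exact enorm_le_iff_norm_le.2 (norm_le_pi_norm _ i)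
    _ = W.gradBound e y + (∑' j, ‖W.bump j y‖ₑ) * ‖G y‖ₑ := by
        rw [ENNReal.tsum_add, ENNReal.tsum_mul_right]; rfl
    _ ≤ _ := by
        gcongr
        exact mul_le_of_le_one_left zero_le (W.tsum_enorm_bump_le hν hβ y)

/-- A ball of radius r/2 in the maximum norm has volume exactly r^n, and r^n r^(-(n+β)) = r^(-β). -/
lemma lintegral_gradBound_rpow_le (hν : ν ≠ 0) (hβ : 0 < β) (hP : 1 ≤ n + β)
    (e : W.centres → ℝ≥0∞) :
    ∫⁻ y, W.gradBound e y ^ (n + β) ≤ ENNReal.ofReal (48 ^ n) ^ (n + β - 1) * B ^ (n + β) *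
      ∑' j, ENNReal.ofReal (W.radius j ^ (-β)) * e j ^ (n + β) := by
  have hP0 : 0 ≤ n + β := by linarith
  refine (lintegral_tsum_indicator_rpow_le volume (fun j => measurableSet_ball) _
    (W.tsum_indicator_le hν hβ) hP).trans (le_of_eq ?_)
  rw [mul_assoc]
  congr 1
  rw [← ENNReal.tsum_mul_left]
  refine tsum_congr fun j => ?_
  have hr := W.radius_pos' j
  rw [Real.volume_pi_ball _ (by positivity), ENNReal.mul_rpow_of_nonneg _ _ hP0,
    ENNReal.div_rpow_of_nonneg _ _ hP0, ENNReal.ofReal_rpow_of_pos hr, Fintype.card_fin,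
    mul_div_cancel₀ _ two_ne_zero, ENNReal.div_eq_inv_mul, ← ENNReal.ofReal_inv_of_pos (by positivity)]
  have : ENNReal.ofReal (W.radius j ^ (-β)) =
      ENNReal.ofReal (W.radius j ^ n) * ENNReal.ofReal (W.radius j ^ (n + β))⁻¹ := by
    rw [← ENNReal.ofReal_mul (by positivity), ← Real.rpow_natCast, ← Real.rpow_neg hr.le,
      ← Real.rpow_add hr]
    congr 2; ring
  rw [this]; ring

lemma lintegral_correctionGrad_rpow_le (he : W.IsErrorBound c f e) (hν : ν ≠ 0) (hβ : 0 < β) (hP : 1 ≤ n + β)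
    (G : (Fin n → ℝ) → (Fin n → ℝ)) :
    ∫⁻ y, ‖W.correctionGrad c f G y‖ₑ ^ (n + β) ≤ 2 ^ (n + β - 1) *
      (ENNReal.ofReal (48 ^ n) ^ (n + β - 1) * B ^ (n + β) *
        (∑' j, ENNReal.ofReal (W.radius j ^ (-β)) * e j ^ (n + β)) +
        ∫⁻ y, ‖G y‖ₑ ^ (n + β)) := by
  calc _ ≤ ∫⁻ y, 2 ^ (n + β - 1) * (W.gradBound e y ^ (n + β) + ‖G y‖ₑ ^ (n + β)) := by
        refine lintegral_mono fun y => ?_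
        refine le_trans (ENNReal.rpow_le_rpow (pi_enorm_le_of_forall_le fun i => ?_) (by linarith))
          (ENNReal.rpow_add_le_mul_rpow_add_rpow _ _ hP)
        exact enorm_tsum_le_tsum_enorm.trans (W.tsum_enorm_grad_le he hν hβ G y i)
    _ = 2 ^ (n + β - 1) * ((∫⁻ y, W.gradBound e y ^ (n + β)) + ∫⁻ y, ‖G y‖ₑ ^ (n + β)) := by
        rw [lintegral_const_mul' _ _ (by
          refine ENNReal.rpow_ne_top_of_nonneg (by linarith) (by simp)),
          lintegral_add_left (W.measurable_gradBound.pow_const _)]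
    _ ≤ _ := by
        gcongr
        exact W.lintegral_gradBound_rpow_le hν hβ hP e

lemma measurable_correctionGrad (hf : Continuous f) {G : (Fin n → ℝ) → (Fin n → ℝ)}
    (hG : Measurable G) : Measurable (W.correctionGrad c f G) := by
  refine measurable_pi_lambda _ fun i => Measurable.tsum fun j => ?_
  have h1 : Measurable fun y => fderiv ℝ (W.bump j) y (Pi.single i 1) :=
    (((W.contDiff_bump j).continuous_fderiv (by simp)).clm_apply continuous_const).measurable
  have h2 := (W.contDiff_bump j).continuous.measurable
  have h3 := hf.measurable
  fun_prop

/-- Each summand obeys the Leibniz rule. Sum and integral may be exchanged on both sides by absolute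
convergence: the function series is dominated by a multiple of ρ^(β/P), the gradient series by an
L_P function, and both are paired with compactly supported factors. Thus {ρ = 0} contributes no
extra distributional term. -/
lemma hasWeakGradient_correction (he : W.IsErrorBound c f e) (hν : ν ≠ 0) (hβ : 0 < β) (hP : 1 ≤ n + β) (hf : Continuous f)
    {G : (Fin n → ℝ) → (Fin n → ℝ)} (hG : Measurable G)
    (hGi : ∀ i, LocallyIntegrable fun x => G x i) (hG' : ∫⁻ y, ‖G y‖ₑ ^ (n + β) ≠ ⊤)
    (h : HasWeakGradient f G) (hB : B ≠ ⊤)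
    (hA : ∑' j, ENNReal.ofReal (W.radius j ^ (-β)) * e j ^ (n + β) ≠ ⊤) :
    HasWeakGradient (W.correction c f) (W.correctionGrad c f G) := by
  intro ψ hψ hs i
  set P := n + β
  have hP0 : 0 < P := by linarith
  have hψc := hψ.continuous
  have hψd : Continuous fun x => fderiv ℝ ψ x (Pi.single i 1) :=
    (hψ.continuous_fderiv (by simp)).clm_apply continuous_const
  have hsd : HasCompactSupport fun x => fderiv ℝ ψ x (Pi.single i 1) :=
    hs.fderiv_apply (𝕜 := ℝ) (Pi.single i 1)
  have hbd : ∀ j, Continuous fun y => fderiv ℝ (W.bump j) y (Pi.single i 1) := fun j =>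
    ((W.contDiff_bump j).continuous_fderiv (by simp)).clm_apply continuous_const
  have hbc : ∀ j, Continuous (W.bump j) := fun j => (W.contDiff_bump j).continuous
  have hρ := continuous_criticalRadius (ν := ν) hν hβ
  have hβP : 0 < β / P := by positivity
  have hm1 : ∀ j, AEStronglyMeasurable
      (fun y => W.bump j y * (c j - f y) * fderiv ℝ ψ y (Pi.single i 1)) := fun j =>
    (((hbc j).mul (continuous_const.sub hf)).mul hψd).aestronglyMeasurable
  have hm2 : ∀ j, AEStronglyMeasurable (fun y =>
      ((c j - f y) * fderiv ℝ (W.bump j) y (Pi.single i 1) - W.bump j y * G y i) * ψ y) := by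
    intro j
    have h1 := (hbc j).measurable
    have h2 := (hbd j).measurable
    have h3 := hf.measurable
    have h4 := hψc.measurable
    exact Measurable.aestronglyMeasurable (by fun_prop)
  have hfin1 : ∑' j, ∫⁻ y, ‖W.bump j y * (c j - f y) * fderiv ℝ ψ y (Pi.single i 1)‖ₑ ≠ ⊤ := by
    rw [← lintegral_tsum fun j => (hm1 j).enorm]
    have hint : Integrable fun y => (2 * criticalRadius ν β y) ^ (β / P) *
        fderiv ℝ ψ y (Pi.single i 1) := by
      refine Continuous.integrable_of_hasCompactSupport ?_ hsd.mul_left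
      exact ((continuous_const.mul hρ).rpow_const fun y => Or.inr hβP.le).mul hψd
    refine ne_top_of_le_ne_top (ENNReal.mul_ne_top (ENNReal.rpow_ne_top_of_nonneg
      (by positivity : 0 ≤ 1 / P) hA) hint.2.ne) ?_
    rw [← lintegral_const_mul'' _ hint.1.enorm]
    refine lintegral_mono fun y => ?_
    simp_rw [fun j => enorm_mul (W.bump j y * (c j - f y)) (fderiv ℝ ψ y (Pi.single i 1))]
    rw [ENNReal.tsum_mul_right, enorm_mul, ← mul_assoc]
    gcongr
    refine (W.tsum_enorm_correction_le he hν hβ hP0 y).trans_eq ?_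
    rw [mul_comm, Real.enorm_of_nonneg]
    have := criticalRadius.nonneg (ν := ν) (β := β) y
    positivity
  have hfin2 : ∑' j, ∫⁻ y, ‖((c j - f y) * fderiv ℝ (W.bump j) y (Pi.single i 1) -
      W.bump j y * G y i) * ψ y‖ₑ ≠ ⊤ := by
    rw [← lintegral_tsum fun j => (hm2 j).enorm]
    obtain ⟨M, hM⟩ := hψc.bounded_above_of_compact_support hs
    set T := tsupport ψ
    set K : (Fin n → ℝ) → ℝ≥0∞ := fun y => W.gradBound e y + ‖G y‖ₑ
    have hKm : Measurable K := W.measurable_gradBound.add (by fun_prop)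
    have hKP : ∫⁻ y, K y ^ P ≠ ⊤ := by
      have h1 : ∫⁻ y, K y ^ P ≤ ∫⁻ y, 2 ^ (P - 1) * (W.gradBound e y ^ P + ‖G y‖ₑ ^ P) :=
        lintegral_mono fun y => ENNReal.rpow_add_le_mul_rpow_add_rpow _ _ hP
      refine ne_top_of_le_ne_top ?_ h1
      have h2 : (2 : ℝ≥0∞) ^ (P - 1) ≠ ⊤ := ENNReal.rpow_ne_top_of_nonneg (by linarith) (by simp)
      rw [lintegral_const_mul' _ _ h2, lintegral_add_left (W.measurable_gradBound.pow_const _)]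
      refine ENNReal.mul_ne_top h2 (ENNReal.add_ne_top.2 ⟨?_, hG'⟩)
      refine ne_top_of_le_ne_top ?_ (W.lintegral_gradBound_rpow_le hν hβ hP e)
      refine ENNReal.mul_ne_top (ENNReal.mul_ne_top ?_ ?_) hA
      · exact ENNReal.rpow_ne_top_of_nonneg (by linarith) (by simp)
      · exact ENNReal.rpow_ne_top_of_nonneg (by linarith) hB
    have hKT : ∫⁻ y in T, K y ≠ ⊤ := by
      have h1 := lintegral_rpow_le_measure_univ_rpow_mul (volume.restrict T) hP hKm.aemeasurable
      rw [Measure.restrict_apply_univ] at h1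
      have h2 : (∫⁻ y in T, K y) ^ P < ⊤ := by
        refine h1.trans_lt (ENNReal.mul_lt_top ?_
          ((setLIntegral_le_lintegral _ _).trans_lt hKP.lt_top))
        exact ENNReal.rpow_lt_top_of_nonneg (by linarith) hs.isCompact.measure_lt_top.ne
      exact ((ENNReal.rpow_lt_top_iff_of_pos hP0).1 h2).ne
    refine ne_top_of_le_ne_top (ENNReal.mul_ne_top hKT (ENNReal.ofReal_ne_top (r := M))) ?_
    rw [← lintegral_mul_const' _ _ ENNReal.ofReal_ne_top,
      ← lintegral_indicator (isClosed_tsupport ψ).measurableSet]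
    refine lintegral_mono fun y => ?_
    simp_rw [fun j => enorm_mul ((c j - f y) * fderiv ℝ (W.bump j) y (Pi.single i 1) -
      W.bump j y * G y i) (ψ y)]
    rw [ENNReal.tsum_mul_right]
    by_cases hy : y ∈ T
    · rw [Set.indicator_of_mem hy]
      refine mul_le_mul' (W.tsum_enorm_grad_le he hν hβ G y i) ?_
      rw [← ofReal_norm]
      exact ENNReal.ofReal_le_ofReal (hM y)
    · rw [image_eq_zero_of_notMem_tsupport hy]; simp
  have h1 := integral_tsum hm1 hfin1
  have h2 := integral_tsum hm2 hfin2
  simp_rw [tsum_mul_right] at h1 h2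
  change ∫ y, W.correction c f y * _ = - ∫ y, W.correctionGrad c f G y i * ψ y
  rw [show (∫ y, W.correction c f y * fderiv ℝ ψ y (Pi.single i 1)) = _ from h1,
    show (∫ y, W.correctionGrad c f G y i * ψ y) = _ from h2, ← tsum_neg]
  exact tsum_congr fun j => h.mul_const_sub hf hGi (c j) (W.contDiff_bump j) ψ hψ hs i

end CriticalPartition

/-! ### From the correction to bounded linear operators. -/

/-- The correction of a pair with respect to a suitable partition is controlled by the pair. -/
lemma exists_partition_correction_le (hn : 1 ≤ n) {β : ℝ} (hβ : 0 < β) :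
    ∃ B C : ℝ≥0∞, C ≠ ⊤ ∧ ∀ ν : Measure (Fin n → ℝ), ν ≠ 0 → ∃ W : CriticalPartition ν β B,
      ∀ (f₁ f₂ : (Fin n → ℝ) → ℝ) (G : (Fin n → ℝ) → (Fin n → ℝ)), Continuous f₁ → Measurable G →
      (∀ i, LocallyIntegrable fun x => G x i) → HasWeakGradient f₁ G →
      ∫⁻ x, ‖G x‖ₑ ^ (n + β) ≠ ⊤ → AEStronglyMeasurable f₂ ν → ∫⁻ x, ‖f₂ x‖ₑ ^ (n + β) ∂ν ≠ ⊤ →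
      Continuous (W.correction (fun j => W.coeff j f₁ f₂) f₁) ∧
      HasWeakGradient (W.correction (fun j => W.coeff j f₁ f₂) f₁)
        (W.correctionGrad (fun j => W.coeff j f₁ f₂) f₁ G) ∧
      Measurable (W.correctionGrad (fun j => W.coeff j f₁ f₂) f₁ G) ∧
      ∫⁻ x, ‖W.correctionGrad (fun j => W.coeff j f₁ f₂) f₁ G x‖ₑ ^ (n + β) ≤
        C * ((∫⁻ x, ‖G x‖ₑ ^ (n + β)) + ∫⁻ x, ‖f₂ x‖ₑ ^ (n + β) ∂ν) ∧
      ∫⁻ x, ‖W.correction (fun j => W.coeff j f₁ f₂) f₁ x‖ₑ ^ (n + β) ∂ν ≤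
        C * ((∫⁻ x, ‖G x‖ₑ ^ (n + β)) + ∫⁻ x, ‖f₂ x‖ₑ ^ (n + β) ∂ν) := by
  have hn' : (1 : ℝ) ≤ n := by exact_mod_cast hn
  have hP : 1 ≤ n + β := by linarith
  have hP0 : 0 < n + β := by linarith
  -- Any exponent strictly between n and p would do: Morrey requires q > n, the Carleson embedding q
  -- < p.
  set q : ℝ := n + β / 2
  have hq : 1 ≤ q := by simp only [q]; linarith
  have hqP : q < n + β := by simp only [q]; linarith
  obtain ⟨M, hM, hMorrey⟩ := exists_morrey (n := n) hq (by simp only [q]; linarith)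
  obtain ⟨B, hB, hW⟩ := exists_criticalPartition n
  obtain ⟨C₁, hC₁, hgrad⟩ : ∃ C₁ : ℝ≥0∞, C₁ ≠ ⊤ ∧ ∀ (ν : Measure (Fin n → ℝ))
      (W : CriticalPartition ν β B) (G : (Fin n → ℝ) → (Fin n → ℝ)), Measurable G →
      ∑' j : W.centres, ENNReal.ofReal (W.radius j ^ (-β)) * W.gradErr q j G ^ (n + β) ≤
        C₁ * ∫⁻ y, ‖G y‖ₑ ^ (n + β) := by
    refine ⟨_, ?_, fun ν W G hG => W.tsum_gradErr_le hβ (by linarith) hqP hG⟩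
    have h1 : 1 < (n + β) / q := (one_lt_div (by linarith)).2 hqP
    refine ENNReal.mul_ne_top (ENNReal.mul_ne_top ENNReal.ofReal_ne_top
      (ENNReal.rpow_ne_top_of_nonneg (by linarith) ENNReal.ofReal_ne_top))
      (ENNReal.mul_ne_top (by finiteness) (ENNReal.div_ne_top
        (ENNReal.rpow_ne_top_of_nonneg (by linarith) (by simp)) ?_))
    simp only [ne_eq, ENNReal.ofReal_eq_zero, not_le]
    linarith
  obtain ⟨C₂, hC₂, havg⟩ : ∃ C₂ : ℝ≥0∞, C₂ ≠ ⊤ ∧ ∀ (ν : Measure (Fin n → ℝ)) (_ : ν ≠ 0)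
      (W : CriticalPartition ν β B) (f₂ : (Fin n → ℝ) → ℝ), AEStronglyMeasurable f₂ ν →
      ∑' j : W.centres, ENNReal.ofReal (W.radius j ^ (-β)) * W.avgErr (n + β) j f₂ ^ (n + β) ≤
        C₂ * ∫⁻ y, ‖f₂ y‖ₑ ^ (n + β) ∂ν := by
    refine ⟨_, ?_, fun ν hν W f₂ hf₂ => W.tsum_avgErr_le hν hβ hP0 hf₂⟩
    have := finite_integral_one_add_norm (μ := (volume : Measure (Fin n → ℝ))) (r := n + β)
      (by simpa using hβ)
    exact ENNReal.mul_ne_top ENNReal.ofReal_ne_top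
      (ENNReal.mul_ne_top ENNReal.ofReal_ne_top this.ne)
  have h2P : (2 : ℝ≥0∞) ^ (n + β - 1) ≠ ⊤ := ENNReal.rpow_ne_top_of_nonneg (by linarith) (by simp)
  have hMP : M ^ (n + β) ≠ ⊤ := ENNReal.rpow_ne_top_of_nonneg hP0.le hM
  have hBP : B ^ (n + β) ≠ ⊤ := ENNReal.rpow_ne_top_of_nonneg hP0.le hB
  have h48 : ENNReal.ofReal (48 ^ n) ^ (n + β - 1) ≠ ⊤ :=
    ENNReal.rpow_ne_top_of_nonneg (by linarith) ENNReal.ofReal_ne_top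
  set C₃ := (2 : ℝ≥0∞) ^ (n + β - 1) * (M ^ (n + β) * C₁ + C₂)
  have hC₃ : C₃ ≠ ⊤ := by finiteness
  set C₄ := (2 : ℝ≥0∞) ^ (n + β - 1) *
    (ENNReal.ofReal (48 ^ n) ^ (n + β - 1) * B ^ (n + β) * C₃ + 1)
  set C₅ := ENNReal.ofReal (48 ^ n) ^ (n + β - 1) * ENNReal.ofReal (2 ^ β) * C₃
  refine ⟨B, C₄ + C₅, by finiteness, fun ν hν => ?_⟩
  obtain ⟨W⟩ := hW ν β hν hβ
  refine ⟨W, fun f₁ f₂ G hf₁ hG hGi hwg hGt hf₂ hf₂t => ?_⟩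
  set A := (∫⁻ x, ‖G x‖ₑ ^ (n + β)) + ∫⁻ x, ‖f₂ x‖ₑ ^ (n + β) ∂ν
  set e : W.centres → ℝ≥0∞ := fun j => M * W.gradErr q j G + W.avgErr (n + β) j f₂
  have he : W.IsErrorBound (fun j => W.coeff j f₁ f₂) f₁ e := fun j y hy =>
    W.enorm_coeff_sub_le hν hβ hP hf₁ hf₂ hf₂t.lt_top j (fun x hx z hz => by
      rw [CriticalPartition.gradErr, ← mul_assoc]
      exact hMorrey f₁ hf₁ G hG hwg j _ (by have := W.radius_pos' j; positivity) x hx z hz) hy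
  have hsum : ∑' j, ENNReal.ofReal (W.radius j ^ (-β)) * e j ^ (n + β) ≤ C₃ * A := by
    calc _ ≤ ∑' j, (2 : ℝ≥0∞) ^ (n + β - 1) *
          (M ^ (n + β) * (ENNReal.ofReal (W.radius j ^ (-β)) * W.gradErr q j G ^ (n + β)) +
            ENNReal.ofReal (W.radius j ^ (-β)) * W.avgErr (n + β) j f₂ ^ (n + β)) := by
          refine ENNReal.tsum_le_tsum fun j => ?_
          refine (mul_le_mul_right (ENNReal.rpow_add_le_mul_rpow_add_rpow _ _ hP) _).trans_eq ?_
          rw [ENNReal.mul_rpow_of_nonneg _ _ hP0.le]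
          ring
      _ ≤ (2 : ℝ≥0∞) ^ (n + β - 1) * (M ^ (n + β) * (C₁ * ∫⁻ y, ‖G y‖ₑ ^ (n + β)) +
            C₂ * ∫⁻ y, ‖f₂ y‖ₑ ^ (n + β) ∂ν) := by
          rw [ENNReal.tsum_mul_left, ENNReal.tsum_add, ENNReal.tsum_mul_left]
          gcongr
          · exact hgrad ν W G hG
          · exact havg ν hν W f₂ hf₂
      _ ≤ (2 : ℝ≥0∞) ^ (n + β - 1) * (M ^ (n + β) * (C₁ * A) + C₂ * A) := by
          gcongr
          · exact le_self_add
          · exact le_add_self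
      _ = _ := by ring
  have hAt : A ≠ ⊤ := ENNReal.add_ne_top.2 ⟨hGt, hf₂t⟩
  have hsumt := ne_top_of_le_ne_top (ENNReal.mul_ne_top hC₃ hAt) hsum
  refine ⟨W.continuous_correction he hν hβ hP0 hf₁ hsumt,
    W.hasWeakGradient_correction he hν hβ hP hf₁ hG hGi hGt hwg hB hsumt,
    W.measurable_correctionGrad hf₁ hG, ?_, ?_⟩
  · calc _ ≤ (2 : ℝ≥0∞) ^ (n + β - 1) *
          (ENNReal.ofReal (48 ^ n) ^ (n + β - 1) * B ^ (n + β) * (C₃ * A) + A) := by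
          refine (W.lintegral_correctionGrad_rpow_le he hν hβ hP G).trans ?_
          gcongr
          exact le_self_add
      _ = C₄ * A := by ring
      _ ≤ _ := by gcongr; exact le_self_add
  · calc _ ≤ ENNReal.ofReal (48 ^ n) ^ (n + β - 1) * ENNReal.ofReal (2 ^ β) * (C₃ * A) := by
          refine (W.lintegral_correction_rpow_le he hν hβ hP).trans ?_
          gcongr
      _ = C₅ * A := by ring
      _ ≤ _ := by gcongr; exact le_add_self

lemma Lp_enorm_rpow_eq {α E : Type*} {m0 : MeasurableSpace α} {m : Measure α}
    [NormedAddCommGroup E] {p : ℝ≥0∞} (h0 : p ≠ 0) (ht : p ≠ ⊤) (f : Lp E p m) :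
    ‖f‖ₑ ^ p.toReal = ∫⁻ x, ‖f x‖ₑ ^ p.toReal ∂m := by
  rw [Lp.enorm_def, eLpNorm_eq_lintegral_rpow_enorm_toReal h0 ht, ← ENNReal.rpow_mul,
    one_div_mul_cancel (ENNReal.toReal_pos h0 ht).ne', ENNReal.rpow_one]

lemma memLp_of_lintegral_rpow_ne_top {α E : Type*} {m0 : MeasurableSpace α} {m : Measure α}
    [NormedAddCommGroup E] {p : ℝ≥0∞} (h0 : p ≠ 0) (ht : p ≠ ⊤) {f : α → E}
    (hf : AEStronglyMeasurable f m) (h : ∫⁻ x, ‖f x‖ₑ ^ p.toReal ∂m ≠ ⊤) : MemLp f p m :=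
  ⟨hf, by
    rw [eLpNorm_eq_lintegral_rpow_enorm_toReal h0 ht]
    exact ENNReal.rpow_lt_top_of_nonneg (by positivity) h⟩

namespace HomSobolev

variable {p : ℝ≥0∞} [Fact (1 ≤ p)]

lemma toContinuousMap_injective :
    Function.Injective (toContinuousMap : HomSobolev n p → C(Fin n → ℝ, ℝ)) :=
  Subtype.val_injective

lemma exists_of_hasWeakGradient {F : (Fin n → ℝ) → ℝ} (hF : Continuous F)
    {G : (Fin n → ℝ) → (Fin n → ℝ)} (hG : MemLp G p volume) (h : HasWeakGradient F G) :
    ∃ F' : HomSobolev n p, (toContinuousMap F' : (Fin n → ℝ) → ℝ) = F ∧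
      gradient F' = hG.toLp G := by
  have hw : HasWeakGradient (⟨F, hF⟩ : C(Fin n → ℝ, ℝ)) (hG.toLp G) := by
    intro φ hφ hs i
    refine (h φ hφ hs i).trans ?_
    congr 1
    refine integral_congr_ae ?_
    filter_upwards [hG.coeFn_toLp] with x hx
    rw [hx]
  let F' : HomSobolev n p := (⟨⟨F, hF⟩, hG.toLp G, hw⟩ : sobolevSubmodule n p)
  exact ⟨F', rfl, (hasWeakGradient_gradient F').unique hw⟩

end HomSobolev

lemma SumSpace.ofLp_injective {p : ℝ≥0∞} [Fact (1 ≤ p)] {μ : Measure (Fin n → ℝ)} :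
    Function.Injective (SumSpace.ofLp : Lp ℝ p μ → SumSpace n p μ) := by
  intro f g h
  exact Subtype.ext (congrArg (fun z : sumSubmodule n p μ => (z : (Fin n → ℝ) →ₘ[μ] ℝ)) h)

/-- Almost everywhere `f₁` = -`f₂`, so |`f₁`|^P has finite integral. By continuity a nonzero value
at x would bound it below on a ball of infinite mass. -/
lemma eq_zero_of_ae_add_eq_zero {ν : Measure (Fin n → ℝ)} {f₁ f₂ : (Fin n → ℝ) → ℝ}
    (hf₁ : Continuous f₁) {P : ℝ} (hP : 0 < P) (hf₂ : ∫⁻ x, ‖f₂ x‖ₑ ^ P ∂ν ≠ ⊤)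
    (h : ∀ᵐ x ∂ν, f₁ x + f₂ x = 0) {x : Fin n → ℝ} (hx : ∀ R > 0, ν (ball x R) = ⊤) :
    f₁ x = 0 := by
  by_contra h0
  have h1 : ∫⁻ x, ‖f₁ x‖ₑ ^ P ∂ν ≠ ⊤ := by
    convert hf₂ using 1
    refine lintegral_congr_ae (h.mono fun z hz => ?_)
    simp only
    rw [eq_neg_of_add_eq_zero_left hz, enorm_neg]
  have hpos : 0 < ‖f₁ x‖ₑ ^ P := ENNReal.rpow_pos_of_nonneg (enorm_pos.2 h0) hP.le
  obtain ⟨c, hc0, hc⟩ := exists_between hpos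
  have hev : ∀ᶠ z in nhds x, c < ‖f₁ z‖ₑ ^ P :=
    ((ENNReal.continuous_rpow_const.comp hf₁.enorm).tendsto x).eventually (lt_mem_nhds hc)
  obtain ⟨R, hR, hRs⟩ := Metric.eventually_nhds_iff_ball.1 hev
  refine h1 (top_le_iff.1 ?_)
  calc ⊤ = c * ν (ball x R) := by rw [hx R hR, ENNReal.mul_top hc0.ne']
    _ = ∫⁻ z in ball x R, c ∂ν := by rw [setLIntegral_const]
    _ ≤ ∫⁻ z in ball x R, ‖f₁ z‖ₑ ^ P ∂ν :=
        setLIntegral_mono' measurableSet_ball fun z hz => (hRs z hz).le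
    _ ≤ _ := setLIntegral_le_lintegral _ _

/-- The linear correction map. -/
lemma exists_correction_map (hn : 1 ≤ n) {p : ℝ≥0∞} [Fact (1 ≤ p)] (hnp : (n : ℝ≥0∞) < p)
    (hp : p < ⊤) :
    ∃ C : ℝ≥0, ∀ μ : Measure (Fin n → ℝ), μ ≠ 0 → ∀ t : ℝ, 0 < t →
      ∃ K : HomSobolev n p × Lp ℝ p μ →ₗ[ℝ] HomSobolev n p,
        (∀ z, ∃ u : Lp ℝ p μ, SumSpace.ofSobolev (K z) = SumSpace.ofLp u ∧
          ‖u‖ + t * ‖K z‖ ≤ C * (‖z.2‖ + t * ‖z.1‖)) ∧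
        ∀ z, SumSpace.ofSobolev z.1 + SumSpace.ofLp z.2 = (0 : SumSpace n p μ) → K z = -z.1 := by
  set P := p.toReal with hPdef
  have hp0 : p ≠ 0 := (zero_le.trans_lt hnp).ne'
  have hnP : (n : ℝ) < P := by
    rw [hPdef, ← ENNReal.toReal_natCast]
    exact (ENNReal.toReal_lt_toReal (ENNReal.natCast_ne_top n) hp.ne).2 hnp
  have hn' : (1 : ℝ) ≤ n := by exact_mod_cast hn
  have hP0 : 0 < P := by linarith
  have hP1 : 1 ≤ P := by linarith
  obtain ⟨β, hβ⟩ : ∃ β : ℝ, n + β = P := ⟨P - n, add_sub_cancel _ _⟩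
  have hβ0 : 0 < β := by linarith
  obtain ⟨B, C, hC, H⟩ := exists_partition_correction_le hn hβ0
  simp only [hβ] at H
  have hCP : C ^ (1 / P) ≠ ⊤ := ENNReal.rpow_ne_top_of_nonneg (by positivity) hC
  refine ⟨2 * (C ^ (1 / P)).toNNReal, fun μ hμ t ht => ?_⟩
  set τ := ENNReal.ofReal t
  have hτ0 : τ ≠ 0 := by simpa [τ] using ht
  have hτt : τ ≠ ⊤ := ENNReal.ofReal_ne_top
  have hτP0 : τ ^ P ≠ 0 := by simp [hτ0, hτt]
  have hτPt : τ ^ P ≠ ⊤ := ENNReal.rpow_ne_top_of_nonneg hP0.le hτt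
  -- With ν = t^(-P) μ one has ‖·‖_{L_p(μ)} = t ‖·‖_{L_p(ν)}, so the parameter t becomes a common
  -- factor of both norms and the constants do not depend on it.
  set s : ℝ≥0∞ := (τ ^ P)⁻¹
  have hs0 : s ≠ 0 := ENNReal.inv_ne_zero.2 hτPt
  have hst : s ≠ ⊤ := ENNReal.inv_ne_top.2 hτP0
  have hsτ : τ ^ P * s = 1 := ENNReal.mul_inv_cancel hτP0 hτPt
  set ν := s • μ with hν_def
  have hν : ν ≠ 0 := by
    intro h
    apply hμ
    rw [← Measure.measure_univ_eq_zero] at h ⊢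
    simpa [ν, hs0] using h
  have hae : ∀ {q : (Fin n → ℝ) → Prop}, (∀ᵐ x ∂μ, q x) → ∀ᵐ x ∂ν, q x := fun h =>
    Measure.ae_smul_measure h s
  have hlint : ∀ k : (Fin n → ℝ) → ℝ≥0∞, ∫⁻ x, k x ∂ν = s * ∫⁻ x, k x ∂μ := fun k => by
    rw [hν_def, lintegral_smul_measure, smul_eq_mul]
  obtain ⟨W, hW⟩ := H ν hν
  let c : HomSobolev n p × Lp ℝ p μ → W.centres → ℝ := fun z j =>
    W.coeff j (HomSobolev.toContinuousMap z.1) z.2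
  let k : HomSobolev n p × Lp ℝ p μ → (Fin n → ℝ) → ℝ := fun z =>
    W.correction (c z) (HomSobolev.toContinuousMap z.1)
  have hf₂ : ∀ g : Lp ℝ p μ, AEStronglyMeasurable g ν := fun g =>
    (Lp.aestronglyMeasurable g).mono_ac (Measure.smul_absolutelyContinuous)
  have hf₂' : ∀ g : Lp ℝ p μ, ∫⁻ x, ‖g x‖ₑ ^ P ∂ν = s * ‖g‖ₑ ^ P := fun g => by
    rw [hlint, Lp_enorm_rpow_eq hp0 hp.ne]
  have hf₂t : ∀ g : Lp ℝ p μ, ∫⁻ x, ‖g x‖ₑ ^ P ∂ν ≠ ⊤ := fun g => by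
    rw [hf₂' g]
    exact ENNReal.mul_ne_top hst (ENNReal.rpow_ne_top_of_nonneg hP0.le enorm_ne_top)
  have key : ∀ z : HomSobolev n p × Lp ℝ p μ, ∃ (K : HomSobolev n p) (u : Lp ℝ p μ),
      (HomSobolev.toContinuousMap K : (Fin n → ℝ) → ℝ) = k z ∧
      SumSpace.ofSobolev K = SumSpace.ofLp u ∧
      ‖u‖ + t * ‖K‖ ≤ (2 * (C ^ (1 / P)).toNNReal : ℝ≥0) * (‖z.2‖ + t * ‖z.1‖) := by
    intro z
    set G := HomSobolev.gradient z.1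
    have hGP : ∫⁻ x, ‖G x‖ₑ ^ P = ‖G‖ₑ ^ P := (Lp_enorm_rpow_eq hp0 hp.ne G).symm
    have hGt : ∫⁻ x, ‖G x‖ₑ ^ P ≠ ⊤ := by
      rw [hGP]; exact ENNReal.rpow_ne_top_of_nonneg hP0.le enorm_ne_top
    obtain ⟨h1, h2, h3, h4, h5⟩ := hW (HomSobolev.toContinuousMap z.1) z.2 G
      (HomSobolev.toContinuousMap z.1).continuous (Lp.stronglyMeasurable G).measurable
      (locallyIntegrable_coord G) (HomSobolev.hasWeakGradient_gradient z.1) hGt (hf₂ z.2)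
      (hf₂t z.2)
    rw [hGP, hf₂' z.2] at h4 h5
    have hAt : C * (‖G‖ₑ ^ P + s * ‖z.2‖ₑ ^ P) ≠ ⊤ :=
      ENNReal.mul_ne_top hC (ENNReal.add_ne_top.2
        ⟨ENNReal.rpow_ne_top_of_nonneg hP0.le enorm_ne_top, ENNReal.mul_ne_top hst
          (ENNReal.rpow_ne_top_of_nonneg hP0.le enorm_ne_top)⟩)
    have hmem := memLp_of_lintegral_rpow_ne_top hp0 hp.ne h3.aestronglyMeasurable
      (ne_top_of_le_ne_top hAt h4)
    obtain ⟨K, hK, hKG⟩ := HomSobolev.exists_of_hasWeakGradient h1 hmem h2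
    rw [hlint] at h5
    have hmem' : MemLp (k z) p μ := memLp_of_lintegral_rpow_ne_top hp0 hp.ne
      h1.aestronglyMeasurable fun htop =>
        ne_top_of_le_ne_top hAt h5 (by rw [htop, ENNReal.mul_top hs0])
    have hu : ‖hmem'.toLp (k z)‖ₑ ^ P = ∫⁻ x, ‖k z x‖ₑ ^ P ∂μ := by
      rw [Lp_enorm_rpow_eq hp0 hp.ne]
      refine lintegral_congr_ae (hmem'.coeFn_toLp.mono fun x hx => ?_)
      simp only [hx]; rfl
    have hKn : ‖HomSobolev.gradient K‖ₑ ^ P ≤ C * (‖G‖ₑ ^ P + s * ‖z.2‖ₑ ^ P) := by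
      refine le_trans (le_of_eq ?_) h4
      rw [hKG, Lp_enorm_rpow_eq hp0 hp.ne]
      refine lintegral_congr_ae (hmem.coeFn_toLp.mono fun x hx => ?_)
      simp only [hx]; rfl
    -- Multiplication by τ^P returns from ν to μ. It is used twice, for the L_p norm and for t times
    -- the gradient norm, whence the factor 2 in the constant.
    have hroot : ∀ a : ℝ≥0∞, s * a ^ P ≤ C * (‖G‖ₑ ^ P + s * ‖z.2‖ₑ ^ P) →
        a ≤ C ^ (1 / P) * (‖z.2‖ₑ + τ * ‖G‖ₑ) := by
      intro a ha
      rw [← ENNReal.rpow_le_rpow_iff hP0, ENNReal.mul_rpow_of_nonneg _ _ hP0.le, ← ENNReal.rpow_mul,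
        one_div_mul_cancel hP0.ne', ENNReal.rpow_one]
      calc a ^ P = τ ^ P * (s * a ^ P) := by rw [← mul_assoc, hsτ, one_mul]
        _ ≤ τ ^ P * (C * (‖G‖ₑ ^ P + s * ‖z.2‖ₑ ^ P)) := by gcongr
        _ = C * ((τ ^ P * s) * ‖z.2‖ₑ ^ P + τ ^ P * ‖G‖ₑ ^ P) := by ring
        _ = C * (‖z.2‖ₑ ^ P + (τ * ‖G‖ₑ) ^ P) := by
            rw [hsτ, one_mul, ENNReal.mul_rpow_of_nonneg _ _ hP0.le]
        _ ≤ _ := by gcongr; exact ENNReal.add_rpow_le_rpow_add _ _ hP1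
    have hu' := hroot ‖hmem'.toLp (k z)‖ₑ (by rw [hu]; exact h5)
    have hK' := hroot (τ * ‖HomSobolev.gradient K‖ₑ) (by
      rw [ENNReal.mul_rpow_of_nonneg _ _ hP0.le, ← mul_assoc, mul_comm s, hsτ, one_mul]
      exact hKn)
    refine ⟨K, hmem'.toLp (k z), hK, ?_, ?_⟩
    · refine Subtype.ext ?_
      exact AEEqFun.mk_eq_mk.2 (Filter.Eventually.of_forall fun x => congrFun hK x)
    · have hsum := add_le_add hu' hK'
      rw [← two_mul, ← mul_assoc, ← ofReal_norm, ← ofReal_norm (HomSobolev.gradient K), ← ofReal_norm z.2,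
        ← ofReal_norm G, ← ENNReal.coe_toNNReal hCP, ← ENNReal.ofReal_mul ht.le,
        ← ENNReal.ofReal_mul ht.le, ← ENNReal.ofReal_add (norm_nonneg _) (by positivity),
        ← ENNReal.ofReal_add (norm_nonneg _) (by positivity),
        show (2 : ℝ≥0∞) * ((C ^ (1 / P)).toNNReal : ℝ≥0∞) =
          ((2 * (C ^ (1 / P)).toNNReal : ℝ≥0) : ℝ≥0∞) by push_cast; rfl,
        ← ENNReal.ofReal_coe_nnreal, ← ENNReal.ofReal_mul (by positivity)] at hsum
      exact (ENNReal.ofReal_le_ofReal_iff (by positivity)).1 hsum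
  choose K u hKk hKu hKn using key
  -- `K` was obtained by choice, but it is determined by its continuous representative `k`, so
  -- linearity need only be checked there.
  have hK_ext : ∀ {z : HomSobolev n p × Lp ℝ p μ} {F : HomSobolev n p},
      k z = HomSobolev.toContinuousMap F → K z = F := fun {z F} h =>
    HomSobolev.toContinuousMap_injective (DFunLike.coe_injective ((hKk z).trans h))
  refine ⟨{ toFun := K, map_add' := fun z w => hK_ext ?_, map_smul' := fun a z => hK_ext ?_ },
    fun z => ⟨u z, hKu z, hKn z⟩, fun z hz => hK_ext ?_⟩
  · have hc : c (z + w) = c z + c w := by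
      ext j
      have h1 : W.coeff j (HomSobolev.toContinuousMap (z + w).1) ⇑(z + w).2 =
          W.coeff j (HomSobolev.toContinuousMap z.1 + HomSobolev.toContinuousMap w.1 :
            (Fin n → ℝ) → ℝ) (⇑z.2 + ⇑w.2) := by
        rw [Prod.fst_add, map_add, ContinuousMap.coe_add]
        exact W.coeff_congr (hae (Lp.coeFn_add z.2 w.2)) j
      exact h1.trans (W.coeff_add hβ0 hP1 (ContinuousMap.continuous _) (ContinuousMap.continuous _)
        (hf₂ _) (hf₂t _).lt_top (hf₂ _) (hf₂t _).lt_top j)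
    rw [map_add, ContinuousMap.coe_add, hKk, hKk]
    simp only [k]
    rw [hc, Prod.fst_add, map_add, ContinuousMap.coe_add]
    exact W.correction_add hν hβ0 _ _ _ _
  · have hc : c (a • z) = a • c z := by
      ext j
      have h1 : W.coeff j (HomSobolev.toContinuousMap (a • z).1) ⇑(a • z).2 =
          W.coeff j (a • (HomSobolev.toContinuousMap z.1 : (Fin n → ℝ) → ℝ)) (a • ⇑z.2) := by
        rw [Prod.smul_fst, map_smul, ContinuousMap.coe_smul]
        exact W.coeff_congr (hae (Lp.coeFn_smul a z.2)) j
      exact h1.trans (W.coeff_smul a _ _ j)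
    rw [RingHom.id_apply, map_smul, ContinuousMap.coe_smul, hKk]
    simp only [k]
    rw [hc, Prod.smul_fst, map_smul, ContinuousMap.coe_smul]
    exact W.correction_smul a _ _
  · have hz' : HomSobolev.toAEEqFun μ z.1 + (z.2 : (Fin n → ℝ) →ₘ[μ] ℝ) = 0 :=
      congrArg (fun z : sumSubmodule n p μ => (z : (Fin n → ℝ) →ₘ[μ] ℝ)) hz
    have hzμ : ∀ᵐ x ∂μ, HomSobolev.toContinuousMap z.1 x + z.2 x = 0 := by
      have h1 := AEEqFun.coeFn_add (HomSobolev.toAEEqFun μ z.1) (z.2 : (Fin n → ℝ) →ₘ[μ] ℝ)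
      rw [hz'] at h1
      have h2 : HomSobolev.toAEEqFun μ z.1 =ᵐ[μ] HomSobolev.toContinuousMap z.1 :=
        AEEqFun.coeFn_mk _ _
      filter_upwards [h1, h2, AEEqFun.coeFn_zero (α := Fin n → ℝ) (β := ℝ) (μ := μ)]
        with x hx1 hx2 hx3
      rw [hx3, Pi.add_apply, hx2] at hx1
      exact hx1.symm
    -- Independence of the decomposition on {ρ = 0}, where the correction vanishes and the first
    -- component is `z.1` itself.
    have hz0 : ∀ x, criticalRadius ν β x = 0 → HomSobolev.toContinuousMap z.1 x = 0 :=
      fun x hx => eq_zero_of_ae_add_eq_zero (ContinuousMap.continuous _) hP0 (hf₂t z.2) (hae hzμ)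
        fun R hR => criticalRadius.measure_ball_eq_top hν hβ0 hx hR
    rw [map_neg, ContinuousMap.coe_neg]
    exact W.correction_zero (fun j => W.coeff_eq_zero hz0 (hae hzμ) j) hz0

namespace SumSpace

variable {p : ℝ≥0∞} [Fact (1 ≤ p)] {μ : Measure (Fin n → ℝ)}

lemma kFunctional_le_of_decomposition {t : ℝ} (ht : 0 ≤ t) {f : SumSpace n p μ}
    {f₁ : HomSobolev n p} {f₂ : Lp ℝ p μ} (h : ofSobolev f₁ + ofLp f₂ = f) :
    kFunctional t f ≤ ‖f₂‖ + t * ‖f₁‖ :=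
  csInf_le ⟨0, by rintro r ⟨g₁, g₂, -, rfl⟩; positivity⟩ ⟨f₁, f₂, h, rfl⟩

lemma le_kFunctional {t a : ℝ} {f : SumSpace n p μ}
    (h : ∀ (f₁ : HomSobolev n p) (f₂ : Lp ℝ p μ), ofSobolev f₁ + ofLp f₂ = f →
      a ≤ ‖f₂‖ + t * ‖f₁‖) : a ≤ kFunctional t f := by
  obtain ⟨F, g, hf⟩ := exists_decomposition f
  refine le_csInf ⟨_, F, g, hf, rfl⟩ ?_
  rintro r ⟨f₁, f₂, hd, rfl⟩
  exact h f₁ f₂ hd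

lemma kFunctional_nonneg {t : ℝ} (ht : 0 ≤ t) (f : SumSpace n p μ) : 0 ≤ kFunctional t f :=
  le_kFunctional fun _ _ _ => by positivity

lemma kFunctional_le_mul_norm {t : ℝ} (ht : 0 ≤ t) (f : SumSpace n p μ) :
    kFunctional t f ≤ (1 + t) * ‖f‖ := by
  refine le_of_forall_pos_le_add fun ε hε => ?_
  have h1 : ‖f‖ < ‖f‖ + ε / (1 + t) := lt_add_of_pos_right _ (by positivity)
  obtain ⟨f₁, f₂, hd, hlt⟩ := exists_decomposition_lt h1
  refine (kFunctional_le_of_decomposition ht hd).trans ?_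
  have h2 : (1 + t) * (‖f₁‖ + ‖f₂‖) ≤ (1 + t) * (‖f‖ + ε / (1 + t)) := by gcongr
  rw [mul_add (1 + t) ‖f‖, mul_div_cancel₀ _ (by positivity : (1 + t) ≠ 0)] at h2
  nlinarith [norm_nonneg f₁, norm_nonneg f₂, mul_nonneg ht (norm_nonneg f₂)]

lemma kFunctional_one (f : SumSpace n p μ) : kFunctional 1 f = ‖f‖ := by
  rw [kFunctional, norm_def]
  congr 1
  ext r
  simp only [one_mul, add_comm]

end SumSpace

/-- Operators which realize the `K`-functional up to a constant. -/
lemma exists_quasilinearization (hn : 1 ≤ n) {p : ℝ≥0∞} [Fact (1 ≤ p)] (hnp : (n : ℝ≥0∞) < p)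
    (hp : p < ⊤) :
    ∃ C : ℝ, 0 ≤ C ∧ ∀ μ : Measure (Fin n → ℝ), μ ≠ 0 → ∀ t : ℝ, 0 < t →
      ∃ (T₁ : SumSpace n p μ →L[ℝ] HomSobolev n p) (T₂ : SumSpace n p μ →L[ℝ] Lp ℝ p μ),
        (∀ f : SumSpace n p μ, SumSpace.ofSobolev (T₁ f) + SumSpace.ofLp (T₂ f) = f) ∧
        ∀ f : SumSpace n p μ, ‖T₂ f‖ + t * ‖T₁ f‖ ≤ C * SumSpace.kFunctional t f := by
  obtain ⟨C, hC⟩ := exists_correction_map hn hnp hp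
  refine ⟨1 + C, by positivity, fun μ hμ t ht => ?_⟩
  obtain ⟨K, hK, hK0⟩ := hC μ hμ t ht
  choose u hu hun using hK
  let S : HomSobolev n p × Lp ℝ p μ →ₗ[ℝ] SumSpace n p μ :=
    LinearMap.coprod SumSpace.ofSobolev SumSpace.ofLp
  have hSa : ∀ z, S z = SumSpace.ofSobolev z.1 + SumSpace.ofLp z.2 := fun z => rfl
  have hS : LinearMap.range S = ⊤ := LinearMap.range_eq_top.2 fun f => by
    obtain ⟨F, g, hf⟩ := SumSpace.exists_decomposition f
    exact ⟨(F, g), hf⟩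
  -- An algebraic linear choice of decompositions. No continuity is needed, since the operators
  -- built from it turn out not to depend on it.
  obtain ⟨σ, hσ⟩ := S.exists_rightInverse_of_surjective hS
  have hσ' : ∀ f, SumSpace.ofSobolev (σ f).1 + SumSpace.ofLp (σ f).2 = f := fun f =>
    DFunLike.congr_fun hσ f
  have hu_eq : ∀ {z v}, SumSpace.ofSobolev (K z) = SumSpace.ofLp v → u z = v := fun {z v} h =>
    SumSpace.ofLp_injective ((hu z).symm.trans h)
  let U : HomSobolev n p × Lp ℝ p μ →ₗ[ℝ] Lp ℝ p μ :=
    { toFun := u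
      map_add' := fun z w => hu_eq (by rw [map_add, map_add, map_add, hu, hu])
      map_smul' := fun a z => hu_eq (by rw [map_smul, map_smul, map_smul, hu]; rfl) }
  have hU : ∀ z, SumSpace.ofSobolev (K z) = SumSpace.ofLp (U z) := hu
  let L₁ : SumSpace n p μ →ₗ[ℝ] HomSobolev n p := (LinearMap.fst ℝ _ _ + K) ∘ₗ σ
  let L₂ : SumSpace n p μ →ₗ[ℝ] Lp ℝ p μ := (LinearMap.snd ℝ _ _ - U) ∘ₗ σ
  have hL₁ : ∀ f, L₁ f = (σ f).1 + K (σ f) := fun f => rfl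
  have hL₂ : ∀ f, L₂ f = (σ f).2 - U (σ f) := fun f => rfl
  have hL : ∀ f, SumSpace.ofSobolev (L₁ f) + SumSpace.ofLp (L₂ f) = f := fun f => by
    rw [hL₁, hL₂, map_add, map_sub, hU]
    conv_rhs => rw [← hσ' f]
    abel
  have hbound : ∀ f, ‖L₂ f‖ + t * ‖L₁ f‖ ≤ (1 + C) * SumSpace.kFunctional t f := by
    intro f
    rw [← div_le_iff₀' (by positivity)]
    refine SumSpace.le_kFunctional fun f₁ f₂ hd => ?_
    rw [div_le_iff₀' (by positivity)]
    set z : HomSobolev n p × Lp ℝ p μ := (f₁, f₂)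
    -- Two decompositions of f differ by an element of the kernel, on which `fst + K` vanishes. So
    -- `L₁ f` may be computed from any decomposition, in particular a nearly optimal one.
    have hker := hK0 (z - σ f) (by
      rw [← hSa, map_sub, hSa, hSa, hσ', hd, sub_self])
    have e1 : L₁ f = z.1 + K z := by
      rw [map_sub, Prod.fst_sub, sub_eq_iff_eq_add] at hker
      rw [hL₁, hker]; abel
    have e2 : L₂ f = z.2 - U z := by
      refine SumSpace.ofLp_injective ?_
      have h1 := hL f
      rw [e1, map_add, hU] at h1
      rw [map_sub, eq_sub_iff_add_eq]
      have h2 : SumSpace.ofSobolev z.1 + SumSpace.ofLp z.2 = f := hd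
      rw [add_assoc] at h1
      rw [← add_left_cancel (h1.trans h2.symm), add_comm]
    have h3 := hun z
    have h4 : ‖L₂ f‖ ≤ ‖z.2‖ + ‖u z‖ := by rw [e2]; exact norm_sub_le _ _
    have h5 : t * ‖L₁ f‖ ≤ t * (‖z.1‖ + ‖K z‖) := by
      rw [e1]; gcongr; exact norm_add_le _ _
    change _ ≤ (1 + C) * (‖z.2‖ + t * ‖z.1‖)
    linarith
  have hb : ∀ f, ‖L₂ f‖ + t * ‖L₁ f‖ ≤ (1 + C) * ((1 + t) * ‖f‖) := fun f =>
    (hbound f).trans (by gcongr; exact SumSpace.kFunctional_le_mul_norm ht.le f)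
  refine ⟨L₁.mkContinuous ((1 + C) * (1 + t) / t) fun f => ?_,
    L₂.mkContinuous ((1 + C) * (1 + t)) fun f => ?_, hL, hbound⟩
  · rw [div_mul_eq_mul_div, le_div_iff₀ ht, mul_comm ‖L₁ f‖, mul_assoc]
    exact (le_add_of_nonneg_left (norm_nonneg _)).trans (hb f)
  · rw [mul_assoc]
    exact (le_add_of_nonneg_right (by positivity)).trans (hb f)

end QuasiLinearization

theorem theorem1p5 (n : ℕ) (hn : 1 ≤ n) (p : ℝ≥0∞) [Fact (1 ≤ p)] (hnp : (n : ℝ≥0∞) < p)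
    (hp : p < ⊤) :
    ∃ C : ℝ, ∀ μ : Measure (Fin n → ℝ), μ ≠ 0 →
      (∃ (T₁ : SumSpace n p μ →L[ℝ] HomSobolev n p) (T₂ : SumSpace n p μ →L[ℝ] Lp ℝ p μ),
        (∀ f : SumSpace n p μ, SumSpace.ofSobolev (T₁ f) + SumSpace.ofLp (T₂ f) = f) ∧
        ‖T₁‖ + ‖T₂‖ ≤ C) ∧
      (∀ t : ℝ, 0 < t →
        ∃ (T₁ : SumSpace n p μ →L[ℝ] HomSobolev n p) (T₂ : SumSpace n p μ →L[ℝ] Lp ℝ p μ),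
          (∀ f : SumSpace n p μ, SumSpace.ofSobolev (T₁ f) + SumSpace.ofLp (T₂ f) = f) ∧
          ∀ f : SumSpace n p μ, ‖T₂ f‖ + t * ‖T₁ f‖ ≤ C * SumSpace.kFunctional t f) := by
  obtain ⟨C, hC0, hC⟩ := exists_quasilinearization hn hnp hp
  -- At t = 1 the K-functional is the norm of Σ, so each operator norm is at most C and their sum at
  -- most 2C.
  refine ⟨2 * C, fun μ hμ => ⟨?_, fun t ht => ?_⟩⟩
  · obtain ⟨T₁, T₂, hT, hb⟩ := hC μ hμ 1 one_pos
    refine ⟨T₁, T₂, hT, ?_⟩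
    have h1 : ‖T₁‖ ≤ C := T₁.opNorm_le_bound hC0 fun f => by
      rw [← SumSpace.kFunctional_one f]
      linarith [hb f, norm_nonneg (T₂ f)]
    have h2 : ‖T₂‖ ≤ C := T₂.opNorm_le_bound hC0 fun f => by
      rw [← SumSpace.kFunctional_one f]
      linarith [hb f, norm_nonneg (T₁ f)]
    linarith
  · obtain ⟨T₁, T₂, hT, hb⟩ := hC μ hμ t ht
    refine ⟨T₁, T₂, hT, fun f => (hb f).trans ?_⟩
    have := mul_nonneg hC0 (SumSpace.kFunctional_nonneg ht.le f)
    linarith
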